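/- Let $d\ge 1$ be an integer and let $\frac4d<p_1<p_0$ be real numbers. For $u\in X:=H^1(\mathbb R^d;\mathbb C)\cap L^{p_0+2}(\mathbb R^d;\mathbb C)$ put $$M(u)=\int_{\mathbb R^d}|u|^2,\qquad E(u)=\int_{\mathbb R^d}|\nabla u|^2-\frac{2}{p_1+2}|u|^{p_1+2}+\frac{2}{p_0+2}|u|^{p_0+2},$$ $$\Phi(u)=\int_{\mathbb R^d}|\nabla u|^2-\frac{dp_1}{2(p_1+2)}|u|^{p_1+2}+\frac{dp_0}{2(p_0+2)}|u|^{p_0+2}.$$ For $m\ge 0$ let $$I(m)=\inf\{E(u):u\in X,\ M(u)=m\},\qquad I^\Phi(m)=\inf\{E(u):u\in X,\ M(u)=m,\ \Phi(u)=0\},$$ with $I^\Phi(m)=\infty$ if there is no such $u$. Let $$m_c=\sup\{m\ge 0: I(m)=0\},\qquad \tilde m_c=\Big(\frac{p_0}{p_1}\Big)^{\frac{p_1d-4}{2(p_0-p_1)}}\Big(\frac{4}{dp_1}\Big)^{\frac d2}m_c .$$ Then $0<m_c<\infty$, $I(m)=0$ for $0\le m\le m_c$, and $I(m)<0$ for $m>m_c$.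 Moreover: 1. If $u\in X$ satisfies $0<M(u)<m_c$ and $0<E(u)<I^\Phi(M(u))$, then $\Phi(u)>0$. 2. $I^\Phi(m)=\infty$ for $0<m<\tilde m_c$. 3. $0<I^\Phi(m)<\infty$ for $\tilde m_c\le m<m_c$. 4. $I^\Phi(m)=I(m)$ for $m\ge m_c$. 5. $I^\Phi$ is nonincreasing on $[\tilde m_c,\infty)$. 6. If $d\in\{1,2,3,4\}$, or $d\ge5$ and $p_0\le\frac{4}{d-2}$, then for every $m\ge\tilde m_c$ the infimum $I^\Phi(m)$ is attained, that is, there is $u\in X$ with $M(u)=m$, $\Phi(u)=0$ and $E(u)=I^\Phi(m)$; and $I^\Phi$ is strictly decreasing and lower semicontinuous on $[\tilde m_c,\infty)$. -/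

import Mathlib

open MeasureTheory
open scoped ENNReal

namespace DoublePowerNLS

noncomputable section

/-- `Space d` is `ℝ^d` with its Euclidean norm and Lebesgue measure. -/
abbrev Space (d : ℕ) : Type := EuclideanSpace ℝ (Fin d)

/-- `v` is a weak `i`-th partial derivative of `u` on `ℝ^d`:
`∫ ∂ᵢφ u = - ∫ φ v` for all real test functions `φ ∈ C_c^∞(ℝ^d)`. -/
def IsWeakPartial {d : ℕ} (i : Fin d) (u v : Space d → ℂ) : Prop :=
  ∀ φ : Space d → ℝ, ContDiff ℝ (⊤ : ℕ∞) φ → HasCompactSupport φ →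
    ∫ x, (fderiv ℝ φ x (EuclideanSpace.single i 1)) • u x = - ∫ x, φ x • v x

/-- The complex Sobolev space `H¹(ℝ^d)`: `u ∈ L²`, with weak partial derivatives in `L²`. -/
def MemH1 {d : ℕ} (u : Space d → ℂ) : Prop :=
  MemLp u 2 volume ∧ ∀ i : Fin d, ∃ v : Space d → ℂ, MemLp v 2 volume ∧ IsWeakPartial i u v

open Classical in
/-- The weak partial derivative `∂ᵢu`: some square-integrable weak partial derivative of `u`
(unique up to null sets, see `weakPartial_ae_eq`), and `0` if there is none. -/
def weakPartial {d : ℕ} (i : Fin d) (u : Space d → ℂ) : Space d → ℂ :=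
  if h : ∃ v : Space d → ℂ, MemLp v 2 volume ∧ IsWeakPartial i u v then h.choose else 0

theorem weakPartial_spec {d : ℕ} {i : Fin d} {u v : Space d → ℂ}
    (hv : MemLp v 2 volume) (h : IsWeakPartial i u v) :
    MemLp (weakPartial i u) 2 volume ∧ IsWeakPartial i u (weakPartial i u) := by
  have hex : ∃ v : Space d → ℂ, MemLp v 2 volume ∧ IsWeakPartial i u v := ⟨v, hv, h⟩
  rw [weakPartial, dif_pos hex]
  exact hex.choose_spec

/-- Square-integrable weak derivatives are unique almost everywhere, so that `weakPartial` does not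
depend on the choice made in its definition. -/
theorem weakPartial_ae_eq {d : ℕ} {i : Fin d} {u v : Space d → ℂ}
    (hv : MemLp v 2 volume) (h : IsWeakPartial i u v) : weakPartial i u =ᵐ[volume] v := by
  obtain ⟨hw, hw'⟩ := weakPartial_spec hv h
  refine ae_eq_of_integral_contDiff_smul_eq (hw.locallyIntegrable (by norm_num))
    (hv.locallyIntegrable (by norm_num)) fun φ hφ hc => ?_
  have h1 := h φ hφ hc
  rw [hw' φ hφ hc] at h1
  exact neg_injective h1

/-- The space `H¹(ℝ^d) ∩ L^{p₀+2}(ℝ^d)`. -/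
def MemX {d : ℕ} (p₀ : ℝ) (u : Space d → ℂ) : Prop :=
  MemH1 u ∧ MemLp u (ENNReal.ofReal (p₀ + 2)) volume

/-- The mass `M(u) = ∫ |u|²`. -/
def mass {d : ℕ} (u : Space d → ℂ) : ℝ := ∫ x, ‖u x‖ ^ 2

/-- The kinetic term `∫ |∇u|²`. -/
def gradSq {d : ℕ} (u : Space d → ℂ) : ℝ := ∫ x, ∑ i : Fin d, ‖weakPartial i u x‖ ^ 2

/-- `∫ |u|^{p+2}`. -/
def powInt {d : ℕ} (p : ℝ) (u : Space d → ℂ) : ℝ := ∫ x, ‖u x‖ ^ (p + 2)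

/-- The energy `E(u)`. -/
def energy {d : ℕ} (p₀ p₁ : ℝ) (u : Space d → ℂ) : ℝ :=
  gradSq u - 2 / (p₁ + 2) * powInt p₁ u + 2 / (p₀ + 2) * powInt p₀ u

/-- The virial functional `Φ(u)`. -/
def virial {d : ℕ} (p₀ p₁ : ℝ) (u : Space d → ℂ) : ℝ :=
  gradSq u - d * p₁ / (2 * (p₁ + 2)) * powInt p₁ u + d * p₀ / (2 * (p₀ + 2)) * powInt p₀ u

/-- `I(m) = inf {E(u) : u ∈ H¹ ∩ L^{p₀+2}, M(u) = m}`, as an extended real. -/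
def minEnergy (d : ℕ) (p₀ p₁ m : ℝ) : EReal :=
  sInf {e : EReal | ∃ u : Space d → ℂ, MemX p₀ u ∧ mass u = m ∧ e = (energy p₀ p₁ u : EReal)}

/-- `I^Φ(m) = inf {E(u) : u ∈ H¹ ∩ L^{p₀+2}, M(u) = m, Φ(u) = 0}`, as an extended real;
it is `∞` if there is no such `u`. -/
def minVirialEnergy (d : ℕ) (p₀ p₁ m : ℝ) : EReal :=
  sInf {e : EReal | ∃ u : Space d → ℂ,
    MemX p₀ u ∧ mass u = m ∧ virial p₀ p₁ u = 0 ∧ e = (energy p₀ p₁ u : EReal)}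

/-- The critical mass `m_c`: the largest `m ≥ 0` with `I(m) = 0`. -/
def criticalMass (d : ℕ) (p₀ p₁ : ℝ) : ℝ :=
  sSup {m : ℝ | 0 ≤ m ∧ minEnergy d p₀ p₁ m = 0}

/-- The rescaled critical mass
`m̃_c = (p₀/p₁)^((p₁ d - 4)/(2(p₀ - p₁))) (4/(d p₁))^(d/2) m_c`. -/
def criticalMassTilde (d : ℕ) (p₀ p₁ : ℝ) : ℝ :=
  (p₀ / p₁) ^ ((p₁ * d - 4) / (2 * (p₀ - p₁))) * (4 / (d * p₁)) ^ ((d : ℝ) / 2)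
    * criticalMass d p₀ p₁

end

end DoublePowerNLS

open MeasureTheory
open scoped ENNReal

namespace DoublePowerNLS

noncomputable section

open Filter Topology

variable {d : ℕ}

/-! Write G = ∫|∇u|², a = `pot p₁ u`, b = `pot p₀ u`, α = dp₁/4 and β = dp₀/4, so that E = G - a + b
and Φ = G - αa + βb with 1 < α < β. Three scalings drive the argument. The mass-preserving scaling
turns E into tG - t^α a + t^β b, and the derivative of this curve is 1/t times the virial of the
scaled function. It is positive for large t, so a function with Φ < 0 can be moved to one with Φ = 0
and smaller energy: the constraint Φ = 0 may be relaxed to Φ ≤ 0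
(`exists_virial_eq_zero_of_nonpos`), which already forces Φ > 0 below the level I^Φ. Since α > 1 the
curve is positive near t = 0, so a function of negative energy also has a critical point of no
larger energy on its curve; hence I^Φ = I above m_c. The dilation that multiplies the mass by θ > 1
multiplies a and b by θ but G only by θ^(1-2/d). Energy and virial per unit mass therefore drop,
which gives coercivity of E below m_c (`energy_ge_of_mass_lt`), strict subadditivity
(`energy_gt_of_mass_lt`) and, with mass spread out at no cost (`exists_add_mass`), monotonicity of
I^Φ. A change of amplitude and length turns Φ into a positive multiple of E and m̃_c into m_c
(`exists_virial_scaling`). So Φ > 0 below m̃_c, and a zero-energy function at m_c yields a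
zero-virial function at m̃_c.

Existence rests on concentration compactness. Ball averages give a weak-type Gagliardo–Nirenberg
inequality, and from it a lower bound on G when Φ ≤ 0 (`exists_gradSq_lower_bound`); this excludes
vanishing. A weak limit w then splits off a remainder, with mass, energy and virial asymptotically
additive (`exists_profile`). For m ≥ m_c strict subadditivity excludes splitting. For m < m_c one of
the two pieces has Φ ≤ 0 and no more energy than the limit, which yields a minimizer of mass at most
m. It remains to exclude mass strictly below m (`IsVirialMinimal.false`). With a slack mass
constraint the dilation gives 2G ≤ dE, so the multiplier of Φ is nonnegative, and the Euler–Lagrange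
equation has no mass term. If d ≤ 4, the modulus U of the minimizer is bounded by the zero K of the
nonlinearity, hence superharmonic, nonnegative and in L²; testing with wide cutoffs contradicts G >
0. If d ≥ 5 and p₀ ≤ 4/(d-2), the relations 2G ≤ dE and Φ = 0 are already incompatible. The same
exclusion gives strict monotonicity. -/

/-! ### Integrability against test functions and basic properties of the functionals. -/

theorem memLp_two_of_test {F : Type*} [NormedAddCommGroup F] {φ : Space d → F} (hφ : Continuous φ)
    (hc : HasCompactSupport φ) (p : ℝ≥0∞) : MemLp φ p volume :=
  hφ.memLp_of_hasCompactSupport hc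

theorem integrable_test_smul {φ : Space d → ℝ} (hφ : Continuous φ) (hc : HasCompactSupport φ)
    {u : Space d → ℂ} (hu : MemLp u 2 volume) : Integrable (fun x => φ x • u x) volume :=
  (hu.locallyIntegrable (by norm_num)).integrable_smul_left_of_hasCompactSupport hφ hc

theorem continuous_fderiv_apply_of_contDiff {φ : Space d → ℝ} (hφ : ContDiff ℝ (⊤ : ℕ∞) φ)
    (y : Space d) : Continuous fun x => fderiv ℝ φ x y :=
  (hφ.continuous_fderiv (by simp)).clm_apply continuous_const

theorem contDiff_fderiv_apply {φ : Space d → ℝ} (hφ : ContDiff ℝ (⊤ : ℕ∞) φ)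
    (y : Space d) : ContDiff ℝ (⊤ : ℕ∞) fun x => fderiv ℝ φ x y :=
  (hφ.fderiv_right (m := (⊤ : ℕ∞)) (by simp)).clm_apply contDiff_const

theorem integrable_fderiv_test_smul {φ : Space d → ℝ} (hφ : ContDiff ℝ (⊤ : ℕ∞) φ)
    (hc : HasCompactSupport φ) (y : Space d)
    {u : Space d → ℂ} (hu : MemLp u 2 volume) :
    Integrable (fun x => fderiv ℝ φ x y • u x) volume :=
  integrable_test_smul (continuous_fderiv_apply_of_contDiff hφ y) (hc.fderiv_apply (𝕜 := ℝ) y) hu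

theorem MemH1.weakPartial_memLp {u : Space d → ℂ} (hu : MemH1 u) (i : Fin d) :
    MemLp (weakPartial i u) 2 volume :=
  let ⟨_, hv, h⟩ := hu.2 i
  (weakPartial_spec hv h).1

theorem MemH1.isWeakPartial {u : Space d → ℂ} (hu : MemH1 u) (i : Fin d) :
    IsWeakPartial i u (weakPartial i u) :=
  let ⟨_, hv, h⟩ := hu.2 i
  (weakPartial_spec hv h).2

/-- Frees gradient computations from the chosen representative: any square-integrable weak
derivatives will do, by uniqueness almost everywhere. -/
theorem gradSq_eq_of_weakPartial {u : Space d → ℂ} {v : Fin d → Space d → ℂ}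
    (hv : ∀ i, MemLp (v i) 2 volume) (h : ∀ i, IsWeakPartial i u (v i)) :
    gradSq u = ∫ x, ∑ i : Fin d, ‖v i x‖ ^ 2 := by
  refine integral_congr_ae ?_
  filter_upwards [ae_all_iff.2 fun i => weakPartial_ae_eq (hv i) (h i)] with x hx
  simp [hx]

theorem mass_congr_ae {u u' : Space d → ℂ} (huu' : u =ᵐ[volume] u') : mass u' = mass u := by
  refine integral_congr_ae ?_
  filter_upwards [huu'] with x hx
  rw [hx]

theorem mass_nonneg (u : Space d → ℂ) : 0 ≤ mass u := integral_nonneg fun _ => by positivity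
theorem gradSq_nonneg (u : Space d → ℂ) : 0 ≤ gradSq u := integral_nonneg fun _ => by positivity
theorem powInt_nonneg (p : ℝ) (u : Space d → ℂ) : 0 ≤ powInt p u :=
  integral_nonneg fun _ => by positivity

theorem MemLp.integrable_norm_sq {u : Space d → ℂ} (hu : MemLp u 2 volume) :
    Integrable (fun x => ‖u x‖ ^ 2) volume := by
  simpa using hu.integrable_norm_pow (by norm_num)

theorem memLp_two_iff_integrable_norm_sq {u : Space d → ℂ} (hm : AEStronglyMeasurable u volume) :
    MemLp u 2 volume ↔ Integrable (fun x => ‖u x‖ ^ 2) volume :=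
  memLp_two_iff_integrable_sq_norm hm

theorem integrable_norm_rpow_iff_memLp {u : Space d → ℂ} (hm : AEStronglyMeasurable u volume)
    {q : ℝ} (hq : 0 < q) :
    Integrable (fun x => ‖u x‖ ^ q) volume ↔ MemLp u (ENNReal.ofReal q) volume := by
  have := integrable_norm_rpow_iff (p := ENNReal.ofReal q) hm (by simpa using hq) (by simp)
  rwa [ENNReal.toReal_ofReal hq.le] at this

theorem MemX.integrable_pow {p₀ : ℝ} (hp : 0 < p₀) {u : Space d → ℂ} (hu : MemX p₀ u) :
    Integrable (fun x => ‖u x‖ ^ (p₀ + 2)) volume :=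
  (integrable_norm_rpow_iff_memLp hu.1.1.1 (by linarith)).2 hu.2

theorem gradSq_eq_sum {u : Space d → ℂ} (hu : MemH1 u) :
    gradSq u = ∑ i, ∫ x, ‖weakPartial i u x‖ ^ 2 :=
  integral_finsetSum _ fun i _ => MemLp.integrable_norm_sq (hu.weakPartial_memLp i)

/-! ### Linear structure -/

theorem IsWeakPartial.add {i : Fin d} {u u' v v' : Space d → ℂ} (h : IsWeakPartial i u v)
    (h' : IsWeakPartial i u' v') (hu : MemLp u 2 volume) (hu' : MemLp u' 2 volume)
    (hv : MemLp v 2 volume) (hv' : MemLp v' 2 volume) :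
    IsWeakPartial i (u + u') (v + v') := by
  intro φ hφ hc
  simp only [Pi.add_apply, smul_add]
  rw [integral_add (integrable_fderiv_test_smul hφ hc _ hu)
    (integrable_fderiv_test_smul hφ hc _ hu'),
    integral_add (integrable_test_smul hφ.continuous hc hv)
      (integrable_test_smul hφ.continuous hc hv'), h φ hφ hc, h' φ hφ hc, neg_add]

theorem IsWeakPartial.const_smul {i : Fin d} {u v : Space d → ℂ} (h : IsWeakPartial i u v)
    (c : ℂ) : IsWeakPartial i (c • u) (c • v) := by
  intro φ hφ hc
  simp only [Pi.smul_apply, smul_comm _ c]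
  rw [integral_smul, integral_smul, h φ hφ hc, smul_neg]

theorem MemH1.add {u u' : Space d → ℂ} (hu : MemH1 u) (hu' : MemH1 u') : MemH1 (u + u') :=
  ⟨hu.1.add hu'.1, fun i => ⟨_, (hu.weakPartial_memLp i).add (hu'.weakPartial_memLp i),
    (hu.isWeakPartial i).add (hu'.isWeakPartial i) hu.1 hu'.1 (hu.weakPartial_memLp i)
      (hu'.weakPartial_memLp i)⟩⟩

theorem MemH1.const_smul {u : Space d → ℂ} (hu : MemH1 u) (c : ℂ) : MemH1 (c • u) :=
  ⟨hu.1.const_smul c, fun i => ⟨_, (hu.weakPartial_memLp i).const_smul c,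
    (hu.isWeakPartial i).const_smul c⟩⟩

theorem MemX.add {p : ℝ} {u u' : Space d → ℂ} (hu : MemX p u) (hu' : MemX p u') :
    MemX p (u + u') := ⟨hu.1.add hu'.1, hu.2.add hu'.2⟩

theorem MemX.const_smul {p : ℝ} {u : Space d → ℂ} (hu : MemX p u) (c : ℂ) : MemX p (c • u) :=
  ⟨hu.1.const_smul c, hu.2.const_smul c⟩

/-- The real `L²` inner product of two complex functions. -/
def inner2 (f g : Space d → ℂ) : ℝ := ∫ x, inner ℝ (f x) (g x)

/-- The real inner product of the gradients of `u` and `w`. -/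
def gradInner (u w : Space d → ℂ) : ℝ := ∑ i, inner2 (weakPartial i u) (weakPartial i w)

theorem integrable_inner {f g : Space d → ℂ} (hf : MemLp f 2 volume) (hg : MemLp g 2 volume) :
    Integrable (fun x => inner ℝ (f x) (g x)) volume := by
  have h := L2.integrable_inner (𝕜 := ℝ) (hf.toLp f) (hg.toLp g)
  refine h.congr ?_
  filter_upwards [hf.coeFn_toLp, hg.coeFn_toLp] with x h1 h2
  rw [h1, h2]

theorem integral_norm_sq_add_smul {f g : Space d → ℂ} (hf : MemLp f 2 volume)
    (hg : MemLp g 2 volume) (c : ℝ) :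
    ∫ x, ‖(f + (c : ℂ) • g) x‖ ^ 2 =
      (∫ x, ‖f x‖ ^ 2) + 2 * c * inner2 f g + c ^ 2 * ∫ x, ‖g x‖ ^ 2 := by
  have e : ∀ x, ‖(f + (c : ℂ) • g) x‖ ^ 2 =
      ‖f x‖ ^ 2 + 2 * c * inner ℝ (f x) (g x) + c ^ 2 * ‖g x‖ ^ 2 := by
    intro x
    have : ((c : ℂ) • g) x = c • g x := by simp
    rw [Pi.add_apply, this, norm_add_sq_real, inner_smul_right, norm_smul, mul_pow]
    simp
    ring
  simp_rw [e]
  have h1 := MemLp.integrable_norm_sq hf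
  have h2 := (integrable_inner hf hg).const_mul (2 * c)
  have h3 := (MemLp.integrable_norm_sq hg).const_mul (c ^ 2)
  rw [integral_add (f := fun x => ‖f x‖ ^ 2 + 2 * c * inner ℝ (f x) (g x)) (h1.add h2) h3,
    integral_add h1 h2, integral_const_mul, integral_const_mul]
  rfl

theorem mass_add_smul {u w : Space d → ℂ} (hu : MemH1 u) (hw : MemH1 w) (c : ℝ) :
    mass (u + (c : ℂ) • w) = mass u + 2 * c * inner2 u w + c ^ 2 * mass w :=
  integral_norm_sq_add_smul hu.1 hw.1 c

theorem gradSq_add_smul {u w : Space d → ℂ} (hu : MemH1 u) (hw : MemH1 w) (c : ℝ) :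
    gradSq (u + (c : ℂ) • w) = gradSq u + 2 * c * gradInner u w + c ^ 2 * gradSq w := by
  have hv := fun i => (hu.weakPartial_memLp i).add ((hw.weakPartial_memLp i).const_smul (c : ℂ))
  rw [gradSq_eq_of_weakPartial hv fun i =>
      (hu.isWeakPartial i).add ((hw.isWeakPartial i).const_smul _) hu.1 (hw.1.const_smul _)
        (hu.weakPartial_memLp i) ((hw.weakPartial_memLp i).const_smul _),
    integral_finsetSum _ fun i _ => MemLp.integrable_norm_sq (hv i)]
  rw [gradSq_eq_sum hu, gradSq_eq_sum hw, gradInner, Finset.mul_sum, Finset.mul_sum,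
    ← Finset.sum_add_distrib, ← Finset.sum_add_distrib]
  refine Finset.sum_congr rfl fun i _ => ?_
  exact integral_norm_sq_add_smul (hu.weakPartial_memLp i) (hw.weakPartial_memLp i) c

theorem gradInner_self {u : Space d → ℂ} (hu : MemH1 u) : gradInner u u = gradSq u := by
  rw [gradSq_eq_sum hu]
  simp [gradInner, inner2]

theorem powInt_const_smul (p : ℝ) (c : ℂ) (u : Space d → ℂ) :
    powInt p (c • u) = ‖c‖ ^ (p + 2) * powInt p u := by
  simp only [powInt, Pi.smul_apply, norm_smul]
  rw [← integral_const_mul]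
  refine integral_congr_ae (ae_of_all _ fun x => ?_)
  exact Real.mul_rpow (norm_nonneg _) (norm_nonneg _)

/-! ### Test functions -/

theorem isWeakPartial_ofReal_test (i : Fin d) {φ : Space d → ℝ} (hφ : ContDiff ℝ (⊤ : ℕ∞) φ)
    (hc : HasCompactSupport φ) :
    IsWeakPartial i (fun x => (φ x : ℂ))
      (fun x => ((fderiv ℝ φ x (EuclideanSpace.single i 1) : ℝ) : ℂ)) := by
  intro ψ hψ hcψ
  have e1 : ∀ x, (fderiv ℝ ψ x (EuclideanSpace.single i 1)) • (φ x : ℂ)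
      = ((fderiv ℝ ψ x (EuclideanSpace.single i 1) * φ x : ℝ) : ℂ) := by intro x; simp
  have e2 : ∀ x, ψ x • ((fderiv ℝ φ x (EuclideanSpace.single i 1) : ℝ) : ℂ)
      = ((ψ x * fderiv ℝ φ x (EuclideanSpace.single i 1) : ℝ) : ℂ) := by intro x; simp
  simp_rw [e1, e2]
  rw [integral_complex_ofReal, integral_complex_ofReal,
    integral_mul_fderiv_eq_neg_fderiv_mul_of_integrable, Complex.ofReal_neg, neg_neg]
  · exact ((continuous_fderiv_apply_of_contDiff hψ _).mul hφ.continuous).integrable_of_hasCompactSupport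
      (hc.mul_left)
  · exact (hψ.continuous.mul (continuous_fderiv_apply_of_contDiff hφ _)).integrable_of_hasCompactSupport
      (hcψ.mul_right)
  · exact (hψ.continuous.mul hφ.continuous).integrable_of_hasCompactSupport (hcψ.mul_right)
  · exact fun x _ => hψ.differentiable (by simp) x
  · exact fun x _ => hφ.differentiable (by simp) x

theorem hasCompactSupport_ofReal {φ : Space d → ℝ} (hc : HasCompactSupport φ) :
    HasCompactSupport fun x => (φ x : ℂ) :=
  hc.comp_left (g := fun r : ℝ => (r : ℂ)) (by simp)

theorem memX_ofReal_test (p : ℝ) {φ : Space d → ℝ} (hφ : ContDiff ℝ (⊤ : ℕ∞) φ)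
    (hc : HasCompactSupport φ) : MemX p (fun x => (φ x : ℂ)) := by
  have h := memLp_two_of_test (Complex.continuous_ofReal.comp hφ.continuous)
    (hasCompactSupport_ofReal hc)
  refine ⟨⟨h 2, fun i => ⟨_, ?_, isWeakPartial_ofReal_test i hφ hc⟩⟩, h _⟩
  exact memLp_two_of_test
    (Complex.continuous_ofReal.comp (continuous_fderiv_apply_of_contDiff hφ _))
    (hasCompactSupport_ofReal (hc.fderiv_apply (𝕜 := ℝ) _)) 2

/-! ### Scaling and translation -/

theorem aestronglyMeasurable_comp_smul {u : Space d → ℂ} (hu : AEStronglyMeasurable u volume)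
    {l : ℝ} (hl : 0 < l) : AEStronglyMeasurable (fun x => u (l • x)) volume := by
  refine hu.comp_quasiMeasurePreserving (f := fun x => l • x) ⟨measurable_const_smul l, ?_⟩
  rw [Measure.map_addHaar_smul _ hl.ne']
  exact Measure.smul_absolutelyContinuous

theorem integral_comp_smul_space {F : Type*} [NormedAddCommGroup F] [NormedSpace ℝ F]
    (f : Space d → F) {l : ℝ} (hl : 0 < l) :
    ∫ x, f (l • x) = (l ^ (-(d : ℝ))) • ∫ x, f x := by
  rw [Measure.integral_comp_smul_of_nonneg _ _ _ (hR := hl.le), finrank_euclideanSpace_fin,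
    Real.rpow_neg hl.le, Real.rpow_natCast]

theorem memLp_two_comp_smul {u : Space d → ℂ} (hu : MemLp u 2 volume)
    {l : ℝ} (hl : 0 < l) : MemLp (fun x => u (l • x)) 2 volume := by
  rw [memLp_two_iff_integrable_norm_sq (aestronglyMeasurable_comp_smul hu.1 hl)]
  exact (MemLp.integrable_norm_sq hu).comp_smul hl.ne'

theorem memLp_comp_smul {u : Space d → ℂ} {q : ℝ} (hq : 0 < q)
    (hu : MemLp u (ENNReal.ofReal q) volume)
    {l : ℝ} (hl : 0 < l) : MemLp (fun x => u (l • x)) (ENNReal.ofReal q) volume := by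
  rw [← integrable_norm_rpow_iff_memLp (aestronglyMeasurable_comp_smul hu.1 hl) hq]
  exact ((integrable_norm_rpow_iff_memLp hu.1 hq).2 hu).comp_smul hl.ne'

theorem IsWeakPartial.comp_smul {i : Fin d} {u v : Space d → ℂ} (h : IsWeakPartial i u v)
    {l : ℝ} (hl : 0 < l) :
    IsWeakPartial i (fun x => u (l • x)) (fun x => (l : ℂ) • v (l • x)) := by
  intro φ hφ hc
  set ψ : Space d → ℝ := fun y => φ (l⁻¹ • y) with hψ
  have hψd : ContDiff ℝ (⊤ : ℕ∞) ψ := hφ.comp (contDiff_const_smul _)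
  have hψc : HasCompactSupport ψ := hc.comp_smul (inv_ne_zero hl.ne')
  have hd : ∀ x, fderiv ℝ ψ (l • x) (EuclideanSpace.single i 1)
      = l⁻¹ * fderiv ℝ φ x (EuclideanSpace.single i 1) := by
    intro x
    rw [hψ, fderiv_comp_smul]
    simp [smul_smul, hl.ne']
  have h1 := h ψ hψd hψc
  have h2 : ∫ x, (fderiv ℝ φ x (EuclideanSpace.single i 1)) • u (l • x) =
      l • ∫ x, (fderiv ℝ ψ (l • x) (EuclideanSpace.single i 1)) • u (l • x) := by
    rw [← integral_smul]
    refine integral_congr_ae (ae_of_all _ fun x => ?_)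
    simp only [hd, smul_smul]
    rw [← mul_assoc, mul_inv_cancel₀ hl.ne', one_mul]
  have h3 : ∫ x, φ x • (l : ℂ) • v (l • x) = l • ∫ x, ψ (l • x) • v (l • x) := by
    rw [← integral_smul]
    refine integral_congr_ae (ae_of_all _ fun x => ?_)
    simp only [hψ, smul_smul, inv_mul_cancel₀ hl.ne', one_smul]
    simp only [Complex.real_smul, smul_eq_mul, Complex.ofReal_mul]
    ring
  rw [h2, h3, integral_comp_smul_space (fun y => (fderiv ℝ ψ y _) • u y) hl,
    integral_comp_smul_space (fun y => ψ y • v y) hl, h1]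
  simp

/-- The rescaled function `x ↦ c u(l x)`. -/
def rescale (c l : ℝ) (u : Space d → ℂ) : Space d → ℂ := (c : ℂ) • fun x => u (l • x)

theorem MemH1.comp_smul {u : Space d → ℂ} (hu : MemH1 u) {l : ℝ} (hl : 0 < l) :
    MemH1 fun x => u (l • x) :=
  ⟨memLp_two_comp_smul hu.1 hl, fun i => ⟨_,
    (memLp_two_comp_smul (hu.weakPartial_memLp i) hl).const_smul (l : ℂ),
    (hu.isWeakPartial i).comp_smul hl⟩⟩

theorem MemX.rescale {p : ℝ} (hp : 0 < p) {u : Space d → ℂ} (hu : MemX p u) (c : ℝ) {l : ℝ}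
    (hl : 0 < l) : MemX p (rescale c l u) :=
  ⟨(hu.1.comp_smul hl).const_smul _, (memLp_comp_smul (by linarith) hu.2 hl).const_smul _⟩

theorem mass_rescale (u : Space d → ℂ) (c : ℝ) {l : ℝ} (hl : 0 < l) :
    mass (rescale c l u) = c ^ 2 * l ^ (-(d : ℝ)) * mass u := by
  simp only [mass, rescale, Pi.smul_apply, norm_smul, mul_pow]
  rw [integral_const_mul, integral_comp_smul_space (fun x => ‖u x‖ ^ 2) hl]
  simp [mul_assoc]

theorem powInt_rescale (p : ℝ) (u : Space d → ℂ) {c l : ℝ} (hc : 0 ≤ c) (hl : 0 < l) :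
    powInt p (rescale c l u) = c ^ (p + 2) * l ^ (-(d : ℝ)) * powInt p u := by
  rw [rescale, powInt_const_smul, powInt, integral_comp_smul_space (fun x => ‖u x‖ ^ (p + 2)) hl]
  simp [powInt, mul_assoc, abs_of_nonneg hc]

theorem gradSq_rescale {u : Space d → ℂ} (hu : MemH1 u) (c : ℝ) {l : ℝ} (hl : 0 < l) :
    gradSq (rescale c l u) = c ^ 2 * l ^ (2 - (d : ℝ)) * gradSq u := by
  have hv := fun i => ((memLp_two_comp_smul (hu.weakPartial_memLp i) hl).const_smul
    (l : ℂ)).const_smul (c : ℂ)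
  rw [rescale, gradSq_eq_of_weakPartial hv fun i =>
      ((hu.isWeakPartial i).comp_smul hl).const_smul (c : ℂ)]
  have e : ∀ x, ∑ i, ‖((c : ℂ) • (l : ℂ) • fun x => weakPartial i u (l • x)) x‖ ^ 2
      = c ^ 2 * l ^ 2 * ∑ i, ‖weakPartial i u (l • x)‖ ^ 2 := by
    intro x
    rw [Finset.mul_sum]
    refine Finset.sum_congr rfl fun i _ => ?_
    simp [mul_pow]
    ring
  calc _ = ∫ x, c ^ 2 * l ^ 2 * ∑ i, ‖weakPartial i u (l • x)‖ ^ 2 :=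
        integral_congr_ae (ae_of_all _ fun x => e x)
    _ = _ := by
      rw [integral_const_mul, integral_comp_smul_space (fun x => ∑ i, ‖weakPartial i u x‖ ^ 2) hl,
        sub_eq_add_neg, Real.rpow_add hl]
      simp [gradSq]
      ring

theorem IsWeakPartial.comp_add {i : Fin d} {u v : Space d → ℂ} (h : IsWeakPartial i u v)
    (y : Space d) : IsWeakPartial i (fun x => u (x + y)) (fun x => v (x + y)) := by
  intro φ hφ hc
  have h1 := h (fun x => φ (x - y)) (hφ.comp (contDiff_id.sub contDiff_const))
    (hc.comp_homeomorph (Homeomorph.subRight y))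
  rw [← integral_add_right_eq_self _ y, ← integral_add_right_eq_self (fun x => _ • v x) y] at h1
  simpa [fderiv_comp_sub] using h1

theorem memLp_comp_add {u : Space d → ℂ} {q : ℝ≥0∞} (hu : MemLp u q volume) (y : Space d) :
    MemLp (fun x => u (x + y)) q volume :=
  hu.comp_measurePreserving (measurePreserving_add_right volume y)

theorem MemH1.comp_add {u : Space d → ℂ} (hu : MemH1 u) (y : Space d) :
    MemH1 fun x => u (x + y) :=
  ⟨memLp_comp_add hu.1 y, fun i => ⟨_, memLp_comp_add (hu.weakPartial_memLp i) y,
    (hu.isWeakPartial i).comp_add y⟩⟩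

theorem MemX.comp_add {p : ℝ} {u : Space d → ℂ} (hu : MemX p u) (y : Space d) :
    MemX p fun x => u (x + y) := ⟨hu.1.comp_add y, memLp_comp_add hu.2 y⟩

theorem mass_comp_add (u : Space d → ℂ) (y : Space d) : mass (fun x => u (x + y)) = mass u :=
  integral_add_right_eq_self (fun x => ‖u x‖ ^ 2) y

theorem powInt_comp_add (p : ℝ) (u : Space d → ℂ) (y : Space d) :
    powInt p (fun x => u (x + y)) = powInt p u :=
  integral_add_right_eq_self (fun x => ‖u x‖ ^ (p + 2)) y

theorem gradSq_comp_add {u : Space d → ℂ} (hu : MemH1 u) (y : Space d) :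
    gradSq (fun x => u (x + y)) = gradSq u := by
  rw [gradSq_eq_of_weakPartial (fun i => memLp_comp_add (hu.weakPartial_memLp i) y)
    fun i => (hu.isWeakPartial i).comp_add y]
  exact integral_add_right_eq_self (fun x => ∑ i, ‖weakPartial i u x‖ ^ 2) y

/-! ### Averages of square-integrable functions -/

/-- Jensen for the square: integrate 2cf - c² ≤ f² with c the mean of f. -/
theorem sq_integral_le_integral_sq {S : Type*} [MeasurableSpace S] {ν : Measure S}
    [IsProbabilityMeasure ν] {f : S → ℝ} (hf : Integrable f ν)
    (hf2 : Integrable (fun s => f s ^ 2) ν) : (∫ s, f s ∂ν) ^ 2 ≤ ∫ s, f s ^ 2 ∂ν := by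
  set c := ∫ s, f s ∂ν with hc
  have h : ∫ s, (2 * c * f s - c ^ 2) ∂ν ≤ ∫ s, f s ^ 2 ∂ν :=
    integral_mono ((hf.const_mul _).sub (integrable_const _)) hf2 fun s => by
      simp only; nlinarith [sq_nonneg (f s - c)]
  rw [integral_sub (hf.const_mul _) (integrable_const _), integral_const_mul, ← hc] at h
  simp at h
  nlinarith

/-- Averaging a family over a probability space does not increase a uniform L² bound. It is applied
to translates along a segment and over a ball. -/
theorem memLp_average {S : Type*} [MeasurableSpace S] (ν : Measure S) [IsProbabilityMeasure ν]
    {F : S × Space d → ℂ} (hF : AEStronglyMeasurable F (ν.prod volume)) {K : ℝ}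
    (h : ∀ᵐ s ∂ν, Integrable (fun x => ‖F (s, x)‖ ^ 2) volume ∧ ∫ x, ‖F (s, x)‖ ^ 2 ≤ K) :
    MemLp F 2 (ν.prod volume) ∧ MemLp (fun x => ∫ s, F (s, x) ∂ν) 2 volume ∧
      ∫ x, ‖∫ s, F (s, x) ∂ν‖ ^ 2 ≤ K := by
  have hI : Integrable (fun p => ‖F p‖ ^ 2) (ν.prod volume) := by
    rw [integrable_prod_iff (f := fun p => ‖F p‖ ^ 2) (hF.norm.pow 2)]
    refine ⟨h.mono fun s hs => hs.1, ?_⟩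
    refine Integrable.mono' (integrable_const K)
      (hF.norm.pow 2).norm.integral_prod_right' ?_
    filter_upwards [h] with s hs
    simp only [norm_pow, norm_norm]
    rw [Real.norm_of_nonneg (integral_nonneg fun _ => by positivity)]
    exact hs.2
  have hL : MemLp F 2 (ν.prod volume) := (memLp_two_iff_integrable_sq_norm hF).2 hI
  have hpt : ∀ᵐ x : Space d, ‖∫ s, F (s, x) ∂ν‖ ^ 2 ≤ ∫ s, ‖F (s, x)‖ ^ 2 ∂ν := by
    filter_upwards [hI.prod_left_ae, hF.prod_swap.prodMk_left] with x hx hmx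
    have hm : MemLp (fun s => F (s, x)) 2 ν := (memLp_two_iff_integrable_sq_norm hmx).2 hx
    refine le_trans ?_ (sq_integral_le_integral_sq (hm.integrable (by norm_num)).norm hx)
    exact pow_le_pow_left₀ (norm_nonneg _) (norm_integral_le_integral_norm _) 2
  have hmeas : AEStronglyMeasurable (fun x => ∫ s, F (s, x) ∂ν) volume :=
    hF.prod_swap.integral_prod_right'
  have hI2 : Integrable (fun x => ∫ s, ‖F (s, x)‖ ^ 2 ∂ν) volume := hI.integral_prod_right
  have hI3 : Integrable (fun x => ‖∫ s, F (s, x) ∂ν‖ ^ 2) volume := by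
    refine hI2.mono' (hmeas.norm.pow 2) ?_
    filter_upwards [hpt] with x hx
    rwa [Real.norm_of_nonneg (by positivity)]
  refine ⟨hL, (memLp_two_iff_integrable_sq_norm hmeas).2 hI3, ?_⟩
  calc ∫ x : Space d, ‖∫ s, F (s, x) ∂ν‖ ^ 2 ≤ ∫ x : Space d, ∫ s, ‖F (s, x)‖ ^ 2 ∂ν := integral_mono_ae hI3 hI2 hpt
    _ = ∫ s, (∫ x, ‖F (s, x)‖ ^ 2) ∂ν := (integral_integral_swap hI).symm
    _ ≤ ∫ _s, K ∂ν := integral_mono_ae hI.integral_prod_left (integrable_const _)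
        (h.mono fun s hs => hs.2)
    _ = K := by simp

/-! ### Translations -/

/-- The weak derivative of `u` in the direction `y`. -/
def dirDeriv (y : Space d) (u : Space d → ℂ) : Space d → ℂ :=
  ∑ i, (y i : ℂ) • weakPartial i u

theorem MemH1.dirDeriv_memLp {u : Space d → ℂ} (hu : MemH1 u) (y : Space d) :
    MemLp (dirDeriv y u) 2 volume :=
  memLp_finsetSum' _ fun i _ => (hu.weakPartial_memLp i).const_smul _

theorem MemH1.integral_fderiv_smul {u : Space d → ℂ} (hu : MemH1 u) (y : Space d)
    {φ : Space d → ℝ} (hφ : ContDiff ℝ (⊤ : ℕ∞) φ) (hc : HasCompactSupport φ) :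
    ∫ x, (fderiv ℝ φ x y) • u x = - ∫ x, φ x • dirDeriv y u x := by
  have e1 : ∀ x, (fderiv ℝ φ x y) • u x =
      ∑ i, (y i : ℂ) • ((fderiv ℝ φ x (EuclideanSpace.single i 1)) • u x) := by
    intro x
    have : y = ∑ i, y i • EuclideanSpace.single i (1 : ℝ) := by
      ext j
      simp [Finset.sum_apply, Pi.single_apply]
    conv_lhs => rw [this]
    simp [Finset.sum_mul, mul_assoc]
  have e2 : ∀ x, φ x • dirDeriv y u x = ∑ i, (y i : ℂ) • (φ x • weakPartial i u x) := by
    intro x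
    simp [dirDeriv, Finset.mul_sum]
    exact Finset.sum_congr rfl fun i _ => by ring
  simp_rw [e1, e2, smul_eq_mul]
  rw [integral_finsetSum _ fun i _ => (integrable_fderiv_test_smul hφ hc
      (EuclideanSpace.single i 1) hu.1).const_mul (y i : ℂ),
    integral_finsetSum _ fun i _ =>
      (integrable_test_smul hφ.continuous hc (hu.weakPartial_memLp i)).const_mul (y i : ℂ),
    ← Finset.sum_neg_distrib]
  refine Finset.sum_congr rfl fun i _ => ?_
  simp only [← smul_eq_mul]
  rw [integral_smul, integral_smul, hu.isWeakPartial i φ hφ hc, smul_neg]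

/-- The increment is the average over s in (0,1] of the directional derivative translated by sy.
This is verified by pairing with test functions; averaging then preserves the L² bound. -/
theorem integral_norm_sq_comp_add_sub_le {u : Space d → ℂ} (hu : MemH1 u) (y : Space d) :
    ∫ x, ‖u (x + y) - u x‖ ^ 2 ≤ ∫ x, ‖dirDeriv y u x‖ ^ 2 := by
  classical
  set w := dirDeriv y u with hw
  have hwL : MemLp w 2 volume := hu.dirDeriv_memLp y
  -- A strongly measurable representative makes the family of translates jointly measurable in (s,
  -- x).
  set w' := hwL.1.mk w with hw'
  have hww' : w =ᵐ[volume] w' := hwL.1.ae_eq_mk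
  have hw'L : MemLp w' 2 volume := hwL.ae_eq hww'
  let ν : Measure ℝ := volume.restrict (Set.Ioc 0 1)
  have : IsProbabilityMeasure ν := ⟨by simp [ν]⟩
  let F : ℝ × Space d → ℂ := fun p => w' (p.2 + p.1 • y)
  have hFm : StronglyMeasurable F :=
    hwL.1.stronglyMeasurable_mk.comp_measurable (by fun_prop)
  have hsec : ∀ s : ℝ, Integrable (fun x => ‖F (s, x)‖ ^ 2) volume ∧
      ∫ x, ‖F (s, x)‖ ^ 2 ≤ ∫ x, ‖w x‖ ^ 2 := by
    intro s
    refine ⟨(MemLp.integrable_norm_sq hw'L).comp_add_right (s • y), le_of_eq ?_⟩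
    exact (integral_add_right_eq_self (fun x => ‖w' x‖ ^ 2) (s • y)).trans (mass_congr_ae hww')
  obtain ⟨hFL, hgL, hgK⟩ := memLp_average ν hFm.aestronglyMeasurable (ae_of_all _ hsec)
  have hdL : MemLp (fun x => u (x + y) - u x) 2 volume := (memLp_comp_add hu.1 y).sub hu.1
  have hae : (fun x => u (x + y) - u x) =ᵐ[volume] fun x => ∫ s, F (s, x) ∂ν := by
    refine ae_eq_of_integral_contDiff_smul_eq (hdL.locallyIntegrable (by norm_num))
      (hgL.locallyIntegrable (by norm_num)) fun φ hφ hc => ?_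
    have hφL : MemLp (fun p : ℝ × Space d => φ p.2) 2 (ν.prod volume) :=
      (memLp_two_of_test hφ.continuous hc 2).comp_snd ν
    have hint : Integrable (fun p : ℝ × Space d => φ p.2 • F p) (ν.prod volume) :=
      memLp_one_iff_integrable.1 (hFL.smul (r := 1) hφL)
    have h1 : ∫ x, φ x • ∫ s, F (s, x) ∂ν = ∫ s, (∫ x, φ x • F (s, x)) ∂ν := by
      simp_rw [← integral_smul]
      exact (integral_integral_swap (f := fun s x => φ x • F (s, x)) hint).symm
    -- The translation and then the derivative are moved onto the test function, where the
    -- fundamental theorem of calculus in s applies.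
    have h2 : ∀ s : ℝ, ∫ x, φ x • F (s, x) = - ∫ z, fderiv ℝ φ (z - s • y) y • u z := by
      intro s
      have := hu.integral_fderiv_smul y (φ := fun x => φ (x - s • y))
        (hφ.comp (contDiff_id.sub contDiff_const))
        (hc.comp_homeomorph (Homeomorph.subRight (s • y)))
      simp only [fderiv_comp_sub] at this
      rw [this, neg_neg, ← integral_add_right_eq_self (fun x => φ (x - s • y) • dirDeriv y u x)
        (s • y)]
      have hwws : ∀ᵐ x, w (x + s • y) = w' (x + s • y) :=
        (measurePreserving_add_right volume (s • y)).quasiMeasurePreserving.ae hww'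
      refine integral_congr_ae ?_
      filter_upwards [hwws] with x hx
      simp [F, ← hw, hx]
    -- One compact set contains all translates of the support; it provides the dominating function
    -- needed for Fubini.
    obtain ⟨K, hK, hKφ⟩ : ∃ K : Set (Space d), IsCompact K ∧ ∀ s ∈ Set.Icc (0 : ℝ) 1,
        ∀ z, z ∉ K → fderiv ℝ φ (z - s • y) y = 0 := by
      refine ⟨(fun p : ℝ × Space d => p.2 + p.1 • y) '' (Set.Icc 0 1 ×ˢ tsupport φ),
        (isCompact_Icc.prod hc).image (by fun_prop), fun s hs z hz => ?_⟩
      have : z - s • y ∉ tsupport φ := fun h => hz ⟨(s, z - s • y), ⟨hs, h⟩, by simp⟩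
      rw [image_eq_zero_of_notMem_tsupport fun h => this (tsupport_fderiv_subset ℝ h)]
      rfl
    obtain ⟨C, hC⟩ := (hc.fderiv_apply (𝕜 := ℝ) y).exists_bound_of_continuous
      (continuous_fderiv_apply_of_contDiff hφ y)
    have hKu : Integrable (K.indicator fun z => ‖u z‖) volume :=
      IntegrableOn.integrable_indicator
        ((hu.1.locallyIntegrable (by norm_num)).integrableOn_isCompact hK).norm hK.measurableSet
    have hcont : Continuous fun p : ℝ × Space d => fderiv ℝ φ (p.2 - p.1 • y) y :=
      (continuous_fderiv_apply_of_contDiff hφ y).comp (by fun_prop)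
    have hint2 : Integrable (fun p : ℝ × Space d => fderiv ℝ φ (p.2 - p.1 • y) y • u p.2)
        (ν.prod volume) := by
      refine Integrable.mono' ((integrable_const C).mul_prod hKu)
        (hcont.aestronglyMeasurable.smul hu.1.1.comp_snd) ?_
      have : ∀ᵐ p ∂(ν.prod (volume : Measure (Space d))), p.1 ∈ Set.Ioc (0 : ℝ) 1 :=
        Measure.quasiMeasurePreserving_fst.ae (ae_restrict_mem measurableSet_Ioc)
      filter_upwards [this] with p hp
      by_cases hz : p.2 ∈ K
      · rw [norm_smul, Set.indicator_of_mem hz]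
        exact mul_le_mul_of_nonneg_right (hC _) (norm_nonneg _)
      · rw [hKφ _ ⟨hp.1.le, hp.2⟩ _ hz, Set.indicator_of_notMem hz]
        simp
    have h3 : ∀ z, ∫ s, fderiv ℝ φ (z - s • y) y • u z ∂ν = (φ z - φ (z - y)) • u z := by
      intro z
      rw [integral_smul_const]
      congr 1
      have hd : ∀ s : ℝ, HasDerivAt (fun s : ℝ => -φ (z - s • y)) (fderiv ℝ φ (z - s • y) y) s := by
        intro s
        have a := (hφ.differentiable (by simp) (z - s • y)).hasFDerivAt
        have b : HasDerivAt (fun s : ℝ => z - s • y) (-y) s := by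
          simpa using ((hasDerivAt_id s).smul_const y).const_sub z
        have c := (a.comp_hasDerivAt s b).neg
        rw [map_neg, neg_neg] at c
        exact c
      have := intervalIntegral.integral_eq_sub_of_hasDerivAt (a := 0) (b := 1)
        (fun s _ => hd s) ((hcont.comp (f := fun s : ℝ => (s, z)) (by fun_prop)).intervalIntegrable _ _)
      rw [intervalIntegral.integral_of_le zero_le_one] at this
      simp only [zero_smul, sub_zero, one_smul] at this
      rw [this]; ring
    rw [h1]
    simp_rw [h2]
    rw [integral_neg, integral_integral_swap (f := fun s z => fderiv ℝ φ (z - s • y) y • u z) hint2]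
    simp_rw [h3, sub_smul, smul_sub]
    have i1 := integrable_test_smul hφ.continuous hc hu.1
    have i2 := integrable_test_smul hφ.continuous hc (memLp_comp_add hu.1 y)
    have i3 : Integrable (fun x => φ (x - y) • u x) volume :=
      integrable_test_smul (hφ.continuous.comp (by fun_prop))
        (hc.comp_homeomorph (Homeomorph.subRight y)) hu.1
    rw [integral_sub i2 i1, integral_sub i1 i3,
      ← integral_add_right_eq_self (fun x => φ (x - y) • u x) y]
    simp
  calc ∫ x, ‖u (x + y) - u x‖ ^ 2 = ∫ x, ‖∫ s, F (s, x) ∂ν‖ ^ 2 := by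
        refine integral_congr_ae ?_
        filter_upwards [hae] with x hx
        rw [hx]
    _ ≤ _ := hgK

theorem integral_norm_sq_comp_add_sub_le_gradSq {u : Space d → ℂ} (hu : MemH1 u) (y : Space d) :
    ∫ x, ‖u (x + y) - u x‖ ^ 2 ≤ ‖y‖ ^ 2 * gradSq u := by
  refine (integral_norm_sq_comp_add_sub_le hu y).trans ?_
  rw [gradSq, ← integral_const_mul]
  refine integral_mono (MemLp.integrable_norm_sq (hu.dirDeriv_memLp y))
    ((integrable_finsetSum _ fun i _ =>
      MemLp.integrable_norm_sq (hu.weakPartial_memLp i)).const_mul _) fun x => ?_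
  simp only
  calc ‖dirDeriv y u x‖ ^ 2 ≤ (∑ i, ‖y i‖ * ‖weakPartial i u x‖) ^ 2 := by
        refine pow_le_pow_left₀ (norm_nonneg _) ?_ 2
        rw [dirDeriv, Finset.sum_apply]
        refine (norm_sum_le _ _).trans (le_of_eq ?_)
        simp
    _ ≤ (∑ i, ‖y i‖ ^ 2) * ∑ i, ‖weakPartial i u x‖ ^ 2 := Finset.sum_mul_sq_le_sq_mul_sq _ _ _
    _ = _ := by rw [EuclideanSpace.norm_sq_eq]

/-- Keeping the coordinate directions separate allows Lipschitz maps to be estimated derivative by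
derivative. -/
theorem integral_norm_sq_comp_add_single_sub_le {u : Space d → ℂ} (hu : MemH1 u) (i : Fin d)
    (h : ℝ) : ∫ x, ‖u (x + h • EuclideanSpace.single i 1) - u x‖ ^ 2
      ≤ h ^ 2 * ∫ x, ‖weakPartial i u x‖ ^ 2 := by
  refine (integral_norm_sq_comp_add_sub_le hu _).trans (le_of_eq ?_)
  rw [← integral_const_mul]
  refine integral_congr_ae (ae_of_all _ fun x => ?_)
  have : dirDeriv (h • EuclideanSpace.single i 1) u x = (h : ℂ) * weakPartial i u x := by
    rw [dirDeriv, Finset.sum_apply, Finset.sum_eq_single i]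
    · simp
    · intro j _ hj
      simp [hj]
    · simp
  simp [this, mul_pow]

/-! ### Weak compactness -/

/-- Sequential Banach–Alaoglu in the dual of a separable space, carried back by the Riesz
isomorphism. -/
theorem exists_weak_subseq {H : Type*} [NormedAddCommGroup H] [InnerProductSpace ℂ H]
    [CompleteSpace H] [SecondCountableTopology H] {x : ℕ → H} {C : ℝ} (hC : ∀ n, ‖x n‖ ≤ C) :
    ∃ φ : ℕ → ℕ, StrictMono φ ∧ ∃ y : H, ∀ h,
      Tendsto (fun n => inner ℂ h (x (φ n))) atTop (𝓝 (inner ℂ h y)) := by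
  have hs := WeakDual.isSeqCompact_closedBall ℂ H 0 C
  have hx : ∀ n, StrongDual.toWeakDual (InnerProductSpace.toDual ℂ H (x n)) ∈
      WeakDual.toStrongDual ⁻¹' Metric.closedBall (0 : StrongDual ℂ H) C := by
    intro n
    simpa using hC n
  obtain ⟨a, -, φ, hφ, ha⟩ := hs hx
  refine ⟨φ, hφ, (InnerProductSpace.toDual ℂ H).symm (WeakDual.toStrongDual a), fun h => ?_⟩
  have h1 := ((WeakDual.eval_continuous (𝕜 := ℂ) h).tendsto a).comp ha
  have h2 := (Complex.continuous_conj.tendsto _).comp h1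
  have e1 : ∀ z : H, inner ℂ h z = (starRingEnd ℂ) (inner ℂ z h) := fun z =>
    (inner_conj_symm h z).symm
  simp_rw [e1]
  rw [InnerProductSpace.toDual_symm_apply]
  exact h2

/-- The finite family is a single bounded sequence in an ℓ² sum of copies of L², so one subsequence
serves a function together with all its partial derivatives. -/
theorem exists_weak_subseq_memLp {ι : Type*} [Fintype ι] {f : ℕ → ι → Space d → ℂ}
    (hf : ∀ n i, MemLp (f n i) 2 volume) {C : ℝ} (hC : ∀ n i, ∫ x, ‖f n i x‖ ^ 2 ≤ C) :
    ∃ φ : ℕ → ℕ, StrictMono φ ∧ ∃ g : ι → Space d → ℂ, (∀ i, MemLp (g i) 2 volume) ∧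
      ∀ i h, MemLp h 2 volume →
        Tendsto (fun n => ∫ x, inner ℂ (h x) (f (φ n) i x)) atTop
          (𝓝 (∫ x, inner ℂ (h x) (g i x))) := by
  classical
  have : Fact ((2 : ℝ≥0∞) ≠ ∞) := ⟨by norm_num⟩
  let H := PiLp 2 fun _ : ι => Lp ℂ 2 (volume : Measure (Space d))
  have hin : ∀ {a b : Space d → ℂ} (ha : MemLp a 2 volume) (hb : MemLp b 2 volume),
      inner ℂ (ha.toLp a) (hb.toLp b) = ∫ x, inner ℂ (a x) (b x) := by
    intro a b ha hb
    rw [L2.inner_def]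
    refine integral_congr_ae ?_
    filter_upwards [ha.coeFn_toLp, hb.coeFn_toLp] with x h1 h2
    rw [h1, h2]
  have hnorm : ∀ {a : Space d → ℂ} (ha : MemLp a 2 volume),
      ‖ha.toLp a‖ ^ 2 = ∫ x, ‖a x‖ ^ 2 := by
    intro a ha
    have h := inner_self_eq_norm_sq_to_K (𝕜 := ℂ) (ha.toLp a)
    rw [hin ha ha] at h
    have h' : ∫ x, inner ℂ (a x) (a x) = ((∫ x, ‖a x‖ ^ 2 : ℝ) : ℂ) := by
      rw [← integral_complex_ofReal]
      refine integral_congr_ae (ae_of_all _ fun x => ?_)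
      simp only [inner_self_eq_norm_sq_to_K (𝕜 := ℂ) (a x)]
      simp
    rw [h'] at h
    have h'' : (∫ x, ‖a x‖ ^ 2 : ℝ) = ‖ha.toLp a‖ ^ 2 := by
      apply Complex.ofReal_injective
      rw [h]; simp
    exact h''.symm
  let x : ℕ → H := fun n => WithLp.toLp 2 fun i => (hf n i).toLp (f n i)
  have hx : ∀ n, ‖x n‖ ≤ √(Fintype.card ι * C) := by
    intro n
    rw [PiLp.norm_eq_of_L2]
    refine Real.sqrt_le_sqrt ?_
    calc ∑ i, ‖(hf n i).toLp (f n i)‖ ^ 2 ≤ ∑ _i : ι, C :=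
          Finset.sum_le_sum fun i _ => by rw [hnorm]; exact hC n i
      _ = _ := by simp
  obtain ⟨φ, hφ, y, hy⟩ := exists_weak_subseq hx
  refine ⟨φ, hφ, fun i => y i, fun i => Lp.memLp _, fun i h hh => ?_⟩
  have h1 := hy (WithLp.toLp 2 (Pi.single i (hh.toLp h)))
  have e : ∀ z : H, inner ℂ (WithLp.toLp 2 (Pi.single i (hh.toLp h)) : H) z
      = inner ℂ (hh.toLp h) (z i) := by
    intro z
    rw [PiLp.inner_apply, Finset.sum_eq_single i]
    · simp
    · intro j _ hj
      simp [hj]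
    · simp
  simp_rw [e] at h1
  have e2 : inner ℂ (hh.toLp h) (y i) = ∫ x, inner ℂ (h x) (y i x) := by
    have := hin hh (Lp.memLp (y i))
    rwa [Lp.toLp_coeFn] at this
  rw [e2] at h1
  refine h1.congr fun n => ?_
  exact hin hh (hf (φ n) i)

theorem inner2_eq_re {f g : Space d → ℂ} (hf : MemLp f 2 volume) (hg : MemLp g 2 volume) :
    inner2 f g = (∫ x, inner ℂ (f x) (g x)).re := by
  have hi : Integrable (fun x => inner ℂ (f x) (g x)) volume := by
    refine (L2.integrable_inner (𝕜 := ℂ) (hf.toLp f) (hg.toLp g)).congr ?_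
    filter_upwards [hf.coeFn_toLp, hg.coeFn_toLp] with x h1 h2
    rw [h1, h2]
  exact integral_re hi

theorem tendsto_inner2 {h g : Space d → ℂ} {f : ℕ → Space d → ℂ} (hh : MemLp h 2 volume)
    (hg : MemLp g 2 volume) (hf : ∀ n, MemLp (f n) 2 volume)
    (ht : Tendsto (fun n => ∫ x, inner ℂ (h x) (f n x)) atTop (𝓝 (∫ x, inner ℂ (h x) (g x)))) :
    Tendsto (fun n => inner2 h (f n)) atTop (𝓝 (inner2 h g)) := by
  rw [inner2_eq_re hh hg]
  refine ((Complex.continuous_re.tendsto _).comp ht).congr fun n => ?_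
  exact (inner2_eq_re hh (hf n)).symm

theorem inner2_comm (f g : Space d → ℂ) : inner2 f g = inner2 g f := by
  simp only [inner2, real_inner_comm]

/-- Weak lower semicontinuity of the norm, from expanding 0 ≤ ‖fₙ - g‖². -/
theorem integral_norm_sq_le_of_weak {g : Space d → ℂ} {f : ℕ → Space d → ℂ}
    (hg : MemLp g 2 volume) (hf : ∀ n, MemLp (f n) 2 volume) {C : ℝ}
    (hC : ∀ n, ∫ x, ‖f n x‖ ^ 2 ≤ C)
    (ht : Tendsto (fun n => inner2 g (f n)) atTop (𝓝 (inner2 g g))) :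
    ∫ x, ‖g x‖ ^ 2 ≤ C := by
  have hgg : inner2 g g = ∫ x, ‖g x‖ ^ 2 := by simp [inner2]
  have h : ∀ n, 2 * inner2 g (f n) ≤ C + ∫ x, ‖g x‖ ^ 2 := by
    intro n
    have h1 := integral_norm_sq_add_smul (hf n) hg (-1)
    have h2 : 0 ≤ ∫ x, ‖(f n + ((-1 : ℝ) : ℂ) • g) x‖ ^ 2 := integral_nonneg fun _ => by positivity
    rw [inner2_comm] at h1
    linarith [hC n]
  have := le_of_tendsto' (ht.const_mul 2) h
  rw [hgg] at this
  linarith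

theorem inner_ofReal_eq_smul (r : ℝ) (z : ℂ) : inner ℂ (r : ℂ) z = r • z := by
  simp [mul_comm]

/-! ### Difference quotients and Lipschitz maps -/

/-- Dominated convergence: the quotients of φ are bounded by its Lipschitz constant times ‖y‖ and
vanish off a fixed compact set. -/
theorem tendsto_integral_difference_quotient (y : Space d) {u : Space d → ℂ}
    (hu : MemLp u 2 volume) {φ : Space d → ℝ} (hφ : ContDiff ℝ (⊤ : ℕ∞) φ)
    (hc : HasCompactSupport φ) :
    Tendsto (fun n : ℕ => ∫ x, ((n + 1 : ℝ) * (φ (x - (1 / (n + 1 : ℝ)) • y) - φ x)) • u x) atTop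
      (𝓝 (- ∫ x, (fderiv ℝ φ x y) • u x)) := by
  obtain ⟨L, hL⟩ := ContDiff.lipschitzWith_of_hasCompactSupport hc hφ (by simp)
  set t : ℕ → ℝ := fun n => 1 / ((n : ℝ) + 1) with ht
  have ht0 : ∀ n, 0 < t n := fun n => by simp only [ht]; positivity
  have ht1 : ∀ n, t n ≤ 1 := fun n => by
    simp only [ht]; rw [div_le_one (by positivity)]; linarith [(Nat.cast_nonneg n : (0 : ℝ) ≤ n)]
  have htl : Tendsto t atTop (𝓝 0) := tendsto_one_div_add_atTop_nhds_zero_nat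
  set K : Set (Space d) := (fun p : ℝ × Space d => p.2 + p.1 • y) '' (Set.Icc 0 1 ×ˢ tsupport φ)
    with hK
  have hKc : IsCompact K := (isCompact_Icc.prod hc).image (by fun_prop)
  have hzero : ∀ s ∈ Set.Icc (0 : ℝ) 1, ∀ z, z ∉ K → φ (z - s • y) = 0 := by
    intro s hs z hz
    have : z - s • y ∉ tsupport φ := fun h => hz ⟨(s, z - s • y), ⟨hs, h⟩, by simp⟩
    exact image_eq_zero_of_notMem_tsupport this
  have hKu : Integrable (K.indicator fun z => (L * ‖y‖) * ‖u z‖) volume :=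
    IntegrableOn.integrable_indicator
      (((hu.locallyIntegrable (by norm_num)).integrableOn_isCompact hKc).norm.const_mul _)
      hKc.measurableSet
  rw [← integral_neg]
  refine tendsto_integral_of_dominated_convergence _ (fun n => ?_) hKu (fun n => ?_) ?_
  · have hcont : Continuous fun x => (n + 1 : ℝ) * (φ (x - (1 / (n + 1 : ℝ)) • y) - φ x) :=
      continuous_const.mul ((hφ.continuous.comp (by fun_prop)).sub hφ.continuous)
    exact hcont.aestronglyMeasurable.smul hu.1
  · refine ae_of_all _ fun x => ?_
    by_cases hx : x ∈ K
    · rw [Set.indicator_of_mem hx, norm_smul]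
      refine mul_le_mul_of_nonneg_right ?_ (norm_nonneg _)
      have h1 := hL.dist_le_mul (x - t n • y) x
      rw [dist_eq_norm, dist_eq_norm] at h1
      have h2 : ‖x - t n • y - x‖ = t n * ‖y‖ := by
        rw [sub_right_comm, sub_self, zero_sub, norm_neg, norm_smul, Real.norm_of_nonneg (ht0 n).le]
      rw [h2] at h1
      have h3 : ((n : ℝ) + 1) * t n = 1 := by simp only [ht]; field_simp
      rw [norm_mul, Real.norm_of_nonneg (by positivity : (0 : ℝ) ≤ n + 1)]
      calc ((n : ℝ) + 1) * ‖φ (x - t n • y) - φ x‖ ≤ ((n : ℝ) + 1) * (L * (t n * ‖y‖)) := by gcongr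
        _ = (((n : ℝ) + 1) * t n) * (L * ‖y‖) := by ring
        _ = L * ‖y‖ := by rw [h3, one_mul]
    · rw [Set.indicator_of_notMem hx]
      have h1 := hzero (t n) ⟨(ht0 n).le, ht1 n⟩ x hx
      have h2 := hzero 0 (by simp) x hx
      simp only [zero_smul, sub_zero] at h2
      simp only [ht] at h1
      rw [h1, h2]
      simp
  · refine ae_of_all _ fun x => ?_
    have a := (hφ.differentiable (by simp) x).hasFDerivAt
    have b : HasDerivAt (fun s : ℝ => x - s • y) (-y) 0 := by
      simpa using ((hasDerivAt_id (0 : ℝ)).smul_const y).const_sub x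
    have b' : HasDerivAt (fun s : ℝ => φ (x - s • y)) (-(fderiv ℝ φ x y)) 0 := by
      have a' : HasFDerivAt φ (fderiv ℝ φ x) (x - (0 : ℝ) • y) := by simpa using a
      have := a'.comp_hasDerivAt (0 : ℝ) b
      rw [map_neg] at this
      exact this
    have hslope := hasDerivAt_iff_tendsto_slope.1 b'
    have htl' : Tendsto t atTop (𝓝[≠] 0) :=
      tendsto_nhdsWithin_iff.2 ⟨htl, Eventually.of_forall fun n => (ht0 n).ne'⟩
    have := (hslope.comp htl').smul_const (u x)
    rw [neg_smul] at this
    refine this.congr fun n => ?_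
    simp [slope_def_field, ht]
    left
    ring

/-- Nirenberg's criterion: the difference quotients with step 1/(n+1) are bounded in L², and any
weak limit is the weak derivative and inherits the bound. -/
theorem exists_weakPartial_of_difference_quotient {i : Fin d} {f : Space d → ℂ}
    (hf : MemLp f 2 volume) {K : ℝ}
    (hK : ∀ h : ℝ, ∫ x, ‖f (x + h • EuclideanSpace.single i 1) - f x‖ ^ 2 ≤ h ^ 2 * K) :
    ∃ v : Space d → ℂ, MemLp v 2 volume ∧ IsWeakPartial i f v ∧ ∫ x, ‖v x‖ ^ 2 ≤ K := by
  set y : Space d := EuclideanSpace.single i 1 with hy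
  let D : ℕ → Unit → Space d → ℂ := fun n _ x =>
    ((n + 1 : ℝ) : ℂ) * (f (x + (1 / (n + 1 : ℝ)) • y) - f x)
  have hD : ∀ n j, MemLp (D n j) 2 volume := fun n _ => ((memLp_comp_add hf _).sub hf).const_mul _
  have hDK : ∀ n j, ∫ x, ‖D n j x‖ ^ 2 ≤ K := by
    intro n j
    have e : ∀ x, ‖D n j x‖ ^ 2 = (n + 1 : ℝ) ^ 2 * ‖f (x + (1 / (n + 1 : ℝ)) • y) - f x‖ ^ 2 := by
      intro x
      simp only [D]
      rw [norm_mul, mul_pow, Complex.norm_real, Real.norm_of_nonneg (by positivity)]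
    simp_rw [e]
    rw [integral_const_mul]
    calc (n + 1 : ℝ) ^ 2 * ∫ x, ‖f (x + (1 / (n + 1 : ℝ)) • y) - f x‖ ^ 2
        ≤ (n + 1 : ℝ) ^ 2 * ((1 / (n + 1 : ℝ)) ^ 2 * K) := by gcongr; exact hK _
      _ = K := by field_simp
  obtain ⟨σ, hσ, g, hg, hlim⟩ := exists_weak_subseq_memLp hD hDK
  refine ⟨g (), hg (), fun φ hφ hc => ?_, ?_⟩
  · have hφL := memLp_two_of_test (Complex.continuous_ofReal.comp hφ.continuous)
      (hasCompactSupport_ofReal hc) 2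
    have h1 := hlim () _ hφL
    simp only [Function.comp_apply, inner_ofReal_eq_smul] at h1
    have h2 := (tendsto_integral_difference_quotient y hf hφ hc).comp hσ.tendsto_atTop
    have h3 : ∀ n, ∫ x, φ x • D n () x =
        ∫ x, ((n + 1 : ℝ) * (φ (x - (1 / (n + 1 : ℝ)) • y) - φ x)) • f x := by
      intro n
      set t := (1 / (n + 1 : ℝ)) with ht
      have i1 := integrable_test_smul hφ.continuous hc hf
      have i2 := integrable_test_smul hφ.continuous hc (memLp_comp_add hf (t • y))
      have i3 : Integrable (fun x => φ (x - t • y) • f x) volume :=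
        integrable_test_smul (hφ.continuous.comp (by fun_prop))
          (hc.comp_homeomorph (Homeomorph.subRight (t • y))) hf
      have e1 : ∀ x, φ x • D n () x = ((n + 1 : ℝ) : ℂ) * (φ x • f (x + t • y) - φ x • f x) := by
        intro x
        simp only [D, Complex.real_smul, ← ht]
        ring
      have e2 : ∀ x, ((n + 1 : ℝ) * (φ (x - t • y) - φ x)) • f x
          = ((n + 1 : ℝ) : ℂ) * (φ (x - t • y) • f x - φ x • f x) := by
        intro x
        simp only [Complex.real_smul, Complex.ofReal_mul, Complex.ofReal_sub]
        ring
      simp_rw [e1, e2]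
      rw [integral_const_mul, integral_const_mul, integral_sub i2 i1, integral_sub i3 i1,
        ← integral_add_right_eq_self (fun x => φ (x - t • y) • f x) (t • y)]
      simp
    have h4 := tendsto_nhds_unique (h1.congr fun n => h3 (σ n)) h2
    rw [← hy, h4, neg_neg]
  · exact integral_norm_sq_le_of_weak (hg ()) (fun n => hD (σ n) ()) (fun n => hDK (σ n) ())
      (tendsto_inner2 (hg ()) (hg ()) (fun n => hD (σ n) ()) (hlim () _ (hg ())))

/-- A 1-Lipschitz map shrinks increments pointwise, hence also the L² bounds on difference
quotients. This serves in place of a chain rule for truncations and for the modulus, which are not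
differentiable. -/
theorem MemH1.comp_lipschitz {u : Space d → ℂ} (hu : MemH1 u) {T : ℂ → ℂ}
    (hT : LipschitzWith 1 T) (h0 : T 0 = 0) :
    MemH1 (fun x => T (u x)) ∧ gradSq (fun x => T (u x)) ≤ gradSq u := by
  have hle : ∀ a b, ‖T a - T b‖ ≤ ‖a - b‖ := by
    intro a b
    simpa [dist_eq_norm] using hT.dist_le_mul a b
  have hm : MemLp (fun x => T (u x)) 2 volume :=
    hu.1.mono (hT.continuous.comp_aestronglyMeasurable hu.1.1) (ae_of_all _ fun x => by
      simpa [h0] using hle (u x) 0)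
  have h : ∀ i : Fin d, ∃ v : Space d → ℂ, MemLp v 2 volume ∧ IsWeakPartial i (fun x => T (u x)) v ∧
      ∫ x, ‖v x‖ ^ 2 ≤ ∫ x, ‖weakPartial i u x‖ ^ 2 := by
    intro i
    refine exists_weakPartial_of_difference_quotient hm fun h => ?_
    refine le_trans ?_ (integral_norm_sq_comp_add_single_sub_le hu i h)
    refine integral_mono (MemLp.integrable_norm_sq ((memLp_comp_add hm _).sub hm))
      (MemLp.integrable_norm_sq ((memLp_comp_add hu.1 _).sub hu.1)) fun x => ?_
    exact pow_le_pow_left₀ (norm_nonneg _) (hle _ _) 2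
  choose v hv hw hle' using h
  refine ⟨⟨hm, fun i => ⟨v i, hv i, hw i⟩⟩, ?_⟩
  rw [gradSq_eq_of_weakPartial hv hw, gradSq_eq_sum hu,
    integral_finsetSum _ fun i _ => MemLp.integrable_norm_sq (hv i)]
  exact Finset.sum_le_sum fun i _ => hle' i

theorem MemX.comp_lipschitz {p : ℝ} {u : Space d → ℂ} (hu : MemX p u) {T : ℂ → ℂ}
    (hT : LipschitzWith 1 T) (h0 : T 0 = 0) : MemX p (fun x => T (u x)) := by
  refine ⟨(hu.1.comp_lipschitz hT h0).1, ?_⟩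
  refine hu.2.mono (hT.continuous.comp_aestronglyMeasurable hu.1.1.1) (ae_of_all _ fun x => ?_)
  simpa [h0, dist_eq_norm] using hT.dist_le_mul (u x) 0

/-! ### Averages over balls and the Gagliardo–Nirenberg inequality -/

/-- The uniform probability measure on the ball of radius `r` about `0`. -/
def ballMeasure (d : ℕ) (r : ℝ) : Measure (Space d) :=
  (volume (Metric.ball (0 : Space d) r))⁻¹ • volume.restrict (Metric.ball 0 r)

theorem isProbabilityMeasure_ballMeasure {r : ℝ} (hr : 0 < r) :
    IsProbabilityMeasure (ballMeasure d r) := by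
  refine ⟨?_⟩
  rw [ballMeasure, Measure.smul_apply, Measure.restrict_apply_univ, smul_eq_mul]
  exact ENNReal.inv_mul_cancel (Metric.measure_ball_pos volume 0 hr).ne' measure_ball_lt_top.ne

/-- The average of `u` over the ball of radius `r` about `x`. -/
def ballAvg (r : ℝ) (u : Space d → ℂ) (x : Space d) : ℂ := ∫ y, u (x + y) ∂(ballMeasure d r)

theorem memLp_ballMeasure {r : ℝ} (hr : 0 < r) {u : Space d → ℂ} (hu : MemLp u 2 volume)
    (x : Space d) : MemLp (fun y => u (x + y)) 2 (ballMeasure d r) := by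
  have h : MemLp (fun y => u (x + y)) 2 volume :=
    hu.comp_measurePreserving (measurePreserving_add_left volume x)
  exact h.restrict _ |>.smul_measure
    (ENNReal.inv_ne_top.2 (Metric.measure_ball_pos volume 0 hr).ne')

theorem norm_sq_ballAvg_le {r : ℝ} (hr : 0 < r) {u : Space d → ℂ} (hu : MemLp u 2 volume)
    (x : Space d) :
    ‖ballAvg r u x‖ ^ 2 ≤ (volume.real (Metric.ball (0 : Space d) r))⁻¹ * mass u := by
  have := isProbabilityMeasure_ballMeasure (d := d) hr
  have hm := memLp_ballMeasure hr hu x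
  have hi := (memLp_two_iff_integrable_sq_norm hm.1).1 hm
  have h1 : ‖ballAvg r u x‖ ^ 2 ≤ ∫ y, ‖u (x + y)‖ ^ 2 ∂(ballMeasure d r) :=
    (pow_le_pow_left₀ (norm_nonneg _) (norm_integral_le_integral_norm _) 2).trans
      (sq_integral_le_integral_sq (hm.integrable (by norm_num)).norm hi)
  refine h1.trans ?_
  rw [ballMeasure, integral_smul_measure, ENNReal.toReal_inv, smul_eq_mul]
  refine mul_le_mul_of_nonneg_left ?_ (by positivity)
  have hmeq : ∫ y, ‖u (x + y)‖ ^ 2 = mass u := integral_add_left_eq_self (fun y => ‖u y‖ ^ 2) x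
  rw [← hmeq]
  exact setIntegral_le_integral ((MemLp.integrable_norm_sq hu).comp_add_left x)
    (ae_of_all _ fun _ => by positivity)

theorem ballAvg_sub {r : ℝ} (hr : 0 < r) {u : Space d → ℂ} (hu : MemLp u 2 volume)
    (x : Space d) (z : ℂ) :
    ballAvg r u x - z = ∫ y, (u (x + y) - z) ∂(ballMeasure d r) := by
  have := isProbabilityMeasure_ballMeasure (d := d) hr
  rw [integral_sub ((memLp_ballMeasure hr hu x).integrable (by norm_num)) (integrable_const _)]
  simp [ballAvg]

/-- The translation estimate with ‖y‖ ≤ r, averaged over the ball. -/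
theorem ballAvg_memLp_sub {r : ℝ} (hr : 0 < r) {u : Space d → ℂ} (hu : MemH1 u) :
    MemLp (fun x => ballAvg r u x - u x) 2 volume ∧
      ∫ x, ‖ballAvg r u x - u x‖ ^ 2 ≤ r ^ 2 * gradSq u := by
  have := isProbabilityMeasure_ballMeasure (d := d) hr
  simp_rw [ballAvg_sub hr hu.1]
  -- The shear (y, x) ↦ (y, x + y) preserves the product measure; this gives the measurability of
  -- (y, x) ↦ u(x + y).
  have hmp : MeasurePreserving (fun p : Space d × Space d => (p.1, p.2 + p.1))
      ((ballMeasure d r).prod volume) ((ballMeasure d r).prod volume) :=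
    (MeasurePreserving.id _).skew_product (g := fun a b => b + a) (by fun_prop)
      (ae_of_all _ fun a => (measurePreserving_add_right volume a).map_eq)
  have hm1 : AEStronglyMeasurable (fun p : Space d × Space d => u (p.2 + p.1))
      ((ballMeasure d r).prod volume) :=
    (hu.1.1.comp_snd (μ := ballMeasure d r)).comp_measurePreserving hmp
  have hm : AEStronglyMeasurable (fun p : Space d × Space d => u (p.2 + p.1) - u p.2)
      ((ballMeasure d r).prod volume) := hm1.sub hu.1.1.comp_snd
  have hball : ∀ᵐ y ∂(ballMeasure d r), y ∈ Metric.ball (0 : Space d) r :=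
    Measure.ae_smul_measure (ae_restrict_mem measurableSet_ball) _
  have h := memLp_average (ballMeasure d r) hm (K := r ^ 2 * gradSq u) (by
    filter_upwards [hball] with y hy
    refine ⟨MemLp.integrable_norm_sq ((memLp_comp_add hu.1 y).sub hu.1), ?_⟩
    refine (integral_norm_sq_comp_add_sub_le_gradSq hu y).trans ?_
    have : ‖y‖ ≤ r := by simpa using (Metric.mem_ball.1 hy).le
    have := gradSq_nonneg u
    gcongr)
  exact h.2

/-- A ball average is a pairing with an L² function, so weak convergence passes to it pointwise. -/
theorem ballAvg_eq_integral_inner {r : ℝ} (u : Space d → ℂ) (x : Space d) :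
    ballAvg r u x = (volume.real (Metric.ball (0 : Space d) r))⁻¹ •
      ∫ y, inner ℂ ((Metric.ball x r).indicator (fun _ => (1 : ℂ)) y) (u y) := by
  rw [ballAvg, ballMeasure, integral_smul_measure, ENNReal.toReal_inv]
  congr 1
  rw [← integral_indicator measurableSet_ball,
    ← integral_add_left_eq_self (fun y => inner ℂ _ (u y)) x]
  refine integral_congr_ae (ae_of_all _ fun y => ?_)
  by_cases hy : y ∈ Metric.ball (0 : Space d) r
  · have hy' : x + y ∈ Metric.ball x r := by simpa using hy
    simp [Set.indicator_of_mem hy, Set.indicator_of_mem hy']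
  · have hy' : x + y ∉ Metric.ball x r := by simpa using hy
    simp [Set.indicator_of_notMem hy, Set.indicator_of_notMem hy']

theorem memLp_indicator_ball (x : Space d) (r : ℝ) :
    MemLp ((Metric.ball x r).indicator (fun _ => (1 : ℂ))) 2 volume :=
  memLp_indicator_const 2 measurableSet_ball 1 (Or.inr measure_ball_lt_top.ne)

theorem volume_real_ball {r : ℝ} (hr : 0 < r) :
    volume.real (Metric.ball (0 : Space d) r) =
      r ^ d * volume.real (Metric.ball (0 : Space d) 1) := by
  rw [Measure.real, Measure.addHaar_ball_of_pos _ _ hr, ENNReal.toReal_mul,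
    ENNReal.toReal_ofReal (by positivity), finrank_euclideanSpace_fin]
  rfl

theorem volume_real_unit_ball_pos : 0 < volume.real (Metric.ball (0 : Space d) 1) :=
  ENNReal.toReal_pos (Metric.measure_ball_pos volume 0 one_pos).ne' measure_ball_lt_top.ne

theorem volume_real_lt_le_of_memLp {f : Space d → ℂ} (hf : MemLp f 2 volume) {s : ℝ} (hs : 0 < s) :
    volume {x | s ≤ ‖f x‖} ≤ ENNReal.ofReal ((∫ x, ‖f x‖ ^ 2) / s ^ 2) := by
  have h := mul_meas_ge_le_integral_of_nonneg (ae_of_all _ fun x => by positivity)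
    (MemLp.integrable_norm_sq hf) (s ^ 2)
  have e : {x | s ^ 2 ≤ ‖f x‖ ^ 2} = {x | s ≤ ‖f x‖} := by
    ext x
    exact pow_le_pow_iff_left₀ hs.le (norm_nonneg _) two_ne_zero
  rw [e] at h
  have hfin : volume {x | s ≤ ‖f x‖} ≠ ∞ := by
    have := (MemLp.integrable_norm_sq hf).measure_norm_ge_lt_top (ε := s ^ 2) (by positivity)
    simp only [norm_pow, norm_norm] at this
    rw [e] at this
    exact this.ne
  rw [← ENNReal.ofReal_toReal hfin]
  refine ENNReal.ofReal_le_ofReal ?_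
  rw [le_div_iff₀ (by positivity), mul_comm]
  exact h

/-- Where |u| > s and the average is at most s/2, the deviation from the average exceeds s/2;
Chebyshev bounds the measure of that set. -/
theorem volume_lt_norm_le_of_avg {u : Space d → ℂ} (hu : MemH1 u) {r s : ℝ} (hr : 0 < r)
    (hs : 0 < s) (h : ∀ x, ‖ballAvg r u x‖ ≤ s / 2) :
    volume {x | s < ‖u x‖} ≤ ENNReal.ofReal (4 * r ^ 2 * gradSq u / s ^ 2) := by
  obtain ⟨hL, hK⟩ := ballAvg_memLp_sub hr hu
  calc volume {x | s < ‖u x‖} ≤ volume {x | s / 2 ≤ ‖ballAvg r u x - u x‖} := by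
        refine measure_mono fun x hx => ?_
        have h1 := h x
        have h2 : ‖u x‖ ≤ ‖ballAvg r u x‖ + ‖ballAvg r u x - u x‖ := by
          have := norm_sub_norm_le (u x) (ballAvg r u x)
          rw [norm_sub_rev] at this
          linarith
        simp only [Set.mem_ofPred_eq] at hx ⊢
        linarith
    _ ≤ _ := volume_real_lt_le_of_memLp hL (by positivity)
    _ ≤ _ := by
      refine ENNReal.ofReal_le_ofReal ?_
      rw [div_pow, div_div_eq_mul_div]
      have : 0 < s ^ 2 := by positivity
      gcongr ?_ / _
      linarith

/-- A weak-type Gagliardo–Nirenberg inequality valid in every dimension. For each level s the radius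
is tuned so that averages stay below s/2, and the deviation costs only r²G. -/
theorem exists_weak_type (hd : 1 ≤ d) : ∃ C : ℝ, 0 < C ∧ ∀ u : Space d → ℂ, MemH1 u → ∀ s : ℝ,
    0 < s → volume {x | s < ‖u x‖} ≤
      ENNReal.ofReal (C * gradSq u * mass u ^ (2 / (d : ℝ)) * s ^ (-2 - 4 / (d : ℝ))) := by
  have hd0 : (0 : ℝ) < d := by exact_mod_cast hd
  set ω := volume.real (Metric.ball (0 : Space d) 1) with hω
  have hω0 : 0 < ω := volume_real_unit_ball_pos
  refine ⟨4 * (4 / ω) ^ (2 / (d : ℝ)), by positivity, fun u hu s hs => ?_⟩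
  rcases (mass_nonneg u).eq_or_lt with hM | hM
  · have h0 : (fun x => ‖u x‖ ^ 2) =ᵐ[volume] 0 :=
      (integral_eq_zero_iff_of_nonneg (fun _ => by positivity) (MemLp.integrable_norm_sq hu.1)).1
        hM.symm
    have : volume {x | s < ‖u x‖} = 0 := by
      refine measure_mono_null (fun x hx => ?_) (ae_iff.1 h0)
      simp only [Set.mem_ofPred_eq] at hx ⊢
      have : 0 < ‖u x‖ := hs.trans hx
      simp only [Pi.zero_apply]
      positivity
    rw [this]
    exact zero_le
  -- With r^d = X the squared average is at most mass/(ω r^d) = (s/2)².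
  set X : ℝ := 4 * mass u / (ω * s ^ 2) with hX
  have hX0 : 0 < X := by positivity
  set r : ℝ := X ^ (1 / (d : ℝ)) with hr
  have hr0 : 0 < r := by positivity
  have hrd : r ^ d = X := by
    rw [hr, ← Real.rpow_natCast, ← Real.rpow_mul hX0.le]
    field_simp
    simp
  have h := volume_lt_norm_le_of_avg hu hr0 hs (fun x => by
    refine le_of_sq_le_sq ((norm_sq_ballAvg_le hr0 hu.1 x).trans ?_) (by positivity)
    rw [volume_real_ball hr0, hrd, ← hω, hX]
    refine le_of_eq ?_
    field_simp
    norm_num)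
  refine h.trans (ENNReal.ofReal_le_ofReal (le_of_eq ?_))
  have hr2 : r ^ 2 = (4 / ω) ^ (2 / (d : ℝ)) * mass u ^ (2 / (d : ℝ)) * s ^ (-(4 / (d : ℝ))) := by
    have e : X = (4 / ω) * mass u * s ^ (-2 : ℝ) := by
      rw [Real.rpow_neg hs.le, hX]
      field_simp
      norm_num
    rw [hr, ← Real.rpow_natCast, ← Real.rpow_mul hX0.le, e, Real.mul_rpow (by positivity)
      (by positivity), Real.mul_rpow (by positivity) (by positivity), ← Real.rpow_mul hs.le]
    congr 2
    all_goals (rw [Nat.cast_ofNat]; ring_nf)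
  rw [hr2, sub_eq_add_neg, Real.rpow_add hs, Real.rpow_neg hs.le 2]
  field_simp
  norm_num

/-! ### Truncated powers and the Gagliardo–Nirenberg inequality with a free height. -/

theorem rpow_le_sq_add_rpow {t p q : ℝ} (ht : 0 ≤ t) (hp : 0 ≤ p) (hpq : p ≤ q) :
    t ^ (p + 2) ≤ t ^ 2 + t ^ (q + 2) := by
  rcases le_total t 1 with h | h
  · have h1 : t ^ (p + 2) ≤ t ^ (2 : ℝ) := by
      rcases ht.eq_or_lt with h0 | h0
      · rw [← h0, Real.zero_rpow (by linarith), Real.zero_rpow (by norm_num)]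
      · exact Real.rpow_le_rpow_of_exponent_ge h0 h (by linarith)
    rw [Real.rpow_two] at h1
    have : 0 ≤ t ^ (q + 2) := by positivity
    linarith
  · have h1 : t ^ (p + 2) ≤ t ^ (q + 2) := Real.rpow_le_rpow_of_exponent_le h (by linarith)
    nlinarith [sq_nonneg t]

theorem aestronglyMeasurable_norm_rpow {u : Space d → ℂ} (hu : AEStronglyMeasurable u volume)
    {q : ℝ} (hq : 0 ≤ q) : AEStronglyMeasurable (fun x => ‖u x‖ ^ q) volume :=
  (Real.continuous_rpow_const hq).comp_aestronglyMeasurable hu.norm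

theorem MemX.integrable_pow_of_le {p₀ p : ℝ} (hp : 0 ≤ p) (hpp : p ≤ p₀) (hp₀ : 0 < p₀)
    {u : Space d → ℂ} (hu : MemX p₀ u) : Integrable (fun x => ‖u x‖ ^ (p + 2)) volume := by
  refine ((MemLp.integrable_norm_sq hu.1.1).add (hu.integrable_pow hp₀)).mono'
    (aestronglyMeasurable_norm_rpow hu.1.1.1 (by linarith)) (ae_of_all _ fun x => ?_)
  rw [Real.norm_of_nonneg (by positivity)]
  exact rpow_le_sq_add_rpow (norm_nonneg _) hp hpp

theorem MemX.memLp_of_le {p₀ p : ℝ} (hp : 0 ≤ p) (hpp : p ≤ p₀) (hp₀ : 0 < p₀)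
    {u : Space d → ℂ} (hu : MemX p₀ u) : MemLp u (ENNReal.ofReal (p + 2)) volume :=
  (integrable_norm_rpow_iff_memLp hu.1.1.1 (by linarith)).1 (hu.integrable_pow_of_le hp hpp hp₀)

theorem min_rpow_le_sq {t N q : ℝ} (ht : 0 ≤ t) (hN : 0 < N) (hq : 0 ≤ q) :
    min t N ^ (q + 2) ≤ N ^ q * t ^ 2 := by
  have hm : 0 ≤ min t N := le_min ht hN.le
  rcases hm.eq_or_lt with h0 | h0
  · rw [← h0, Real.zero_rpow (by linarith)]; positivity
  rw [Real.rpow_add h0, Real.rpow_two]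
  gcongr
  · exact min_le_right _ _
  · exact min_le_left _ _

theorem integrable_min_rpow {u : Space d → ℂ} (hu : MemLp u 2 volume) {N q : ℝ} (hN : 0 < N)
    (hq : 0 ≤ q) : Integrable (fun x => min ‖u x‖ N ^ (q + 2)) volume := by
  refine ((MemLp.integrable_norm_sq hu).const_mul (N ^ q)).mono' ?_ (ae_of_all _ fun x => ?_)
  · exact (Real.continuous_rpow_const (by linarith : 0 ≤ q + 2)).comp_aestronglyMeasurable
      (hu.1.norm.inf aestronglyMeasurable_const)
  · rw [Real.norm_of_nonneg (Real.rpow_nonneg (le_min (norm_nonneg _) hN.le) _)]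
    exact min_rpow_le_sq (norm_nonneg _) hN hq

/-- Layer-cake integration of the weak-type bound: the integrand is t^(p-4/d-1) on (0, N),
integrable at 0 because p > 4/d. -/
theorem exists_integral_min_rpow_le (hd : 1 ≤ d) {p : ℝ} (hp : 4 / (d : ℝ) < p) :
    ∃ C : ℝ, 0 < C ∧ ∀ u : Space d → ℂ, MemH1 u → ∀ N : ℝ, 0 < N →
      ∫ x, min ‖u x‖ N ^ (p + 2) ≤
        C * gradSq u * mass u ^ (2 / (d : ℝ)) * N ^ (p - 4 / (d : ℝ)) := by
  obtain ⟨C, hC, hw⟩ := exists_weak_type hd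
  have hd0 : (0 : ℝ) < d := by exact_mod_cast hd
  have hp0 : 0 < p := lt_trans (by positivity) hp
  set ρ := p - 4 / (d : ℝ) with hρ
  have hρ0 : 0 < ρ := sub_pos.2 hp
  refine ⟨(p + 2) * C / ρ, by positivity, fun u hu N hN => ?_⟩
  set K := C * gradSq u * mass u ^ (2 / (d : ℝ)) with hK
  have hK0 : 0 ≤ K := by
    have := gradSq_nonneg u; have := mass_nonneg u; positivity
  have hnn : ∀ x, 0 ≤ min ‖u x‖ N := fun x => le_min (norm_nonneg _) hN.le
  have hint := integrable_min_rpow hu.1 hN hp0.le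
  have hlc := lintegral_rpow_eq_lintegral_meas_lt_mul (volume : Measure (Space d))
    (f := fun x => min ‖u x‖ N) (ae_of_all _ hnn)
    (hu.1.1.norm.inf aestronglyMeasurable_const).aemeasurable (p := p + 2) (by linarith)
  have hbd : ∀ t ∈ Set.Ioi (0 : ℝ), volume {x | t < min ‖u x‖ N} * ENNReal.ofReal (t ^ (p + 2 - 1))
      ≤ (Set.Ioc 0 N).indicator (fun t => ENNReal.ofReal (K * t ^ (ρ - 1))) t := by
    intro t ht
    have ht0 : 0 < t := ht
    by_cases htN : t ≤ N
    · rw [Set.indicator_of_mem (show t ∈ Set.Ioc 0 N from ⟨ht0, htN⟩)]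
      calc _ ≤ ENNReal.ofReal (K * t ^ (-2 - 4 / (d : ℝ))) * ENNReal.ofReal (t ^ (p + 2 - 1)) := by
            gcongr
            refine (measure_mono fun x hx => ?_).trans (hw u hu t ht0)
            exact lt_of_lt_of_le (show t < min ‖u x‖ N from hx) (min_le_left _ _)
        _ = _ := by
          rw [← ENNReal.ofReal_mul (by positivity), mul_assoc, ← Real.rpow_add ht0]
          congr 3
          rw [hρ]; ring
    · have : {x | t < min ‖u x‖ N} = ∅ := by
        ext x
        simp only [Set.mem_ofPred_eq, Set.mem_empty_iff_false, iff_false, not_lt]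
        exact (min_le_right _ _).trans (not_le.1 htN).le
      rw [this]
      simp
  have hcalc : ENNReal.ofReal (∫ x, min ‖u x‖ N ^ (p + 2)) ≤
      ENNReal.ofReal ((p + 2) * C / ρ * gradSq u * mass u ^ (2 / (d : ℝ)) * N ^ ρ) := by
    rw [ofReal_integral_eq_lintegral_ofReal hint (ae_of_all _ fun x => Real.rpow_nonneg (hnn x) _),
      hlc]
    have hii : IntervalIntegrable (fun t : ℝ => K * t ^ (ρ - 1)) volume 0 N :=
      (intervalIntegral.intervalIntegrable_rpow' (by linarith)).const_mul K
    have hIoc : IntegrableOn (fun t : ℝ => K * t ^ (ρ - 1)) (Set.Ioc 0 N) volume :=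
      (intervalIntegrable_iff_integrableOn_Ioc_of_le hN.le).1 hii
    calc ENNReal.ofReal (p + 2) * ∫⁻ t in Set.Ioi 0,
          volume {x | t < min ‖u x‖ N} * ENNReal.ofReal (t ^ (p + 2 - 1))
        ≤ ENNReal.ofReal (p + 2) * ∫⁻ t in Set.Ioi (0 : ℝ),
          (Set.Ioc 0 N).indicator (fun t => ENNReal.ofReal (K * t ^ (ρ - 1))) t := by
          exact mul_le_mul' le_rfl (setLIntegral_mono' measurableSet_Ioi hbd)
      _ ≤ ENNReal.ofReal (p + 2) * ∫⁻ t in Set.Ioc (0 : ℝ) N, ENNReal.ofReal (K * t ^ (ρ - 1)) := by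
          refine mul_le_mul' le_rfl ?_
          rw [← lintegral_indicator measurableSet_Ioc]
          exact setLIntegral_le_lintegral _ _
      _ = ENNReal.ofReal (p + 2) * ENNReal.ofReal (∫ t in (0 : ℝ)..N, K * t ^ (ρ - 1)) := by
          rw [intervalIntegral.integral_of_le hN.le, ofReal_integral_eq_lintegral_ofReal hIoc]
          refine (ae_restrict_mem measurableSet_Ioc).mono fun t ht => ?_
          have := ht.1
          simp only [Pi.zero_apply]
          positivity
      _ = _ := by
          rw [intervalIntegral.integral_const_mul, integral_rpow (Or.inl (by linarith)),
            ← ENNReal.ofReal_mul (by linarith)]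
          congr 1
          rw [sub_add_cancel, Real.zero_rpow hρ0.ne', hK]
          field_simp
          ring
  refine (ENNReal.ofReal_le_ofReal_iff ?_).1 hcalc
  have := gradSq_nonneg u; have := mass_nonneg u; positivity

theorem rpow_le_min_add {t N p q : ℝ} (ht : 0 ≤ t) (hN : 0 < N) (hpq : p ≤ q) :
    t ^ (p + 2) ≤ min t N ^ (p + 2) + N ^ (p - q) * t ^ (q + 2) := by
  rcases le_total t N with h | h
  · rw [min_eq_left h]
    have : 0 ≤ N ^ (p - q) * t ^ (q + 2) := by positivity
    linarith
  · have ht0 : 0 < t := hN.trans_le h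
    have h1 : t ^ (p + 2) = t ^ (p - q) * t ^ (q + 2) := by
      rw [← Real.rpow_add ht0]; congr 1; ring
    have h2 : t ^ (p - q) ≤ N ^ (p - q) := Real.rpow_le_rpow_of_nonpos hN h (by linarith)
    have h3 : 0 ≤ min t N ^ (p + 2) := Real.rpow_nonneg (le_min ht hN.le) _
    rw [h1]
    have : 0 ≤ t ^ (q + 2) := by positivity
    nlinarith

/-- Splits |u| at height N. Since N is free, the p₀ term gets an arbitrarily small coefficient when
N is large, while small N weakens the gradient term. -/
theorem exists_gagliardo_nirenberg (hd : 1 ≤ d) {p₀ p₁ : ℝ} (hp₁ : 4 / (d : ℝ) < p₁)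
    (hp : p₁ < p₀) : ∃ C : ℝ, 0 < C ∧ ∀ u : Space d → ℂ, MemX p₀ u → ∀ N : ℝ, 0 < N →
      powInt p₁ u ≤ C * gradSq u * mass u ^ (2 / (d : ℝ)) * N ^ (p₁ - 4 / (d : ℝ))
        + N ^ (p₁ - p₀) * powInt p₀ u := by
  obtain ⟨C, hC, h⟩ := exists_integral_min_rpow_le hd hp₁
  have hp₁0 : 0 < p₁ := lt_of_le_of_lt (by positivity) hp₁
  refine ⟨C, hC, fun u hu N hN => ?_⟩
  have h2 := h u hu.1 N hN
  have h3 : powInt p₁ u ≤ (∫ x, min ‖u x‖ N ^ (p₁ + 2)) + N ^ (p₁ - p₀) * powInt p₀ u := by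
    rw [powInt, powInt, ← integral_const_mul,
      ← integral_add (integrable_min_rpow hu.1.1 hN hp₁0.le)
        ((hu.integrable_pow (by linarith)).const_mul _)]
    exact integral_mono (hu.integrable_pow_of_le hp₁0.le hp.le (by linarith))
      ((integrable_min_rpow hu.1.1 hN hp₁0.le).add ((hu.integrable_pow (by linarith)).const_mul _))
      fun x => rpow_le_min_add (norm_nonneg _) hN hp.le
  linarith

/-! ### Coercivity -/

/-- With vanishing gradient the weak-type bound makes every superlevel set null. -/
theorem MemH1.gradSq_pos (hd : 1 ≤ d) {u : Space d → ℂ} (hu : MemH1 u) (hm : 0 < mass u) :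
    0 < gradSq u := by
  refine (gradSq_nonneg u).lt_of_ne fun h => ?_
  obtain ⟨C, -, hw⟩ := exists_weak_type hd
  have h1 : ∀ n : ℕ, volume {x | 1 / ((n : ℝ) + 1) < ‖u x‖} = 0 := by
    intro n
    have := hw u hu (1 / ((n : ℝ) + 1)) (by positivity)
    rw [← h] at this
    simpa using this
  have h2 : ∀ᵐ x, ∀ n : ℕ, ‖u x‖ ≤ 1 / ((n : ℝ) + 1) := by
    rw [ae_all_iff]
    intro n
    rw [ae_iff]
    simpa [not_le] using h1 n
  have h3 : (fun x => ‖u x‖ ^ 2) =ᵐ[volume] 0 := by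
    filter_upwards [h2] with x hx
    have : ‖u x‖ ≤ 0 := ge_of_tendsto' tendsto_one_div_add_atTop_nhds_zero_nat hx
    have : ‖u x‖ = 0 := le_antisymm this (norm_nonneg _)
    simp [this]
  have : mass u = 0 := integral_eq_zero_of_ae h3
  exact hm.ne' this

theorem powInt_pos {p : ℝ} (hp : 0 < p + 2) {u : Space d → ℂ} (hm : 0 < mass u)
    (hi : Integrable (fun x => ‖u x‖ ^ (p + 2)) volume) : 0 < powInt p u := by
  refine (powInt_nonneg p u).lt_of_ne fun h => ?_
  have h1 := (integral_eq_zero_iff_of_nonneg (fun x => by positivity) hi).1 h.symm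
  have : mass u = 0 := by
    refine integral_eq_zero_of_ae ?_
    filter_upwards [h1] with x hx
    have : ‖u x‖ = 0 := (Real.rpow_eq_zero (norm_nonneg _) hp.ne').1 hx
    simp [this]
  exact hm.ne' this

/-- The exponent may have either sign, so the same choice supplies small heights and large ones. -/
theorem exists_mul_rpow_le {a ρ ε : ℝ} (ha : 0 ≤ a) (hρ : ρ ≠ 0) (hε : 0 < ε) :
    ∃ N : ℝ, 0 < N ∧ a * N ^ ρ ≤ ε := by
  refine ⟨(ε / (a + 1)) ^ (1 / ρ), by positivity, ?_⟩
  rw [← Real.rpow_mul (by positivity), one_div_mul_cancel hρ, Real.rpow_one, mul_div_assoc',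
    div_le_iff₀ (by positivity)]
  nlinarith

theorem powInt_le_mass_add {p₀ p₁ : ℝ} (hp₁ : 0 < p₁) (hp : p₁ < p₀) {u : Space d → ℂ}
    (hu : MemX p₀ u) {N : ℝ} (hN : 0 < N) :
    powInt p₁ u ≤ N ^ p₁ * mass u + N ^ (p₁ - p₀) * powInt p₀ u := by
  rw [powInt, powInt, mass, ← integral_const_mul, ← integral_const_mul,
      ← integral_add ((MemLp.integrable_norm_sq hu.1.1).const_mul _)
        ((hu.integrable_pow (by linarith)).const_mul _)]
  refine integral_mono (hu.integrable_pow_of_le hp₁.le hp.le (by linarith))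
      (((MemLp.integrable_norm_sq hu.1.1).const_mul _).add
        ((hu.integrable_pow (by linarith)).const_mul _))
      fun x => (rpow_le_min_add (norm_nonneg _) hN hp.le).trans ?_
  gcongr
  exact min_rpow_le_sq (norm_nonneg _) hN hp₁.le

/-- Large N lets half of the p₀ term absorb the high part of the p₁ term; the low part costs only
mass. Energy and mass thus bound G and the p₀ term from above. -/
theorem exists_energy_bound {p₀ p₁ : ℝ} (hp₁ : 0 < p₁) (hp : p₁ < p₀) :
    ∃ C : ℝ, 0 < C ∧ ∀ u : Space d → ℂ, MemX p₀ u →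
      gradSq u + 1 / (p₀ + 2) * powInt p₀ u ≤ energy p₀ p₁ u + C * mass u := by
  obtain ⟨N, hN, h⟩ := exists_mul_rpow_le (a := 2 / (p₁ + 2)) (ρ := p₁ - p₀) (ε := 1 / (p₀ + 2))
    (by positivity) (by linarith) (by have : 0 < p₀ := by linarith
                                      positivity)
  refine ⟨2 / (p₁ + 2) * N ^ p₁, by positivity, fun u hu => ?_⟩
  have h1 := mul_le_mul_of_nonneg_left (powInt_le_mass_add hp₁ hp hu hN)
    (by positivity : 0 ≤ 2 / (p₁ + 2))
  have h2 := mul_le_mul_of_nonneg_right h (powInt_nonneg p₀ u)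
  rw [energy]
  have e : 2 / (p₀ + 2) * powInt p₀ u = 2 * (1 / (p₀ + 2) * powInt p₀ u) := by ring
  rw [e]
  nlinarith

/-- First N is fixed so that the defocusing term absorbs its share, then the factor mass^(2/d) is
made small enough for the gradient to absorb the rest. -/
theorem exists_energy_nonneg_of_small_mass (hd : 1 ≤ d) {p₀ p₁ : ℝ} (hp₁ : 4 / (d : ℝ) < p₁)
    (hp : p₁ < p₀) : ∃ m : ℝ, 0 < m ∧ ∀ u : Space d → ℂ, MemX p₀ u → mass u ≤ m →
      0 ≤ energy p₀ p₁ u := by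
  have hp₁0 : 0 < p₁ := lt_of_le_of_lt (by positivity) hp₁
  have hp₀0 : 0 < p₀ := by linarith
  have hd0 : (0 : ℝ) < d := by exact_mod_cast hd
  obtain ⟨C, hC, hgn⟩ := exists_gagliardo_nirenberg hd hp₁ hp
  obtain ⟨N, hN, h⟩ := exists_mul_rpow_le (a := 2 / (p₁ + 2)) (ρ := p₁ - p₀) (ε := 2 / (p₀ + 2))
    (by positivity) (by linarith) (by positivity)
  obtain ⟨m, hm, h'⟩ := exists_mul_rpow_le (a := 2 / (p₁ + 2) * (C * N ^ (p₁ - 4 / (d : ℝ))))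
    (ρ := 2 / (d : ℝ)) (ε := 1) (by positivity) (by positivity) one_pos
  refine ⟨m, hm, fun u hu hum => ?_⟩
  have h1 := mul_le_mul_of_nonneg_left (hgn u hu N hN) (by positivity : 0 ≤ 2 / (p₁ + 2))
  have h2 := mul_le_mul_of_nonneg_right h (powInt_nonneg p₀ u)
  have hG := gradSq_nonneg u
  have h3 : mass u ^ (2 / (d : ℝ)) ≤ m ^ (2 / (d : ℝ)) :=
    Real.rpow_le_rpow (mass_nonneg u) hum (by positivity)
  have h4 : 2 / (p₁ + 2) * (C * N ^ (p₁ - 4 / (d : ℝ))) * mass u ^ (2 / (d : ℝ)) ≤ 1 :=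
    (mul_le_mul_of_nonneg_left h3 (by positivity)).trans h'
  have h5 := mul_le_mul_of_nonneg_right h4 hG
  rw [energy]
  nlinarith

/-! ### Truncation above a level and a lower bound on the gradient. -/

/-- The excess of `|u|` over the level `N`. -/
def excess (N : ℝ) (z : ℂ) : ℂ := ((max (‖z‖ - N) 0 : ℝ) : ℂ)

theorem norm_excess (N : ℝ) (z : ℂ) : ‖excess N z‖ = max (‖z‖ - N) 0 := by
  rw [excess, Complex.norm_real, Real.norm_of_nonneg (le_max_right _ _)]

theorem lipschitzWith_excess (N : ℝ) : LipschitzWith 1 (excess N) := by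
  refine LipschitzWith.of_dist_le_mul fun a b => ?_
  rw [dist_eq_norm, dist_eq_norm, excess, excess, ← Complex.ofReal_sub, Complex.norm_real,
    NNReal.coe_one, one_mul]
  refine (abs_max_sub_max_le_abs _ _ _).trans ?_
  rw [sub_sub_sub_cancel_right]
  exact abs_norm_sub_norm_le a b

theorem excess_zero {N : ℝ} (hN : 0 ≤ N) : excess N 0 = 0 := by
  simp [excess, hN]

/-- Above level N one has |u|² ≤ N^(-p₀)|u|^(p₀+2). The mass of the truncation is therefore
controlled by the p₀ term, which can be small when the mass of u is not. -/
theorem mass_excess_le {p₀ : ℝ} (hp₀ : 0 < p₀) {u : Space d → ℂ} (hu : MemX p₀ u) {N : ℝ}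
    (hN : 0 < N) : mass (fun x => excess N (u x)) ≤ N ^ (-p₀) * powInt p₀ u := by
  rw [mass, powInt, ← integral_const_mul]
  refine integral_mono (MemLp.integrable_norm_sq
    (hu.1.comp_lipschitz (lipschitzWith_excess N) (excess_zero hN.le)).1.1)
    ((hu.integrable_pow hp₀).const_mul _) fun x => ?_
  simp only [norm_excess]
  rcases le_total (‖u x‖) N with h | h
  · rw [max_eq_right (by linarith)]
    have : 0 ≤ N ^ (-p₀) * ‖u x‖ ^ (p₀ + 2) := by positivity
    simpa using this
  · rw [max_eq_left (by linarith)]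
    have ht : 0 < ‖u x‖ := hN.trans_le h
    have h1 : (‖u x‖ - N) ^ 2 ≤ ‖u x‖ ^ 2 := by
      have : 0 ≤ ‖u x‖ - N := by linarith
      gcongr
      linarith
    have h2 : (1 : ℝ) ≤ N ^ (-p₀) * ‖u x‖ ^ p₀ := by
      rw [Real.rpow_neg hN.le, ← div_eq_inv_mul, one_le_div (by positivity)]
      exact Real.rpow_le_rpow hN.le h hp₀.le
    rw [Real.rpow_add ht, Real.rpow_two]
    nlinarith [sq_nonneg (‖u x‖)]

theorem powInt_le_of_lipschitz {p : ℝ} (hp : 0 < p) {u : Space d → ℂ} (hu : MemX p u) {T : ℂ → ℂ}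
    (hT : LipschitzWith 1 T) (h0 : T 0 = 0) : powInt p (fun x => T (u x)) ≤ powInt p u := by
  refine integral_mono ((hu.comp_lipschitz hT h0).integrable_pow hp) (hu.integrable_pow hp)
    fun x => ?_
  have : ‖T (u x)‖ ≤ ‖u x‖ := by simpa [h0, dist_eq_norm] using hT.dist_le_mul (u x) 0
  exact Real.rpow_le_rpow (norm_nonneg _) this (by linarith)

/-- Above height 2N one has |u| ≤ 2(|u| - N). -/
theorem powInt_le_min_add_excess {p₀ p₁ : ℝ} (hp₁ : 0 < p₁) (hp : p₁ < p₀) {u : Space d → ℂ}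
    (hu : MemX p₀ u) {N : ℝ} (hN : 0 < N) :
    powInt p₁ u ≤ (∫ x, min ‖u x‖ (2 * N) ^ (p₁ + 2)) +
      2 ^ (p₁ + 2) * powInt p₁ (fun x => excess N (u x)) := by
  have hv := hu.comp_lipschitz (lipschitzWith_excess N) (excess_zero hN.le)
  have hi := (hv.integrable_pow_of_le hp₁.le hp.le (by linarith)).const_mul ((2 : ℝ) ^ (p₁ + 2))
  have hi2 := integrable_min_rpow hu.1.1 (by positivity : 0 < 2 * N) hp₁.le
  rw [powInt, powInt, ← integral_const_mul, ← integral_add hi2 hi]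
  refine integral_mono (hu.integrable_pow_of_le hp₁.le hp.le (by linarith)) (hi2.add hi)
    fun x => ?_
  simp only [norm_excess]
  rcases le_total (‖u x‖) (2 * N) with h | h
  · rw [min_eq_left h]
    have : 0 ≤ (2 : ℝ) ^ (p₁ + 2) * max (‖u x‖ - N) 0 ^ (p₁ + 2) :=
      mul_nonneg (by positivity) (Real.rpow_nonneg (le_max_right _ _) _)
    linarith
  · rw [← Real.mul_rpow (by norm_num) (le_max_right _ _), max_eq_left (by linarith)]
    have h1 : ‖u x‖ ^ (p₁ + 2) ≤ (2 * (‖u x‖ - N)) ^ (p₁ + 2) :=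
      Real.rpow_le_rpow (norm_nonneg _) (by linarith) (by linarith)
    have h2 : 0 ≤ min ‖u x‖ (2 * N) ^ (p₁ + 2) := by positivity
    linarith

/-- Nonpositive virial bounds the p₀ term by the p₁ term; Gagliardo–Nirenberg with large N returns
at most half of the p₀ term, which is absorbed. -/
theorem exists_powInt_le_gradSq (hd : 1 ≤ d) {p₀ p₁ : ℝ} (hp₁ : 4 / (d : ℝ) < p₁)
    (hp : p₁ < p₀) (m : ℝ) : ∃ C : ℝ, 0 < C ∧ ∀ u : Space d → ℂ, MemX p₀ u → mass u ≤ m →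
      virial p₀ p₁ u ≤ 0 → powInt p₀ u ≤ C * gradSq u := by
  have hp₁0 : 0 < p₁ := lt_of_le_of_lt (by positivity) hp₁
  have hp₀0 : 0 < p₀ := by linarith
  have hd0 : (0 : ℝ) < d := by exact_mod_cast hd
  set k₁ : ℝ := d * p₁ / (2 * (p₁ + 2)) with hk₁
  set k₀ : ℝ := d * p₀ / (2 * (p₀ + 2)) with hk₀
  have hk₁0 : 0 < k₁ := by positivity
  have hk₀0 : 0 < k₀ := by positivity
  obtain ⟨C, hC, hgn⟩ := exists_gagliardo_nirenberg hd hp₁ hp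
  obtain ⟨N, hN, h⟩ := exists_mul_rpow_le (a := k₁) (ρ := p₁ - p₀) (ε := k₀ / 2)
    hk₁0.le (by linarith) (by positivity)
  set D := C * |m| ^ (2 / (d : ℝ)) * N ^ (p₁ - 4 / (d : ℝ)) with hD
  refine ⟨2 * k₁ * D / k₀ + 1, by positivity, fun u hu hum hv => ?_⟩
  have h1 := mul_le_mul_of_nonneg_left (hgn u hu N hN) hk₁0.le
  have h2 := mul_le_mul_of_nonneg_right h (powInt_nonneg p₀ u)
  have hG := gradSq_nonneg u
  have h3 : mass u ^ (2 / (d : ℝ)) ≤ |m| ^ (2 / (d : ℝ)) :=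
    Real.rpow_le_rpow (mass_nonneg u) (hum.trans (le_abs_self m)) (by positivity)
  have h4 : C * gradSq u * mass u ^ (2 / (d : ℝ)) * N ^ (p₁ - 4 / (d : ℝ)) ≤ D * gradSq u := by
    calc _ = (C * N ^ (p₁ - 4 / (d : ℝ)) * gradSq u) * mass u ^ (2 / (d : ℝ)) := by ring
      _ ≤ (C * N ^ (p₁ - 4 / (d : ℝ)) * gradSq u) * |m| ^ (2 / (d : ℝ)) := by gcongr
      _ = _ := by rw [hD]; ring
  have h5 := mul_le_mul_of_nonneg_left h4 hk₁0.le
  rw [virial, ← hk₁, ← hk₀] at hv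
  have h6 : k₀ * powInt p₀ u ≤ 2 * k₁ * D * gradSq u := by nlinarith
  have h7 : powInt p₀ u ≤ 2 * k₁ * D / k₀ * gradSq u := by
    rw [div_mul_eq_mul_div, le_div_iff₀ hk₀0]
    linarith
  linarith

/-- Applied to u, Gagliardo–Nirenberg is only linear in G, so it yields no lower bound. The low part
of u is absorbed by a small height; the excess has mass O(G), which produces a superlinear term
G^(1+2/d). Hence G ≤ G/2 + C·G^(1+2/d), and G > 0 may be divided out. -/
theorem exists_gradSq_lower_bound (hd : 1 ≤ d) {p₀ p₁ : ℝ} (hp₁ : 4 / (d : ℝ) < p₁)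
    (hp : p₁ < p₀) (m : ℝ) : ∃ c : ℝ, 0 < c ∧ ∀ u : Space d → ℂ, MemX p₀ u → 0 < mass u →
      mass u ≤ m → virial p₀ p₁ u ≤ 0 → c ≤ gradSq u := by
  have hp₁0 : 0 < p₁ := lt_of_le_of_lt (by positivity) hp₁
  have hp₀0 : 0 < p₀ := by linarith
  have hd0 : (0 : ℝ) < d := by exact_mod_cast hd
  set k₁ : ℝ := d * p₁ / (2 * (p₁ + 2)) with hk₁
  have hk₁0 : 0 < k₁ := by positivity
  set κ := 2 / (d : ℝ) with hκ
  have hκ0 : 0 < κ := by positivity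
  set ρ := p₁ - 4 / (d : ℝ) with hρ
  have hρ0 : 0 < ρ := sub_pos.2 hp₁
  obtain ⟨C₁, hC₁, hB⟩ := exists_powInt_le_gradSq hd hp₁ hp m
  obtain ⟨C₂, hC₂, hmin⟩ := exists_integral_min_rpow_le hd hp₁
  obtain ⟨C₃, hC₃, hgn⟩ := exists_gagliardo_nirenberg hd hp₁ hp
  -- A small height N' makes the low part cost a quarter of G, and a large K below does the same for
  -- the p₀ contribution of the excess.
  obtain ⟨N', hN', h1⟩ := exists_mul_rpow_le (a := C₂ * |m| ^ κ) (ρ := ρ)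
    (ε := 1 / (4 * k₁)) (by positivity) hρ0.ne' (by positivity)
  obtain ⟨K, hK, h2⟩ := exists_mul_rpow_le (a := 2 ^ (p₁ + 2) * C₁) (ρ := p₁ - p₀)
    (ε := 1 / (4 * k₁)) (by positivity) (by linarith) (by positivity)
  set N := N' / 2 with hN
  have hN0 : 0 < N := by positivity
  set D := 2 ^ (p₁ + 2) * (C₃ * K ^ ρ) * (N ^ (-p₀) * C₁) ^ κ with hD
  have hD0 : 0 < D := by positivity
  -- The value of G at which 2k₁D·G^κ reaches 1.
  refine ⟨(1 / (2 * k₁ * D)) ^ (1 / κ), by positivity, fun u hu hm0 hum hv => ?_⟩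
  have hG : 0 < gradSq u := hu.1.gradSq_pos hd hm0
  set v : Space d → ℂ := fun x => excess N (u x) with hvdef
  have hvX : MemX p₀ v := hu.comp_lipschitz (lipschitzWith_excess N) (excess_zero hN0.le)
  have hBu := hB u hu hum hv
  have hGv : gradSq v ≤ gradSq u :=
    (hu.1.comp_lipschitz (lipschitzWith_excess N) (excess_zero hN0.le)).2
  have hBv : powInt p₀ v ≤ powInt p₀ u :=
    powInt_le_of_lipschitz hp₀0 hu (lipschitzWith_excess N) (excess_zero hN0.le)
  have hMv : mass v ≤ N ^ (-p₀) * C₁ * gradSq u := by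
    refine (mass_excess_le hp₀0 hu hN0).trans ?_
    rw [mul_assoc]
    gcongr
  have hMv' : mass v ^ κ ≤ (N ^ (-p₀) * C₁) ^ κ * gradSq u ^ κ := by
    rw [← Real.mul_rpow (by positivity) hG.le]
    exact Real.rpow_le_rpow (mass_nonneg _) hMv hκ0.le
  have hA : gradSq u ≤ k₁ * powInt p₁ u := by
    rw [virial, ← hk₁] at hv
    have : 0 ≤ d * p₀ / (2 * (p₀ + 2)) * powInt p₀ u :=
      mul_nonneg (by positivity) (powInt_nonneg _ _)
    linarith
  have hA1 := powInt_le_min_add_excess hp₁0 hp hu hN0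
  have hA2 : ∫ x, min ‖u x‖ (2 * N) ^ (p₁ + 2) ≤ 1 / (4 * k₁) * gradSq u := by
    have e : 2 * N = N' := by rw [hN]; ring
    rw [e]
    refine (hmin u hu.1 N' hN').trans ?_
    have h3 : mass u ^ κ ≤ |m| ^ κ :=
      Real.rpow_le_rpow (mass_nonneg u) (hum.trans (le_abs_self m)) hκ0.le
    calc C₂ * gradSq u * mass u ^ κ * N' ^ ρ ≤ C₂ * gradSq u * |m| ^ κ * N' ^ ρ := by gcongr
      _ = (C₂ * |m| ^ κ * N' ^ ρ) * gradSq u := by ring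
      _ ≤ _ := by gcongr
  have hA3 : 2 ^ (p₁ + 2) * powInt p₁ v ≤ D * gradSq u ^ κ * gradSq u + 1 / (4 * k₁) * gradSq u := by
    have h3 := hgn v hvX K hK
    have h4 : C₃ * gradSq v * mass v ^ κ * K ^ ρ ≤
        C₃ * gradSq u * ((N ^ (-p₀) * C₁) ^ κ * gradSq u ^ κ) * K ^ ρ := by
      have := mass_nonneg v
      have := gradSq_nonneg v
      gcongr
    have h5 : K ^ (p₁ - p₀) * powInt p₀ v ≤ K ^ (p₁ - p₀) * (C₁ * gradSq u) := by
      gcongr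
      exact hBv.trans hBu
    calc 2 ^ (p₁ + 2) * powInt p₁ v ≤ 2 ^ (p₁ + 2) *
          (C₃ * gradSq u * ((N ^ (-p₀) * C₁) ^ κ * gradSq u ^ κ) * K ^ ρ
            + K ^ (p₁ - p₀) * (C₁ * gradSq u)) := by
          gcongr
          exact h3.trans (add_le_add h4 h5)
      _ = D * gradSq u ^ κ * gradSq u + 2 ^ (p₁ + 2) * C₁ * K ^ (p₁ - p₀) * gradSq u := by
          rw [hD]; ring
      _ ≤ _ := by gcongr
  have hfin : gradSq u ≤ k₁ * (1 / (2 * k₁) * gradSq u + D * gradSq u ^ κ * gradSq u) := by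
    refine hA.trans (mul_le_mul_of_nonneg_left ?_ hk₁0.le)
    have e : 1 / (2 * k₁) * gradSq u = 1 / (4 * k₁) * gradSq u + 1 / (4 * k₁) * gradSq u := by
      field_simp; norm_num
    rw [e]
    linarith
  have hfin2 : 1 ≤ 2 * k₁ * D * gradSq u ^ κ := by
    have e : k₁ * (1 / (2 * k₁) * gradSq u + D * gradSq u ^ κ * gradSq u)
      = (1 / 2 + k₁ * D * gradSq u ^ κ) * gradSq u := by field_simp
    rw [e] at hfin
    have : (1 : ℝ) ≤ 1 / 2 + k₁ * D * gradSq u ^ κ :=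
      le_of_mul_le_mul_right (by rwa [one_mul]) hG
    linarith
  have hfin3 : 1 / (2 * k₁ * D) ≤ gradSq u ^ κ := by
    rw [div_le_iff₀ (by positivity)]
    linarith
  calc (1 / (2 * k₁ * D)) ^ (1 / κ) ≤ (gradSq u ^ κ) ^ (1 / κ) :=
        Real.rpow_le_rpow (by positivity) hfin3 (by positivity)
    _ = gradSq u := by rw [← Real.rpow_mul hG.le, mul_one_div_cancel hκ0.ne', Real.rpow_one]

/-! ### Adding mass at no cost -/

theorem exists_bump (d : ℕ) : ∃ φ : Space d → ℝ, ContDiff ℝ (⊤ : ℕ∞) φ ∧ HasCompactSupport φ ∧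
    (∀ x, 0 ≤ φ x) ∧ (∀ x, φ x ≤ 1) ∧ ∀ x, ‖x‖ ≤ 1 → φ x = 1 := by
  let f : ContDiffBump (0 : Space d) := ⟨1, 2, one_pos, one_lt_two⟩
  exact ⟨f, f.contDiff, f.hasCompactSupport, fun x => f.nonneg, fun x => f.le_one, fun x hx =>
    f.one_of_mem_closedBall (by simpa using hx)⟩

theorem mass_pos_of_bump {φ : Space d → ℝ} (hφ : ContDiff ℝ (⊤ : ℕ∞) φ) (hc : HasCompactSupport φ)
    (h1 : ∀ x, ‖x‖ ≤ 1 → φ x = 1) : 0 < mass fun x => (φ x : ℂ) := by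
  have hi := MemLp.integrable_norm_sq (memX_ofReal_test 1 hφ hc).1.1
  refine (integral_pos_iff_support_of_nonneg (fun x => by positivity) hi).2 ?_
  refine lt_of_lt_of_le (Metric.measure_ball_pos volume (0 : Space d) one_pos)
    (measure_mono fun x hx => ?_)
  have : φ x = 1 := h1 x (by simpa using (Metric.mem_ball.1 hx).le)
  simp [this]

/-! ### Continuity of the functionals under vanishing perturbations. -/

theorem powInt_eq_norm_rpow {p : ℝ} (hp : 0 < p + 2) {u : Space d → ℂ}
    (hu : MemLp u (ENNReal.ofReal (p + 2)) volume) : powInt p u = ‖hu.toLp u‖ ^ (p + 2) := by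
  rw [Lp.norm_toLp, hu.eLpNorm_eq_integral_rpow_norm (by simpa using hp) (by simp),
    ENNReal.toReal_ofReal hp.le, ENNReal.toReal_ofReal
      (Real.rpow_nonneg (integral_nonneg fun _ => by positivity) _),
    ← Real.rpow_mul (integral_nonneg fun _ => by positivity), inv_mul_cancel₀ hp.ne',
    Real.rpow_one]
  rfl

theorem tendsto_powInt_add {p : ℝ} (hp : 0 < p) {u : Space d → ℂ} {w : ℕ → Space d → ℂ}
    (hu : MemLp u (ENNReal.ofReal (p + 2)) volume)
    (hw : ∀ n, MemLp (w n) (ENNReal.ofReal (p + 2)) volume)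
    (h0 : Tendsto (fun n => powInt p (w n)) atTop (𝓝 0)) :
    Tendsto (fun n => powInt p (u + w n)) atTop (𝓝 (powInt p u)) := by
  have hq : 0 < p + 2 := by linarith
  have : Fact (1 ≤ ENNReal.ofReal (p + 2)) := ⟨by
    rw [← ENNReal.ofReal_one]; exact ENNReal.ofReal_le_ofReal (by linarith)⟩
  have h1 : Tendsto (fun n => (hw n).toLp (w n)) atTop (𝓝 0) := by
    rw [tendsto_zero_iff_norm_tendsto_zero]
    have h2 := (h0.rpow_const (p := 1 / (p + 2)) (Or.inr (by positivity)))
    rw [Real.zero_rpow (by positivity)] at h2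
    refine h2.congr fun n => ?_
    rw [powInt_eq_norm_rpow hq (hw n), ← Real.rpow_mul (norm_nonneg _),
      mul_one_div_cancel hq.ne', Real.rpow_one]
  have h3 : Tendsto (fun n => ‖hu.toLp u + (hw n).toLp (w n)‖ ^ (p + 2)) atTop
      (𝓝 (‖hu.toLp u‖ ^ (p + 2))) := by
    have := ((tendsto_const_nhds (x := hu.toLp u)).add h1).norm.rpow_const (p := p + 2)
      (Or.inr hq.le)
    simpa using this
  rw [powInt_eq_norm_rpow hq hu]
  refine h3.congr fun n => ?_
  rw [powInt_eq_norm_rpow hq (hu.add (hw n)), MemLp.toLp_add]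

theorem gradSq_const_smul {u : Space d → ℂ} (hu : MemH1 u) (c : ℂ) :
    gradSq (c • u) = ‖c‖ ^ 2 * gradSq u := by
  rw [gradSq_eq_of_weakPartial (fun i => (hu.weakPartial_memLp i).const_smul c)
    fun i => (hu.isWeakPartial i).const_smul c, gradSq, ← integral_const_mul]
  refine integral_congr_ae (ae_of_all _ fun x => ?_)
  simp [Finset.mul_sum, mul_pow]

theorem abs_gradInner_le {u w : Space d → ℂ} (hu : MemH1 u) (hw : MemH1 w) {t : ℝ} (ht : 0 < t) :
    2 * |gradInner u w| ≤ t * gradSq u + t⁻¹ * gradSq w := by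
  have h1 := gradSq_add_smul hu hw t⁻¹
  have h2 := gradSq_add_smul hu hw (-t⁻¹)
  have h3 := gradSq_nonneg (u + ((t⁻¹ : ℝ) : ℂ) • w)
  have h4 := gradSq_nonneg (u + ((-t⁻¹ : ℝ) : ℂ) • w)
  have e : ∀ g : ℝ, 2 * g = t * (2 * t⁻¹ * g) := by intro g; field_simp
  have e2 : t * gradSq u + t⁻¹ * gradSq w = t * (gradSq u + t⁻¹ ^ 2 * gradSq w) := by
    field_simp
  rw [e, e2]
  refine mul_le_mul_of_nonneg_left ?_ ht.le
  have e3 : 2 * t⁻¹ * |gradInner u w| = |2 * t⁻¹ * gradInner u w| := by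
    rw [abs_mul, abs_of_pos (by positivity : 0 < 2 * t⁻¹)]
  rw [e3, abs_le]
  constructor <;> nlinarith

theorem tendsto_gradSq_add {u : Space d → ℂ} {w : ℕ → Space d → ℂ} (hu : MemH1 u)
    (hw : ∀ n, MemH1 (w n)) (h0 : Tendsto (fun n => gradSq (w n)) atTop (𝓝 0)) :
    Tendsto (fun n => gradSq (u + w n)) atTop (𝓝 (gradSq u)) := by
  have hin : Tendsto (fun n => gradInner u (w n)) atTop (𝓝 0) := by
    rw [Metric.tendsto_atTop]
    intro ε hε
    set t := ε / (gradSq u + 1) with ht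
    have hG := gradSq_nonneg u
    have ht0 : 0 < t := by positivity
    obtain ⟨n₀, hn₀⟩ := Metric.tendsto_atTop.1 h0 (t * (ε / 2)) (by positivity)
    refine ⟨n₀, fun n hn => ?_⟩
    have h1 := abs_gradInner_le hu (hw n) ht0
    have h2 := hn₀ n hn
    rw [Real.dist_eq, sub_zero, abs_of_nonneg (gradSq_nonneg _)] at h2
    have h3 : t * gradSq u ≤ ε := by
      rw [ht, div_mul_eq_mul_div, div_le_iff₀ (by positivity)]
      nlinarith
    have h4 : t⁻¹ * gradSq (w n) < ε / 2 := by
      rw [inv_mul_lt_iff₀ ht0]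
      exact h2
    rw [Real.dist_eq, sub_zero]
    linarith
  have e : ∀ n, gradSq (u + w n) = gradSq u + 2 * gradInner u (w n) + gradSq (w n) := by
    intro n
    have := gradSq_add_smul hu (hw n) 1
    simpa using this
  simp_rw [e]
  simpa using (tendsto_const_nhds.add (hin.const_mul 2)).add h0

/-- A bump spread over ever larger balls keeps its mass while its gradient and its higher powers
tend to 0. Adding a multiple of it raises the mass to m and leaves the other functionals unchanged
in the limit. -/
theorem exists_add_mass (hd : 1 ≤ d) {p₀ p₁ : ℝ} (hp₁ : 0 < p₁) (hp : p₁ < p₀)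
    {u : Space d → ℂ} (hu : MemX p₀ u) {m : ℝ} (hm : mass u ≤ m) :
    ∃ v : ℕ → Space d → ℂ, (∀ n, MemX p₀ (v n)) ∧ (∀ n, mass (v n) = m) ∧
      Tendsto (fun n => gradSq (v n)) atTop (𝓝 (gradSq u)) ∧
      Tendsto (fun n => powInt p₁ (v n)) atTop (𝓝 (powInt p₁ u)) ∧
      Tendsto (fun n => powInt p₀ (v n)) atTop (𝓝 (powInt p₀ u)) := by
  have hp₀ : 0 < p₀ := by linarith
  have hd0 : (0 : ℝ) < d := by exact_mod_cast hd
  obtain ⟨φ, hφ, hc, -, -, hφ1⟩ := exists_bump d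
  set f : Space d → ℂ := fun x => (φ x : ℂ) with hf
  have hfX : MemX p₀ f := memX_ofReal_test p₀ hφ hc
  have hM : 0 < mass f := mass_pos_of_bump hφ hc hφ1
  set l : ℕ → ℝ := fun n => 1 / ((n : ℝ) + 1) with hl
  have hl0 : ∀ n, 0 < l n := fun n => by simp only [hl]; positivity
  have hlt : Tendsto l atTop (𝓝 0) := tendsto_one_div_add_atTop_nhds_zero_nat
  -- The amplitude l^(d/2) keeps the mass fixed; the gradient scales as l² and the p-term as
  -- l^(dp/2).
  set g : ℕ → Space d → ℂ := fun n => rescale (l n ^ ((d : ℝ) / 2)) (l n) f with hg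
  have hgX : ∀ n, MemX p₀ (g n) := fun n => hfX.rescale hp₀ _ (hl0 n)
  have hsq : ∀ n, (l n ^ ((d : ℝ) / 2)) ^ 2 = l n ^ (d : ℝ) := fun n => by
    rw [← Real.rpow_natCast, ← Real.rpow_mul (hl0 n).le]; congr 1; push_cast; ring
  have hgM : ∀ n, mass (g n) = mass f := fun n => by
    rw [hg, mass_rescale _ _ (hl0 n), hsq, ← Real.rpow_add (hl0 n)]
    simp
  have hgG : ∀ n, gradSq (g n) = l n ^ (2 : ℝ) * gradSq f := fun n => by
    rw [hg, gradSq_rescale hfX.1 _ (hl0 n), hsq, ← Real.rpow_add (hl0 n)]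
    congr 2; ring
  have hgP : ∀ p n, powInt p (g n) = l n ^ ((d : ℝ) * p / 2) * powInt p f := fun p n => by
    rw [hg, powInt_rescale _ _ (by have := hl0 n; positivity) (hl0 n),
      ← Real.rpow_mul (hl0 n).le, ← Real.rpow_add (hl0 n)]
    congr 2; ring
  have hrp : ∀ {e : ℝ}, 0 < e → Tendsto (fun n => l n ^ e) atTop (𝓝 0) := by
    intro e he
    have := hlt.rpow_const (p := e) (Or.inr he.le)
    rwa [Real.zero_rpow he.ne'] at this
  -- choice of the coefficient
  have hex : ∀ n, ∃ c : ℝ, c ^ 2 ≤ (m - mass u) / mass f ∧ mass (u + (c : ℂ) • g n) = m := by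
    intro n
    have key : ∀ b : ℝ, 0 ≤ b → ∃ c ∈ Set.Icc 0 (√((m - mass u) / mass f)),
        mass u + 2 * c * b + c ^ 2 * mass f = m := by
      intro b hb
      have hnn : 0 ≤ (m - mass u) / mass f := div_nonneg (by linarith) hM.le
      have hcont : ContinuousOn (fun c : ℝ => mass u + 2 * c * b + c ^ 2 * mass f)
          (Set.Icc 0 (√((m - mass u) / mass f))) := by fun_prop
      refine (intermediate_value_Icc (Real.sqrt_nonneg _) hcont) ⟨by simpa using hm, ?_⟩
      have e : √((m - mass u) / mass f) ^ 2 * mass f = m - mass u := by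
        rw [Real.sq_sqrt hnn]; field_simp
      have : 0 ≤ 2 * √((m - mass u) / mass f) * b := by positivity
      linarith
    have hnn : 0 ≤ (m - mass u) / mass f := div_nonneg (by linarith) hM.le
    have hb : ∀ c ∈ Set.Icc 0 (√((m - mass u) / mass f)), c ^ 2 ≤ (m - mass u) / mass f := by
      intro c hc
      rw [← Real.sq_sqrt hnn]
      exact pow_le_pow_left₀ hc.1 hc.2 2
    -- The sign of the coefficient follows that of the cross term, so that this term only helps to
    -- reach mass m and the coefficient stays bounded.
    rcases le_total 0 (inner2 u (g n)) with h | h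
    · obtain ⟨c, hc, hce⟩ := key _ h
      refine ⟨c, hb c hc, ?_⟩
      rw [mass_add_smul hu.1 (hgX n).1, hgM, hce]
    · obtain ⟨c, hc, hce⟩ := key (-inner2 u (g n)) (by linarith)
      refine ⟨-c, by rw [neg_sq]; exact hb c hc, ?_⟩
      rw [mass_add_smul hu.1 (hgX n).1, hgM, ← hce]
      ring
  choose c hc hce using hex
  set R := (m - mass u) / mass f with hR
  have hwX : ∀ n, MemX p₀ ((c n : ℂ) • g n) := fun n => (hgX n).const_smul _
  have hcabs : ∀ n, |c n| ≤ √R := fun n => Real.abs_le_sqrt (hc n)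
  have hwG : Tendsto (fun n => gradSq ((c n : ℂ) • g n)) atTop (𝓝 0) := by
    have e : ∀ n, gradSq ((c n : ℂ) • g n) = c n ^ 2 * gradSq (g n) := by
      intro n
      rw [gradSq_const_smul (hgX n).1, Complex.norm_real, Real.norm_eq_abs, sq_abs]
    have hb : Tendsto (fun n => R * (l n ^ (2 : ℝ) * gradSq f)) atTop (𝓝 0) := by
      simpa using ((hrp (by norm_num : (0 : ℝ) < 2)).mul_const (gradSq f)).const_mul R
    refine squeeze_zero (fun n => gradSq_nonneg _) (fun n => ?_) hb
    rw [e, hgG]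
    have := gradSq_nonneg f
    have := hl0 n
    exact mul_le_mul_of_nonneg_right (hc n) (by positivity)
  have hwP : ∀ p : ℝ, 0 < p → Tendsto (fun n => powInt p ((c n : ℂ) • g n)) atTop (𝓝 0) := by
    intro p hp
    have hb : Tendsto (fun n => √R ^ (p + 2) * (l n ^ ((d : ℝ) * p / 2) * powInt p f))
        atTop (𝓝 0) := by
      simpa using ((hrp (by positivity : 0 < (d : ℝ) * p / 2)).mul_const (powInt p f)).const_mul
        (√R ^ (p + 2))
    refine squeeze_zero (fun n => powInt_nonneg _ _) (fun n => ?_) hb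
    rw [powInt_const_smul, hgP]
    have := powInt_nonneg p f
    have := hl0 n
    refine mul_le_mul_of_nonneg_right ?_ (by positivity)
    rw [Complex.norm_real]
    exact Real.rpow_le_rpow (norm_nonneg _) (hcabs n) (by linarith)
  exact ⟨fun n => u + (c n : ℂ) • g n, fun n => hu.add (hwX n), hce,
    tendsto_gradSq_add hu.1 (fun n => (hwX n).1) hwG,
    tendsto_powInt_add hp₁ (hu.memLp_of_le hp₁.le hp.le hp₀)
      (fun n => (hwX n).memLp_of_le hp₁.le hp.le hp₀) (hwP p₁ hp₁),
    tendsto_powInt_add hp₀ hu.2 (fun n => (hwX n).2) (hwP p₀ hp₀)⟩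

/-! ### The Brezis–Lieb lemma -/

/-- Convexity of x^q applied to x + y = τ(x/τ) + (1-τ)(y/(1-τ)), with τ fixed by τ^(1-q) = 1 + ε. -/
theorem exists_add_rpow_le {q ε : ℝ} (hq : 1 < q) (hε : 0 < ε) : ∃ C : ℝ, 0 < C ∧
    ∀ x y : ℝ, 0 ≤ x → 0 ≤ y → (x + y) ^ q ≤ (1 + ε) * x ^ q + C * y ^ q := by
  set τ : ℝ := (1 + ε) ^ (-(1 / (q - 1))) with hτ
  have hq1 : 0 < q - 1 := by linarith
  have hτ0 : 0 < τ := by positivity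
  have hτ1 : τ < 1 := Real.rpow_lt_one_of_one_lt_of_neg (by linarith) (by
    have : 0 < 1 / (q - 1) := by positivity
    linarith)
  have hτq : τ ^ (1 - q) = 1 + ε := by
    rw [hτ, ← Real.rpow_mul (by linarith)]
    have : -(1 / (q - 1)) * (1 - q) = 1 := by field_simp; ring
    rw [this, Real.rpow_one]
  have h1τ : 0 < 1 - τ := by linarith
  refine ⟨(1 - τ) ^ (1 - q), by positivity, fun x y hx hy => ?_⟩
  have h := (convexOn_rpow hq.le).2 (x := x / τ) (y := y / (1 - τ))
    (Set.mem_Ici.2 (by positivity)) (Set.mem_Ici.2 (by positivity)) hτ0.le h1τ.le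
    (add_sub_cancel _ _)
  simp only [smul_eq_mul] at h
  rw [mul_div_cancel₀ _ hτ0.ne', mul_div_cancel₀ _ h1τ.ne', Real.div_rpow hx hτ0.le,
    Real.div_rpow hy h1τ.le] at h
  rw [← hτq, Real.rpow_sub hτ0, Real.rpow_sub h1τ, Real.rpow_one, Real.rpow_one]
  calc (x + y) ^ q ≤ _ := h
    _ = _ := by ring

theorem exists_abs_norm_rpow_sub_le {q ε : ℝ} (hq : 1 < q) (hε : 0 < ε) : ∃ C : ℝ, 0 < C ∧
    ∀ a b : ℂ, |‖a + b‖ ^ q - ‖a‖ ^ q| ≤ ε * ‖a‖ ^ q + C * ‖b‖ ^ q := by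
  obtain ⟨C, hC, h⟩ := exists_add_rpow_le hq hε
  refine ⟨C, hC, fun a b => ?_⟩
  have h1 : ‖a + b‖ ^ q ≤ (1 + ε) * ‖a‖ ^ q + C * ‖b‖ ^ q :=
    (Real.rpow_le_rpow (norm_nonneg _) (norm_add_le _ _) (by linarith)).trans
      (h _ _ (norm_nonneg _) (norm_nonneg _))
  have h2 : ‖a‖ ^ q ≤ (1 + ε) * ‖a + b‖ ^ q + C * ‖b‖ ^ q := by
    refine (Real.rpow_le_rpow (norm_nonneg _) ?_ (by linarith)).trans
      (h _ _ (norm_nonneg (a + b)) (norm_nonneg b))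
    have := norm_sub_le (a + b) b
    simpa using this
  have h3 : 0 ≤ ‖a‖ ^ q := by positivity
  have h4 : 0 ≤ ‖b‖ ^ q := by positivity
  have h5 : 0 ≤ ‖a + b‖ ^ q := by positivity
  rw [abs_le]
  constructor
  · rcases le_total (‖a‖ ^ q) (‖a + b‖ ^ q) with h6 | h6
    · have : 0 ≤ ε * ‖a‖ ^ q + C * ‖b‖ ^ q := by positivity
      linarith
    · nlinarith
  · linarith

/-- Brezis–Lieb. The pointwise defect is at most ε|rₙ|^q plus a multiple of |f|^q: the first
contribution is uniformly small, the second dominates the rest. -/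
theorem tendsto_powInt_sub_powInt {p : ℝ} (hp : 0 < p) {f : Space d → ℂ} {r : ℕ → Space d → ℂ}
    (hf : MemLp f (ENNReal.ofReal (p + 2)) volume)
    (hr : ∀ n, MemLp (r n) (ENNReal.ofReal (p + 2)) volume) {K : ℝ}
    (hK : ∀ n, powInt p (r n + f) ≤ K) (h0 : ∀ᵐ x, Tendsto (fun n => r n x) atTop (𝓝 0)) :
    Tendsto (fun n => powInt p (r n + f) - powInt p (r n)) atTop (𝓝 (powInt p f)) := by
  have hq : 1 < p + 2 := by linarith
  have hq0 : 0 < p + 2 := by linarith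
  have hint : ∀ {g : Space d → ℂ}, MemLp g (ENNReal.ofReal (p + 2)) volume →
      Integrable (fun x => ‖g x‖ ^ (p + 2)) volume := fun hg =>
    (integrable_norm_rpow_iff_memLp hg.1 hq0).2 hg
  have hfi := hint hf
  have hri := fun n => hint (hr n)
  have hsi := fun n => hint ((hr n).add hf)
  obtain ⟨C₁, hC₁, hineq₁⟩ := exists_abs_norm_rpow_sub_le hq one_pos
  set K' := 2 * K + C₁ * powInt p f with hK'
  have hrK : ∀ n, powInt p (r n) ≤ K' := by
    intro n
    have : powInt p (r n) ≤ 2 * powInt p (r n + f) + C₁ * powInt p f := by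
      rw [powInt, powInt, powInt, ← integral_const_mul, ← integral_const_mul,
        ← integral_add ((hsi n).const_mul _) (hfi.const_mul _)]
      refine integral_mono (hri n) (((hsi n).const_mul _).add (hfi.const_mul _)) fun x => ?_
      have := hineq₁ (r n x + f x) (-f x)
      rw [norm_neg, add_neg_cancel_right] at this
      have := (abs_le.1 this).2
      simp only [Pi.add_apply]
      linarith
    have := hK n
    rw [hK']
    linarith
  have hK'0 : 0 ≤ K' := (powInt_nonneg _ _).trans (hrK 0)
  rw [Metric.tendsto_atTop]
  intro δ hδ
  set ε := δ / (2 * (K' + 1)) with hε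
  have hε0 : 0 < ε := by positivity
  obtain ⟨C, hC, hineq⟩ := exists_abs_norm_rpow_sub_le hq hε0
  set D : ℕ → Space d → ℝ := fun n x =>
    ‖(r n + f) x‖ ^ (p + 2) - ‖r n x‖ ^ (p + 2) - ‖f x‖ ^ (p + 2) with hD
  have hDi : ∀ n, Integrable (D n) volume := fun n => ((hsi n).sub (hri n)).sub hfi
  -- Removing ε|rₙ|^q leaves a quantity dominated by |f|^q that tends to 0 almost everywhere.
  set W : ℕ → Space d → ℝ := fun n x => max (|D n x| - ε * ‖r n x‖ ^ (p + 2)) 0 with hW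
  have hWi : ∀ n, Integrable (W n) volume := fun n =>
    ((hDi n).abs.sub ((hri n).const_mul ε)).pos_part
  have hWle : ∀ n x, W n x ≤ (C + 1) * ‖f x‖ ^ (p + 2) := by
    intro n x
    have h1 := hineq (r n x) (f x)
    have h2 : 0 ≤ ‖f x‖ ^ (p + 2) := by positivity
    refine max_le ?_ (by positivity)
    have h3 : |D n x| ≤ |‖r n x + f x‖ ^ (p + 2) - ‖r n x‖ ^ (p + 2)| + ‖f x‖ ^ (p + 2) := by
      refine (abs_sub _ _).trans ?_
      rw [abs_of_nonneg h2]
      rfl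
    linarith
  have hWlim : Tendsto (fun n => ∫ x, W n x) atTop (𝓝 0) := by
    have : ∫ x : Space d, (0 : ℝ) = 0 := by simp
    rw [← this]
    refine tendsto_integral_of_dominated_convergence _ (fun n => (hWi n).1)
      (hfi.const_mul (C + 1)) (fun n => ae_of_all _ fun x => ?_) ?_
    · rw [Real.norm_of_nonneg (le_max_right _ _)]
      exact hWle n x
    · filter_upwards [h0] with x hx
      have hc : Continuous fun z : ℂ => max (|‖z + f x‖ ^ (p + 2) - ‖z‖ ^ (p + 2)
          - ‖f x‖ ^ (p + 2)| - ε * ‖z‖ ^ (p + 2)) 0 := by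
        have h1 : Continuous fun z : ℂ => ‖z + f x‖ ^ (p + 2) :=
          (Real.continuous_rpow_const hq0.le).comp (by fun_prop)
        have h2 : Continuous fun z : ℂ => ‖z‖ ^ (p + 2) :=
          (Real.continuous_rpow_const hq0.le).comp (by fun_prop)
        fun_prop
      have := (hc.tendsto 0).comp hx
      simp only [zero_add, norm_zero, Real.zero_rpow hq0.ne', sub_zero, sub_self, abs_zero, mul_zero,
        max_self] at this
      exact this
  obtain ⟨n₀, hn₀⟩ := Metric.tendsto_atTop.1 hWlim (δ / 2) (by positivity)
  refine ⟨n₀, fun n hn => ?_⟩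
  have h1 := hn₀ n hn
  rw [Real.dist_eq, sub_zero, abs_of_nonneg (integral_nonneg fun x => le_max_right _ _)] at h1
  have h2 : powInt p (r n + f) - powInt p (r n) - powInt p f = ∫ x, D n x := by
    rw [powInt, powInt, powInt, ← integral_sub (hsi n) (hri n)]
    exact (integral_sub ((hsi n).sub (hri n)) hfi).symm
  rw [Real.dist_eq, h2]
  calc |∫ x, D n x| ≤ ∫ x, |D n x| := abs_integral_le_integral_abs
    _ ≤ ∫ x, (W n x + ε * ‖r n x‖ ^ (p + 2)) := by
      refine integral_mono (hDi n).abs ((hWi n).add ((hri n).const_mul ε)) fun x => ?_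
      have : |D n x| - ε * ‖r n x‖ ^ (p + 2) ≤ W n x := le_max_left _ _
      linarith
    _ = (∫ x, W n x) + ε * powInt p (r n) := by
      rw [integral_add (hWi n) ((hri n).const_mul ε), integral_const_mul]; rfl
    _ < δ := by
      have h3 : ε * powInt p (r n) ≤ ε * K' := by gcongr; exact hrK n
      have h4 : ε * K' ≤ δ / 2 := by
        rw [hε, div_mul_eq_mul_div, div_le_iff₀ (by positivity)]
        nlinarith
      linarith

/-! ### Concentration compactness -/

/-- Vanishing is excluded. If all averages at radius r were at most N/2, the set |u| > N would have
measure at most δ. The ranges below N, between N and K, and above K would then contribute at most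
c/4 each to the p₁ integral, against the lower bound c. -/
theorem exists_lower_bound_ballAvg {p₀ p₁ : ℝ} (hp₁ : 0 < p₁) (hp : p₁ < p₀) {M G B c : ℝ}
    (hM : 0 ≤ M) (hG : 0 ≤ G) (hB : 0 ≤ B) (hc : 0 < c) :
    ∃ r η : ℝ, 0 < r ∧ 0 < η ∧ ∀ u : Space d → ℂ, MemX p₀ u → mass u ≤ M → gradSq u ≤ G →
      powInt p₀ u ≤ B → c ≤ powInt p₁ u → ∃ x, η < ‖ballAvg r u x‖ := by
  have hp₀ : 0 < p₀ := by linarith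
  obtain ⟨N, hN, hN'⟩ := exists_mul_rpow_le (ρ := p₁) hM hp₁.ne' (by positivity : 0 < c / 4)
  obtain ⟨K, hK, hK'⟩ := exists_mul_rpow_le (ρ := p₁ - p₀) hB (by linarith)
    (by positivity : 0 < c / 4)
  set δ := c / (4 * K ^ (p₁ + 2)) with hδ
  have hδ0 : 0 < δ := by positivity
  obtain ⟨r, hr, hr'⟩ := exists_mul_rpow_le (a := 4 * G / N ^ 2) (ρ := 2) (by positivity) (by norm_num)
    hδ0
  refine ⟨r, N / 2, hr, by positivity, fun u hu huM huG huB huA => ?_⟩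
  by_contra! hcon
  have hv := volume_lt_norm_le_of_avg hu.1 hr hN hcon
  have hvδ : volume {x | N < ‖u x‖} ≤ ENNReal.ofReal δ := by
    refine hv.trans (ENNReal.ofReal_le_ofReal (le_trans ?_ hr'))
    rw [Real.rpow_two, div_mul_eq_mul_div]
    have : 4 * r ^ 2 * gradSq u ≤ 4 * G * r ^ 2 := by nlinarith [sq_nonneg r]
    gcongr
  set S := toMeasurable volume {x | N < ‖u x‖} with hS
  have hSm : MeasurableSet S := measurableSet_toMeasurable _ _
  have hSv : volume S ≤ ENNReal.ofReal δ := by rwa [hS, measure_toMeasurable]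
  have hSfin : volume S ≠ ∞ := (hSv.trans_lt ENNReal.ofReal_lt_top).ne
  have hi1 := (MemLp.integrable_norm_sq hu.1.1).const_mul (N ^ p₁)
  have hi2 := (hu.integrable_pow hp₀).const_mul (K ^ (p₁ - p₀))
  have hi3 : Integrable (S.indicator fun _ => K ^ (p₁ + 2)) volume :=
    (integrable_indicator_iff hSm).2 (integrableOn_const hSfin)
  have h1 : powInt p₁ u ≤ N ^ p₁ * mass u + K ^ (p₁ - p₀) * powInt p₀ u
      + δ * K ^ (p₁ + 2) := by
    have h2 : ∫ x, S.indicator (fun _ => K ^ (p₁ + 2)) x ≤ δ * K ^ (p₁ + 2) := by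
      rw [integral_indicator hSm, setIntegral_const, smul_eq_mul]
      gcongr
      exact ENNReal.toReal_le_of_le_ofReal hδ0.le hSv
    refine le_trans ?_ (add_le_add le_rfl h2)
    rw [powInt, powInt, mass, ← integral_const_mul, ← integral_const_mul, ← integral_add hi1 hi2]
    refine le_trans ?_ (integral_add (hi1.add hi2) hi3).le
    refine integral_mono (hu.integrable_pow_of_le hp₁.le hp.le hp₀) ((hi1.add hi2).add hi3)
      fun x => ?_
    change ‖u x‖ ^ (p₁ + 2) ≤ N ^ p₁ * ‖u x‖ ^ 2 + K ^ (p₁ - p₀) * ‖u x‖ ^ (p₀ + 2) +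
      S.indicator (fun _ => K ^ (p₁ + 2)) x
    have hx0 := norm_nonneg (u x)
    have a1 : 0 ≤ N ^ p₁ * ‖u x‖ ^ 2 := by positivity
    have a2 : 0 ≤ K ^ (p₁ - p₀) * ‖u x‖ ^ (p₀ + 2) := by positivity
    have a3 : 0 ≤ S.indicator (fun _ => K ^ (p₁ + 2)) x :=
      Set.indicator_nonneg (fun _ _ => by positivity) x
    have a4 := rpow_le_min_add (p := p₁) (q := p₀) hx0 hK hp.le
    rcases le_or_gt (‖u x‖) N with h | h
    · have a5 := min_rpow_le_sq hx0 hN hp₁.le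
      rw [min_eq_left h] at a5
      linarith
    · have hxS : x ∈ S := subset_toMeasurable _ _ h
      rw [Set.indicator_of_mem hxS]
      have a5 : min ‖u x‖ K ^ (p₁ + 2) ≤ K ^ (p₁ + 2) :=
        Real.rpow_le_rpow (le_min hx0 hK.le) (min_le_right _ _) (by linarith)
      linarith
  have h2 : N ^ p₁ * mass u ≤ c / 4 := by
    refine le_trans ?_ hN'
    rw [mul_comm]
    gcongr
  have h3 : K ^ (p₁ - p₀) * powInt p₀ u ≤ c / 4 := by
    refine le_trans ?_ hK'
    rw [mul_comm]
    gcongr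
  have h4 : δ * K ^ (p₁ + 2) = c / 4 := by rw [hδ]; field_simp
  linarith

theorem tendsto_ballAvg {r : ℝ} {u : ℕ → Space d → ℂ} {w : Space d → ℂ}
    (h : ∀ g : Space d → ℂ, MemLp g 2 volume →
      Tendsto (fun n => ∫ x, inner ℂ (g x) (u n x)) atTop (𝓝 (∫ x, inner ℂ (g x) (w x))))
    (x : Space d) : Tendsto (fun n => ballAvg r (u n) x) atTop (𝓝 (ballAvg r w x)) := by
  simp_rw [ballAvg_eq_integral_inner]
  exact (h _ (memLp_indicator_ball x r)).const_smul _

/-- Weak `L²` convergence to `0` with bounded gradients gives convergence a.e. along a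
subsequence. -/
theorem exists_subseq_ae_tendsto_zero {r : ℕ → Space d → ℂ} (hr : ∀ n, MemH1 (r n)) {M G : ℝ}
    (hM : ∀ n, mass (r n) ≤ M) (hG : ∀ n, gradSq (r n) ≤ G)
    (hlim : ∀ ρ : ℝ, 0 < ρ → ∀ x, Tendsto (fun n => ballAvg ρ (r n) x) atTop (𝓝 0)) :
    ∃ σ : ℕ → ℕ, StrictMono σ ∧ ∀ᵐ x, Tendsto (fun n => r (σ n) x) atTop (𝓝 0) := by
  -- A bounded integrable weight localizes the argument, so no diagonal extraction over balls is
  -- needed.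
  set W : Space d → ℝ := fun x => (1 + ‖x‖) ^ (-((d : ℝ) + 1)) with hW
  have hWi : Integrable W volume := integrable_one_add_norm (by simp)
  have hW0 : ∀ x, 0 < W x := fun x => by simp only [hW]; positivity
  have hW1 : ∀ x, W x ≤ 1 := fun x =>
    Real.rpow_le_one_of_one_le_of_nonpos (by linarith [norm_nonneg x])
      (by have : (0 : ℝ) ≤ d := by positivity
          linarith)
  have hG0 : 0 ≤ G := (gradSq_nonneg _).trans (hG 0)
  set g : ℕ → Space d → ℝ := fun n x => W x * ‖r n x‖ ^ 2 with hg
  have hgi : ∀ n, Integrable (g n) volume := fun n =>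
    (MemLp.integrable_norm_sq (hr n).1).bdd_mul hWi.1 (c := 1) (ae_of_all _ fun x => by
      rw [Real.norm_of_nonneg (hW0 x).le]; exact hW1 x)
  have hgnn : ∀ n x, 0 ≤ g n x := fun n x => mul_nonneg (hW0 x).le (by positivity)
  have hgl : Tendsto (fun n => ∫ x, g n x) atTop (𝓝 0) := by
    rw [Metric.tendsto_atTop]
    intro ε hε
    -- At small radius the function is L²-close to its averages uniformly in n; the averages then
    -- tend to 0 boundedly, and the weight allows dominated convergence.
    obtain ⟨ρ, hρ, hρ'⟩ := exists_mul_rpow_le (a := 2 * G) (ρ := 2) (by positivity) (by norm_num)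
      (by positivity : 0 < ε / 2)
    have hsub := fun n => ballAvg_memLp_sub hρ (hr n)
    have havm : ∀ n, AEStronglyMeasurable (ballAvg ρ (r n)) volume := fun n => by
      refine ((hsub n).1.1.add (hr n).1.1).congr (ae_of_all _ fun x => ?_)
      simp
    set b := (volume.real (Metric.ball (0 : Space d) ρ))⁻¹ * M with hb
    have hbd : ∀ n x, ‖ballAvg ρ (r n) x‖ ^ 2 ≤ b := fun n x =>
      (norm_sq_ballAvg_le hρ (hr n).1 x).trans (by rw [hb]; gcongr; exact hM n)
    have hAi : ∀ n, Integrable (fun x => W x * ‖ballAvg ρ (r n) x‖ ^ 2) volume := fun n =>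
      hWi.mul_bdd (c := b) ((havm n).norm.pow 2) (ae_of_all _ fun x => by
        rw [Real.norm_of_nonneg (by positivity)]; exact hbd n x)
    have hAl : Tendsto (fun n => ∫ x, W x * ‖ballAvg ρ (r n) x‖ ^ 2) atTop (𝓝 0) := by
      have : ∫ x : Space d, (0 : ℝ) = 0 := by simp
      rw [← this]
      refine tendsto_integral_of_dominated_convergence (fun x => W x * b) (fun n => (hAi n).1)
        (hWi.mul_const b) (fun n => ae_of_all _ fun x => ?_) (ae_of_all _ fun x => ?_)
      · rw [Real.norm_of_nonneg (mul_nonneg (hW0 x).le (by positivity))]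
        exact mul_le_mul_of_nonneg_left (hbd n x) (hW0 x).le
      · have := ((hlim ρ hρ x).norm.pow 2).const_mul (W x)
        simpa using this
    obtain ⟨n₀, hn₀⟩ := Metric.tendsto_atTop.1 hAl (ε / 4) (by positivity)
    refine ⟨n₀, fun n hn => ?_⟩
    have h1 := hn₀ n hn
    rw [Real.dist_eq, sub_zero, abs_of_nonneg
      (integral_nonneg fun x => mul_nonneg (hW0 x).le (by positivity))] at h1
    rw [Real.dist_eq, sub_zero, abs_of_nonneg (integral_nonneg (hgnn n))]
    have h2 : ∫ x, g n x ≤ 2 * (∫ x, ‖ballAvg ρ (r n) x - r n x‖ ^ 2)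
        + 2 * ∫ x, W x * ‖ballAvg ρ (r n) x‖ ^ 2 := by
      have i1 := (MemLp.integrable_norm_sq (hsub n).1).const_mul 2
      have i2 := (hAi n).const_mul 2
      rw [← integral_const_mul, ← integral_const_mul, ← integral_add i1 i2]
      refine integral_mono (hgi n) (i1.add i2) fun x => ?_
      have h3 : ‖r n x‖ ^ 2 ≤ 2 * ‖ballAvg ρ (r n) x - r n x‖ ^ 2 + 2 * ‖ballAvg ρ (r n) x‖ ^ 2 := by
        have h4 : ‖r n x‖ ≤ ‖ballAvg ρ (r n) x - r n x‖ + ‖ballAvg ρ (r n) x‖ := by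
          have := norm_sub_norm_le (r n x) (ballAvg ρ (r n) x)
          rw [norm_sub_rev] at this
          linarith
        nlinarith [norm_nonneg (r n x), sq_nonneg (‖ballAvg ρ (r n) x - r n x‖ -
          ‖ballAvg ρ (r n) x‖), norm_nonneg (ballAvg ρ (r n) x - r n x),
          norm_nonneg (ballAvg ρ (r n) x)]
      have h5 := mul_le_mul_of_nonneg_left h3 (hW0 x).le
      have h6 := mul_le_mul_of_nonneg_right (hW1 x)
        (by positivity : 0 ≤ 2 * ‖ballAvg ρ (r n) x - r n x‖ ^ 2)
      simp only [hg]
      linarith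
    have h3 := (hsub n).2
    have h4 : ρ ^ 2 * gradSq (r n) ≤ ρ ^ 2 * G := by gcongr; exact hG n
    rw [Real.rpow_two] at hρ'
    linarith
  have hmeas : TendstoInMeasure volume g atTop (fun _ => (0 : ℝ)) := by
    refine tendstoInMeasure_of_tendsto_eLpNorm (p := 1) one_ne_zero (fun n => (hgi n).1)
      aestronglyMeasurable_const ?_
    have e : ∀ n, eLpNorm (g n - fun _ => (0 : ℝ)) 1 volume = ENNReal.ofReal (∫ x, g n x) := by
      intro n
      rw [eLpNorm_one_eq_lintegral_enorm,
        ofReal_integral_eq_lintegral_ofReal (hgi n) (ae_of_all _ (hgnn n))]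
      refine lintegral_congr fun x => ?_
      simp only [Pi.sub_apply, sub_zero]
      exact Real.enorm_of_nonneg (hgnn n x)
    simp_rw [e]
    have := ENNReal.tendsto_ofReal hgl
    simpa using this
  obtain ⟨σ, hσ, hae⟩ := hmeas.exists_seq_tendsto_ae
  refine ⟨σ, hσ, ?_⟩
  filter_upwards [hae] with x hx
  have h1 : Tendsto (fun n => ‖r (σ n) x‖ ^ 2) atTop (𝓝 0) := by
    have := hx.const_mul (W x)⁻¹
    rw [mul_zero] at this
    refine this.congr fun n => ?_
    simp only [hg]
    rw [← mul_assoc, inv_mul_cancel₀ (hW0 x).ne', one_mul]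
  have h2 := h1.sqrt
  rw [Real.sqrt_zero] at h2
  refine tendsto_zero_iff_norm_tendsto_zero.2 (h2.congr fun n => ?_)
  exact Real.sqrt_sq (norm_nonneg _)

/-- Fatou; weak L² convergence alone does not place the limit in the higher Lebesgue space. -/
theorem memLp_of_ae_tendsto {q : ℝ} (hq : 0 < q) {f : ℕ → Space d → ℂ} {w : Space d → ℂ}
    (hf : ∀ n, MemLp (f n) (ENNReal.ofReal q) volume) {K : ℝ}
    (hK : ∀ n, ∫ x, ‖f n x‖ ^ q ≤ K) (hlim : ∀ᵐ x, Tendsto (fun n => f n x) atTop (𝓝 (w x))) :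
    MemLp w (ENNReal.ofReal q) volume := by
  have hm : AEStronglyMeasurable w volume := aestronglyMeasurable_of_tendsto_ae atTop
    (fun n => (hf n).1) hlim
  rw [← integrable_norm_rpow_iff_memLp hm hq]
  refine ⟨aestronglyMeasurable_norm_rpow hm hq.le, ?_⟩
  rw [hasFiniteIntegral_iff_norm]
  have h1 : ∀ᵐ x, ENNReal.ofReal ‖‖w x‖ ^ q‖ ≤
      liminf (fun n => ENNReal.ofReal (‖f n x‖ ^ q)) atTop := by
    filter_upwards [hlim] with x hx
    have h2 : Tendsto (fun n => ENNReal.ofReal (‖f n x‖ ^ q)) atTop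
        (𝓝 (ENNReal.ofReal (‖w x‖ ^ q))) :=
      ENNReal.tendsto_ofReal (hx.norm.rpow_const (Or.inr hq.le))
    rw [h2.liminf_eq, Real.norm_of_nonneg (by positivity)]
  calc ∫⁻ x, ENNReal.ofReal ‖‖w x‖ ^ q‖ ≤ ∫⁻ x, liminf (fun n => ENNReal.ofReal (‖f n x‖ ^ q)) atTop :=
        lintegral_mono_ae h1
    _ ≤ liminf (fun n => ∫⁻ x, ENNReal.ofReal (‖f n x‖ ^ q)) atTop :=
        lintegral_liminf_le' fun n =>
          (aestronglyMeasurable_norm_rpow (hf n).1 hq.le).aemeasurable.ennreal_ofReal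
    _ ≤ ENNReal.ofReal K := by
        refine liminf_le_of_le (by isBoundedDefault) fun b hb => ?_
        obtain ⟨n, hn⟩ := hb.exists
        refine hn.trans ?_
        rw [← ofReal_integral_eq_lintegral_ofReal
          ((integrable_norm_rpow_iff_memLp (hf n).1 hq).2 (hf n))
          (ae_of_all _ fun x => by positivity)]
        exact ENNReal.ofReal_le_ofReal (hK n)
    _ < ∞ := ENNReal.ofReal_lt_top

/-- Translations bring a nonvanishing average to the origin, so the weak limit w is nonzero.
Quadratic terms split by expanding the square and weak convergence, power terms by Brezis–Lieb. The
remainders are those of the translated sequence, which suffices because all functionals are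
translation invariant. -/
theorem exists_profile {p₀ p₁ : ℝ} (hp₁ : 0 < p₁) (hp : p₁ < p₀) {u : ℕ → Space d → ℂ}
    (hu : ∀ n, MemX p₀ (u n)) {M G B c : ℝ} (hM : ∀ n, mass (u n) ≤ M)
    (hG : ∀ n, gradSq (u n) ≤ G) (hB : ∀ n, powInt p₀ (u n) ≤ B) (hc : 0 < c)
    (hA : ∀ n, c ≤ powInt p₁ (u n)) :
    ∃ (σ : ℕ → ℕ) (w : Space d → ℂ) (r : ℕ → Space d → ℂ), StrictMono σ ∧ MemX p₀ w ∧
      0 < mass w ∧ (∀ n, MemX p₀ (r n)) ∧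
      Tendsto (fun n => mass (u (σ n)) - mass (r n)) atTop (𝓝 (mass w)) ∧
      Tendsto (fun n => gradSq (u (σ n)) - gradSq (r n)) atTop (𝓝 (gradSq w)) ∧
      Tendsto (fun n => powInt p₁ (u (σ n)) - powInt p₁ (r n)) atTop (𝓝 (powInt p₁ w)) ∧
      Tendsto (fun n => powInt p₀ (u (σ n)) - powInt p₀ (r n)) atTop (𝓝 (powInt p₀ w)) := by
  have hp₀ : 0 < p₀ := by linarith
  obtain ⟨ρ, η, hρ, hη, hlow⟩ := exists_lower_bound_ballAvg (d := d) hp₁ hp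
    ((mass_nonneg _).trans (hM 0)) ((gradSq_nonneg _).trans (hG 0))
    ((powInt_nonneg _ _).trans (hB 0)) hc
  choose y hy using fun n => hlow (u n) (hu n) (hM n) (hG n) (hB n) (hA n)
  set f : ℕ → Space d → ℂ := fun n x => u n (x + y n) with hf
  have hfX : ∀ n, MemX p₀ (f n) := fun n => (hu n).comp_add _
  have hfM : ∀ n, mass (f n) = mass (u n) := fun n => mass_comp_add _ _
  have hfG : ∀ n, gradSq (f n) = gradSq (u n) := fun n => gradSq_comp_add (hu n).1 _
  have hfP : ∀ p n, powInt p (f n) = powInt p (u n) := fun p n => powInt_comp_add _ _ _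
  have hfavg : ∀ n, ballAvg ρ (f n) 0 = ballAvg ρ (u n) (y n) := fun n => by
    simp only [ballAvg, hf, zero_add, add_comm (y n)]
  -- The index `none` carries the function and `some i` its partial derivatives, so that one
  -- extraction makes all of them converge.
  let F : ℕ → Option (Fin d) → Space d → ℂ := fun n o => o.elim (f n) fun i => weakPartial i (f n)
  have hFL : ∀ n o, MemLp (F n o) 2 volume := by
    rintro n (_ | i)
    · exact (hfX n).1.1
    · exact (hfX n).1.weakPartial_memLp i
  have hFC : ∀ n o, ∫ x, ‖F n o x‖ ^ 2 ≤ max M G := by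
    rintro n (_ | i)
    · exact ((hfM n).le.trans (hM n)).trans (le_max_left _ _)
    · refine le_trans ?_ (((hfG n).le.trans (hG n)).trans (le_max_right _ _))
      rw [gradSq_eq_sum (hfX n).1]
      exact Finset.single_le_sum (f := fun i => ∫ x, ‖weakPartial i (f n) x‖ ^ 2)
        (fun i _ => integral_nonneg fun _ => by positivity) (Finset.mem_univ i)
  obtain ⟨σ₁, hσ₁, g, hgL, hglim⟩ := exists_weak_subseq_memLp hFL hFC
  set w := g none with hw
  have hwp : ∀ i, IsWeakPartial i w (g (some i)) := by
    intro i φ hφ hc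
    have h1 := hglim none _ (memLp_two_of_test (Complex.continuous_ofReal.comp
      (continuous_fderiv_apply_of_contDiff hφ (EuclideanSpace.single i 1)))
      (hasCompactSupport_ofReal (hc.fderiv_apply (𝕜 := ℝ) _)) 2)
    have h2 := hglim (some i) _ (memLp_two_of_test (Complex.continuous_ofReal.comp hφ.continuous)
      (hasCompactSupport_ofReal hc) 2)
    simp only [Function.comp_apply, inner_ofReal_eq_smul] at h1 h2
    refine tendsto_nhds_unique h1 (h2.neg.congr fun n => ?_)
    exact ((hfX (σ₁ n)).1.isWeakPartial i φ hφ hc).symm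
  have hwH : MemH1 w := ⟨hgL none, fun i => ⟨_, hgL _, hwp i⟩⟩
  have hwae : ∀ i, weakPartial i w =ᵐ[volume] g (some i) := fun i =>
    weakPartial_ae_eq (hgL _) (hwp i)
  set s : ℕ → Space d → ℂ := fun n => f (σ₁ n) + ((-1 : ℝ) : ℂ) • w with hs
  have hsH : ∀ n, MemH1 (s n) := fun n => (hfX _).1.add (hwH.const_smul _)
  have hin : Tendsto (fun n => inner2 (f (σ₁ n)) w) atTop (𝓝 (mass w)) := by
    have h1 := tendsto_inner2 hwH.1 hwH.1 (fun n => (hfX (σ₁ n)).1.1) (hglim none w hwH.1)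
    have e : inner2 w w = mass w := by simp [inner2, mass]
    rw [e] at h1
    exact h1.congr fun n => inner2_comm _ _
  have hgin : Tendsto (fun n => gradInner (f (σ₁ n)) w) atTop (𝓝 (gradSq w)) := by
    rw [← gradInner_self hwH]
    refine tendsto_finsetSum _ fun i _ => ?_
    have h1 := tendsto_inner2 (hwH.weakPartial_memLp i) (hgL (some i))
      (fun n => (hfX (σ₁ n)).1.weakPartial_memLp i)
      (hglim (some i) (weakPartial i w) (hwH.weakPartial_memLp i))
    have e : inner2 (weakPartial i w) (g (some i)) = inner2 (weakPartial i w) (weakPartial i w) := by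
      refine integral_congr_ae ?_
      filter_upwards [hwae i] with x hx
      rw [hx]
    rw [e] at h1
    exact h1.congr fun n => inner2_comm _ _
  have hsM : ∀ n, mass (s n) = mass (u (σ₁ n)) - 2 * inner2 (f (σ₁ n)) w + mass w := fun n => by
    rw [hs, mass_add_smul (hfX _).1 hwH, hfM]; ring
  have hsG : ∀ n, gradSq (s n) = gradSq (u (σ₁ n)) - 2 * gradInner (f (σ₁ n)) w + gradSq w :=
    fun n => by rw [hs, gradSq_add_smul (hfX _).1 hwH, hfG]; ring
  obtain ⟨M', hM'⟩ : ∃ M', ∀ n, mass (s n) ≤ M' := by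
    obtain ⟨b, hb⟩ := hin.bddBelow_range
    refine ⟨M - 2 * b + mass w, fun n => ?_⟩
    have := hb ⟨n, rfl⟩
    simp only at this
    rw [hsM]
    linarith [hM (σ₁ n)]
  obtain ⟨G', hG'⟩ : ∃ G', ∀ n, gradSq (s n) ≤ G' := by
    obtain ⟨b, hb⟩ := hgin.bddBelow_range
    refine ⟨G - 2 * b + gradSq w, fun n => ?_⟩
    have := hb ⟨n, rfl⟩
    simp only at this
    rw [hsG]
    linarith [hG (σ₁ n)]
  have hsavg : ∀ ρ : ℝ, 0 < ρ → ∀ x, Tendsto (fun n => ballAvg ρ (s n) x) atTop (𝓝 0) := by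
    intro ρ' hρ' x
    have := isProbabilityMeasure_ballMeasure (d := d) hρ'
    have h1 := (tendsto_ballAvg (r := ρ') (fun g hg => hglim none g hg) x).sub_const
      (ballAvg ρ' w x)
    rw [sub_self] at h1
    refine h1.congr fun n => ?_
    have i1 := (memLp_ballMeasure hρ' (hfX (σ₁ n)).1.1 x).integrable (by norm_num)
    have i2 := (memLp_ballMeasure hρ' hwH.1 x).integrable (by norm_num)
    refine (integral_sub i1 i2).symm.trans ?_
    refine integral_congr_ae (ae_of_all _ fun z => ?_)
    simp [hs, sub_eq_add_neg]
  obtain ⟨σ₂, hσ₂, hae⟩ := exists_subseq_ae_tendsto_zero hsH hM' hG' hsavg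
  have hfw : ∀ᵐ x, Tendsto (fun n => f (σ₁ (σ₂ n)) x) atTop (𝓝 (w x)) := by
    filter_upwards [hae] with x hx
    have := hx.add_const (w x)
    rw [zero_add] at this
    refine this.congr fun n => ?_
    simp [hs]
  have hwX : MemX p₀ w := ⟨hwH, memLp_of_ae_tendsto (by linarith)
    (fun n => (hfX (σ₁ (σ₂ n))).2) (fun n => ((hfP p₀ _).le.trans (hB _))) hfw⟩
  have hsX : ∀ n, MemX p₀ (s n) := fun n => (hfX _).add (hwX.const_smul _)
  have hsf : ∀ n, s n + w = f (σ₁ n) := fun n => by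
    ext x; simp [hs]
  have hP : ∀ p : ℝ, 0 < p → p ≤ p₀ → (∃ K, ∀ n, powInt p (u n) ≤ K) →
      Tendsto (fun n => powInt p (u (σ₁ (σ₂ n))) - powInt p (s (σ₂ n))) atTop
        (𝓝 (powInt p w)) := by
    rintro p hp0 hpp ⟨K, hK⟩
    have := tendsto_powInt_sub_powInt hp0 (hwX.memLp_of_le hp0.le hpp hp₀)
      (r := fun n => s (σ₂ n)) (fun n => (hsX (σ₂ n)).memLp_of_le hp0.le hpp hp₀)
      (K := K) (fun n => by rw [hsf, hfP]; exact hK _) hae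
    refine this.congr fun n => ?_
    rw [hsf, hfP]
  refine ⟨σ₁ ∘ σ₂, w, fun n => s (σ₂ n), hσ₁.comp hσ₂, hwX, ?_, fun n => hsX _, ?_, ?_, ?_, ?_⟩
  · have h1 := tendsto_ballAvg (r := ρ) (fun g hg => hglim none g hg) 0
    have h2 : η ≤ ‖ballAvg ρ w 0‖ := ge_of_tendsto' h1.norm fun n => by
      have := hy (σ₁ n)
      rw [← hfavg] at this
      exact this.le
    have h3 := norm_sq_ballAvg_le hρ hwH.1 0
    refine (mass_nonneg w).lt_of_ne fun h => ?_
    rw [← h, mul_zero] at h3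
    nlinarith
  · have h1 := (hin.comp hσ₂.tendsto_atTop).const_mul 2
    have h2 := h1.sub_const (mass w)
    have e : 2 * mass w - mass w = mass w := by ring
    rw [e] at h2
    refine h2.congr fun n => ?_
    simp only [Function.comp_apply]
    rw [hsM]; ring
  · have h1 := (hgin.comp hσ₂.tendsto_atTop).const_mul 2
    have h2 := h1.sub_const (gradSq w)
    have e : 2 * gradSq w - gradSq w = gradSq w := by ring
    rw [e] at h2
    refine h2.congr fun n => ?_
    simp only [Function.comp_apply]
    rw [hsG]; ring
  · refine hP p₁ hp₁ hp.le ⟨M + B, fun n => ?_⟩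
    have h1 := powInt_le_mass_add hp₁ hp (hu n) one_pos
    simp only [Real.one_rpow, one_mul] at h1
    linarith [hM n, hB n]
  · exact hP p₀ hp₀ le_rfl ⟨B, hB⟩

/-! ### Potential terms and scalings -/

/-- The potential energy `2/(p+2) ∫ |u|^{p+2}`. -/
def pot (p : ℝ) (u : Space d → ℂ) : ℝ := 2 / (p + 2) * powInt p u

theorem energy_eq (p₀ p₁ : ℝ) (u : Space d → ℂ) :
    energy p₀ p₁ u = gradSq u - pot p₁ u + pot p₀ u := rfl

theorem virial_eq (p₀ p₁ : ℝ) (u : Space d → ℂ) :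
    virial p₀ p₁ u = gradSq u - d * p₁ / 4 * pot p₁ u + d * p₀ / 4 * pot p₀ u := by
  simp only [virial, pot, div_eq_mul_inv, mul_inv]
  ring

theorem pot_nonneg {p : ℝ} (hp : 0 < p) (u : Space d → ℂ) : 0 ≤ pot p u :=
  mul_nonneg (by positivity) (powInt_nonneg p u)

theorem MemX.pot_pos {p₀ p : ℝ} (hp : 0 < p) (hpp : p ≤ p₀) {u : Space d → ℂ} (hu : MemX p₀ u)
    (hm : 0 < mass u) : 0 < pot p u :=
  mul_pos (by positivity) (powInt_pos (by linarith) hm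
    (hu.integrable_pow_of_le hp.le hpp (by linarith)))

theorem pos_of_four_div_lt (hd : 1 ≤ d) {p₁ : ℝ} (hp₁ : 4 / (d : ℝ) < p₁) :
    0 < p₁ ∧ 1 < d * p₁ / 4 := by
  have hd0 : (0 : ℝ) < d := by exact_mod_cast hd
  refine ⟨lt_trans (by positivity) hp₁, ?_⟩
  rw [div_lt_iff₀ hd0] at hp₁
  linarith

theorem pot_rescale (p : ℝ) (u : Space d → ℂ) {c l : ℝ} (hc : 0 ≤ c) (hl : 0 < l) :
    pot p (rescale c l u) = c ^ (p + 2) * l ^ (-(d : ℝ)) * pot p u := by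
  rw [pot, powInt_rescale p u hc hl, pot]
  ring

/-- The mass-preserving scaling. -/
theorem exists_massScale {p₀ : ℝ} (hp₀ : 0 < p₀) {u : Space d → ℂ} (hu : MemX p₀ u) {t : ℝ}
    (ht : 0 < t) : ∃ v : Space d → ℂ, MemX p₀ v ∧ mass v = mass u ∧ gradSq v = t * gradSq u ∧
      ∀ p : ℝ, pot p v = t ^ (d * p / 4) * pot p u := by
  have hl : 0 < t ^ (1 / 2 : ℝ) := by positivity
  have hc : 0 ≤ (t ^ (1 / 2 : ℝ)) ^ ((d : ℝ) / 2) := by positivity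
  refine ⟨rescale ((t ^ (1 / 2 : ℝ)) ^ ((d : ℝ) / 2)) (t ^ (1 / 2 : ℝ)) u,
    hu.rescale hp₀ _ hl, ?_, ?_, fun p => ?_⟩
  · rw [mass_rescale _ _ hl, ← Real.rpow_two, ← Real.rpow_mul hl.le, ← Real.rpow_add hl]
    ring_nf
    simp
  · rw [gradSq_rescale hu.1 _ hl, ← Real.rpow_two, ← Real.rpow_mul hl.le, ← Real.rpow_add hl,
      ← Real.rpow_mul ht.le]
    ring_nf
    simp [mul_comm]
  · rw [pot_rescale _ _ hc hl, ← Real.rpow_mul hl.le, ← Real.rpow_add hl, ← Real.rpow_mul ht.le]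
    ring_nf

/-- The dilation that multiplies the mass by `θ`. -/
theorem exists_dilate (hd : 1 ≤ d) {p₀ : ℝ} (hp₀ : 0 < p₀) {u : Space d → ℂ} (hu : MemX p₀ u)
    {θ : ℝ} (hθ : 0 < θ) : ∃ v : Space d → ℂ, MemX p₀ v ∧ mass v = θ * mass u ∧
      gradSq v = θ ^ (1 - 2 / (d : ℝ)) * gradSq u ∧ ∀ p : ℝ, pot p v = θ * pot p u := by
  have hd0 : (0 : ℝ) < d := by exact_mod_cast hd
  have hl : 0 < θ ^ (-(1 / (d : ℝ))) := by positivity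
  have e : (θ ^ (-(1 / (d : ℝ)))) ^ (-(d : ℝ)) = θ := by
    rw [← Real.rpow_mul hθ.le, neg_mul_neg, one_div_mul_cancel hd0.ne', Real.rpow_one]
  refine ⟨rescale 1 (θ ^ (-(1 / (d : ℝ)))) u, hu.rescale hp₀ _ hl, ?_, ?_, fun p => ?_⟩
  · rw [mass_rescale _ _ hl, e]; simp
  · rw [gradSq_rescale hu.1 _ hl, ← Real.rpow_mul hθ.le, one_pow, one_mul]
    congr 2
    field_simp
    ring
  · rw [pot_rescale _ _ zero_le_one hl, e]; simp

/-! ### The energy along the mass-preserving scaling -/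

theorem eventually_lt_right_of_deriv_neg {f : ℝ → ℝ} {f' x : ℝ} (h : HasDerivAt f f' x)
    (hf' : f' < 0) : ∀ᶠ y in 𝓝[>] x, f y < f x := by
  have h1 := (hasDerivAt_iff_tendsto_slope.1 h).mono_left
    (nhdsWithin_mono x fun y (hy : x < y) => hy.ne')
  filter_upwards [h1.eventually (gt_mem_nhds hf'), self_mem_nhdsWithin] with y hy hxy
  rw [slope_def_field, div_neg_iff] at hy
  have : x < y := hxy
  rcases hy with h | h <;> linarith

theorem eventually_lt_left_of_deriv_pos {f : ℝ → ℝ} {f' x : ℝ} (h : HasDerivAt f f' x)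
    (hf' : 0 < f') : ∀ᶠ y in 𝓝[<] x, f y < f x := by
  have h1 := (hasDerivAt_iff_tendsto_slope.1 h).mono_left
    (nhdsWithin_mono x fun y (hy : y < x) => hy.ne)
  filter_upwards [h1.eventually (lt_mem_nhds hf'), self_mem_nhdsWithin] with y hy hxy
  rw [slope_def_field, div_pos_iff] at hy
  have : y < x := hxy
  rcases hy with h | h <;> linarith

/-- The minimum over [s, T] is not attained at T, where the derivative is positive, nor at s by
either alternative; it is interior, hence critical. -/
theorem exists_critical_of_endpoints {f g : ℝ → ℝ} {s T : ℝ} (hsT : s < T)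
    (hf : ∀ t ∈ Set.Icc s T, HasDerivAt f (g t) t) (hT : 0 < g T)
    (hs : g s < 0 ∨ f T < f s) :
    ∃ t ∈ Set.Ioo s T, g t = 0 ∧ f t < f s ∧ f t < f T := by
  obtain ⟨t, ht, hmin⟩ := isCompact_Icc.exists_isMinOn (Set.nonempty_Icc.2 hsT.le)
    fun t ht => (hf t ht).continuousAt.continuousWithinAt
  have hmin' : ∀ y ∈ Set.Icc s T, f t ≤ f y := fun y hy => hmin hy
  have hTlt : f t < f T := by
    have h1 := eventually_lt_left_of_deriv_pos (hf T (Set.right_mem_Icc.2 hsT.le)) hT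
    obtain ⟨y, hy, hy2⟩ := (h1.and (Ioo_mem_nhdsLT hsT)).exists
    exact (hmin' y ⟨hy2.1.le, hy2.2.le⟩).trans_lt hy
  have hslt : f t < f s := by
    rcases hs with hs | hs
    · have h1 := eventually_lt_right_of_deriv_neg (hf s (Set.left_mem_Icc.2 hsT.le)) hs
      obtain ⟨y, hy, hy2⟩ := (h1.and (Ioo_mem_nhdsGT hsT)).exists
      exact (hmin' y ⟨hy2.1.le, hy2.2.le⟩).trans_lt hy
    · exact hTlt.trans hs
  have hts : t ≠ s := fun h => by rw [h] at hslt; exact hslt.false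
  have htT : t ≠ T := fun h => by rw [h] at hTlt; exact hTlt.false
  have hIoo : t ∈ Set.Ioo s T := ⟨ht.1.lt_of_ne hts.symm, ht.2.lt_of_ne htT⟩
  refine ⟨t, hIoo, ?_, hslt, hTlt⟩
  exact (hmin.isLocalMin (Icc_mem_nhds hIoo.1 hIoo.2)).hasDerivAt_eq_zero (hf t ht)

/-- The energy `t ↦ t G - t^α a + t^β b` along the mass-preserving scaling. -/
def scaledEnergy (G a b α β t : ℝ) : ℝ := t * G - t ^ α * a + t ^ β * b

/-- The derivative of `scaledEnergy`. -/
def scaledEnergyDeriv (G a b α β t : ℝ) : ℝ := G - α * t ^ (α - 1) * a + β * t ^ (β - 1) * b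

theorem hasDerivAt_scaledEnergy (G a b α β : ℝ) {t : ℝ} (ht : 0 < t) :
    HasDerivAt (scaledEnergy G a b α β) (scaledEnergyDeriv G a b α β t) t := by
  have h1 := (hasDerivAt_id t).mul_const G
  have h2 := (Real.hasDerivAt_rpow_const (p := α) (Or.inl ht.ne')).mul_const a
  have h3 := (Real.hasDerivAt_rpow_const (p := β) (Or.inl ht.ne')).mul_const b
  have := (h1.sub h2).add h3
  rw [one_mul] at this
  exact this

/-- The power β > α dominates at infinity. -/
theorem exists_scaledEnergyDeriv_pos {G a b α β : ℝ} (hG : 0 ≤ G) (hb : 0 < b)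
    (hα : 1 < α) (hαβ : α < β) (s : ℝ) : ∃ T, s < T ∧ 1 < T ∧ 0 < scaledEnergyDeriv G a b α β T := by
  have h := tendsto_rpow_atTop (sub_pos.2 hαβ)
  obtain ⟨T, hT1, hT2⟩ := ((h.eventually_gt_atTop (α * a / (β * b))).and
    (eventually_gt_atTop (max s 1))).exists
  have hβ : 0 < β := by linarith
  have hT0 : 1 < T := (le_max_right _ _).trans_lt hT2
  refine ⟨T, (le_max_left _ _).trans_lt hT2, hT0, ?_⟩
  have hTp : 0 < T := by linarith
  rw [div_lt_iff₀ (by positivity)] at hT1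
  have e : T ^ (β - 1) = T ^ (β - α) * T ^ (α - 1) := by
    rw [← Real.rpow_add hTp]; congr 1; ring
  have h2 : 0 < T ^ (α - 1) := by positivity
  rw [scaledEnergyDeriv, e]
  nlinarith [mul_lt_mul_of_pos_right hT1 h2]

/-- Since α > 1 the linear term tG dominates near 0. -/
theorem exists_scaledEnergy_pos {G a b α β : ℝ} (hG : 0 < G) (ha : 0 ≤ a) (hb : 0 ≤ b)
    (hα : 1 < α) : ∃ s, 0 < s ∧ s < 1 ∧ 0 < scaledEnergy G a b α β s := by
  obtain ⟨N, hN, h⟩ := exists_mul_rpow_le ha (sub_pos.2 hα).ne' (half_pos hG)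
  set s := min N (1 / 2) with hs
  have hs0 : 0 < s := lt_min hN (by norm_num)
  refine ⟨s, hs0, (min_le_right _ _).trans_lt (by norm_num), ?_⟩
  have h1 : s ^ (α - 1) ≤ N ^ (α - 1) :=
    Real.rpow_le_rpow hs0.le (min_le_left _ _) (by linarith)
  have e : s ^ α = s * s ^ (α - 1) := by
    rw [Real.rpow_sub_one hs0.ne']; field_simp
  have h2 : s ^ (α - 1) * a ≤ G / 2 := by nlinarith
  have h3 : 0 ≤ s ^ β * b := by positivity
  rw [scaledEnergy, e]
  nlinarith

/-! ### Reaching zero virial along the mass-preserving scaling. -/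

theorem MemX.exists_scaled (hd : 1 ≤ d) {p₀ p₁ : ℝ} (hp₁ : 4 / (d : ℝ) < p₁) (hp : p₁ < p₀)
    {u : Space d → ℂ} (hu : MemX p₀ u) {t : ℝ} (ht : 0 < t) :
    ∃ v : Space d → ℂ, MemX p₀ v ∧ mass v = mass u ∧
      energy p₀ p₁ v =
        scaledEnergy (gradSq u) (pot p₁ u) (pot p₀ u) (d * p₁ / 4) (d * p₀ / 4) t ∧
      virial p₀ p₁ v =
        t * scaledEnergyDeriv (gradSq u) (pot p₁ u) (pot p₀ u) (d * p₁ / 4) (d * p₀ / 4) t := by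
  obtain ⟨hp₁0, -⟩ := pos_of_four_div_lt hd hp₁
  obtain ⟨v, hv, hm, hG, hP⟩ := exists_massScale (by linarith) hu ht
  refine ⟨v, hv, hm, ?_, ?_⟩
  · rw [energy_eq, hG, hP, hP]; rfl
  · rw [virial_eq, hG, hP, hP, scaledEnergyDeriv, Real.rpow_sub_one ht.ne', Real.rpow_sub_one ht.ne']
    field_simp

theorem scaledEnergy_one (p₀ p₁ : ℝ) (u : Space d → ℂ) :
    scaledEnergy (gradSq u) (pot p₁ u) (pot p₀ u) (d * p₁ / 4) (d * p₀ / 4) 1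
      = energy p₀ p₁ u := by
  simp [scaledEnergy, energy_eq]

theorem scaledEnergyDeriv_one (p₀ p₁ : ℝ) (u : Space d → ℂ) :
    scaledEnergyDeriv (gradSq u) (pot p₁ u) (pot p₀ u) (d * p₁ / 4) (d * p₀ / 4) 1
      = virial p₀ p₁ u := by
  simp [scaledEnergyDeriv, virial_eq]

/-- The curve decreases at t = 1 and increases for large t; its minimum in between has zero virial.
-/
theorem exists_virial_eq_zero_of_neg (hd : 1 ≤ d) {p₀ p₁ : ℝ} (hp₁ : 4 / (d : ℝ) < p₁)
    (hp : p₁ < p₀) {u : Space d → ℂ} (hu : MemX p₀ u) (hm : 0 < mass u)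
    (hv : virial p₀ p₁ u < 0) : ∃ w : Space d → ℂ, MemX p₀ w ∧ mass w = mass u ∧
      virial p₀ p₁ w = 0 ∧ energy p₀ p₁ w < energy p₀ p₁ u := by
  obtain ⟨hp₁0, hα⟩ := pos_of_four_div_lt hd hp₁
  have hd0 : (0 : ℝ) < d := by exact_mod_cast hd
  have hαβ : d * p₁ / 4 < d * p₀ / 4 := by gcongr
  obtain ⟨T, -, hT1, hT⟩ := exists_scaledEnergyDeriv_pos (a := pot p₁ u) (gradSq_nonneg u)
    (hu.pot_pos (by linarith) le_rfl hm) hα hαβ 1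
  obtain ⟨t, ht, hgt, hft, -⟩ := exists_critical_of_endpoints hT1
    (fun t ht => hasDerivAt_scaledEnergy (gradSq u) (pot p₁ u) (pot p₀ u) (d * p₁ / 4) (d * p₀ / 4)
      (by linarith [ht.1] : 0 < t)) hT (Or.inl (by rwa [scaledEnergyDeriv_one]))
  obtain ⟨w, hw, hwm, hwe, hwv⟩ := hu.exists_scaled hd hp₁ hp (by linarith [ht.1] : 0 < t)
  exact ⟨w, hw, hwm, by rw [hwv, hgt, mul_zero], by rw [hwe, ← scaledEnergy_one p₀ p₁ u]; exact hft⟩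

theorem exists_virial_eq_zero_of_nonpos (hd : 1 ≤ d) {p₀ p₁ : ℝ} (hp₁ : 4 / (d : ℝ) < p₁)
    (hp : p₁ < p₀) {u : Space d → ℂ} (hu : MemX p₀ u) (hm : 0 < mass u)
    (hv : virial p₀ p₁ u ≤ 0) : ∃ w : Space d → ℂ, MemX p₀ w ∧ mass w = mass u ∧
      virial p₀ p₁ w = 0 ∧ energy p₀ p₁ w ≤ energy p₀ p₁ u := by
  rcases hv.lt_or_eq with h | h
  · obtain ⟨w, h1, h2, h3, h4⟩ := exists_virial_eq_zero_of_neg hd hp₁ hp hu hm h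
    exact ⟨w, h1, h2, h3, h4.le⟩
  · exact ⟨u, hu, rfl, h, le_rfl⟩

/-- If the virial is positive, the curve falls from a positive value near t = 0 to a negative one at
t = 1, where it is increasing; an interior minimum lies in (0, 1). -/
theorem exists_virial_eq_zero_of_energy_neg (hd : 1 ≤ d) {p₀ p₁ : ℝ} (hp₁ : 4 / (d : ℝ) < p₁)
    (hp : p₁ < p₀) {u : Space d → ℂ} (hu : MemX p₀ u) (hm : 0 < mass u)
    (he : energy p₀ p₁ u < 0) : ∃ w : Space d → ℂ, MemX p₀ w ∧ mass w = mass u ∧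
      virial p₀ p₁ w = 0 ∧ energy p₀ p₁ w ≤ energy p₀ p₁ u := by
  rcases le_or_gt (virial p₀ p₁ u) 0 with hv | hv
  · exact exists_virial_eq_zero_of_nonpos hd hp₁ hp hu hm hv
  obtain ⟨hp₁0, hα⟩ := pos_of_four_div_lt hd hp₁
  obtain ⟨s, hs0, hs1, hs⟩ := exists_scaledEnergy_pos (β := d * p₀ / 4) (hu.1.gradSq_pos hd hm)
    (pot_nonneg hp₁0 u) (pot_nonneg (by linarith : 0 < p₀) u) hα
  obtain ⟨t, ht, hgt, -, hft⟩ := exists_critical_of_endpoints hs1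
    (fun t ht => hasDerivAt_scaledEnergy (gradSq u) (pot p₁ u) (pot p₀ u) (d * p₁ / 4) (d * p₀ / 4)
      (by linarith [ht.1] : 0 < t)) (by rwa [scaledEnergyDeriv_one])
    (Or.inr (by rw [scaledEnergy_one]; linarith))
  obtain ⟨w, hw, hwm, hwe, hwv⟩ := hu.exists_scaled hd hp₁ hp (by linarith [ht.1] : 0 < t)
  refine ⟨w, hw, hwm, by rw [hwv, hgt, mul_zero], ?_⟩
  rw [hwe, ← scaledEnergy_one p₀ p₁ u]
  exact hft.le

/-- The parameter t = 1 minimizes the energy along the mass-preserving curve, so its derivative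
there, the virial, is zero. -/
theorem virial_eq_zero_of_energy_min (hd : 1 ≤ d) {p₀ p₁ : ℝ} (hp₁ : 4 / (d : ℝ) < p₁)
    (hp : p₁ < p₀) {u : Space d → ℂ} (hu : MemX p₀ u)
    (hmin : ∀ v : Space d → ℂ, MemX p₀ v → mass v = mass u → energy p₀ p₁ u ≤ energy p₀ p₁ v) :
    virial p₀ p₁ u = 0 := by
  rw [← scaledEnergyDeriv_one]
  refine IsLocalMin.hasDerivAt_eq_zero ?_ (hasDerivAt_scaledEnergy _ _ _ _ _ one_pos)
  filter_upwards [lt_mem_nhds (one_pos : (0 : ℝ) < 1)] with t ht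
  obtain ⟨v, hv, hvm, hve, -⟩ := hu.exists_scaled hd hp₁ hp ht
  rw [scaledEnergy_one, ← hve]
  exact hmin v hv hvm

/-! ### The critical mass -/

theorem minEnergy_le {p₀ p₁ : ℝ} {u : Space d → ℂ} (hu : MemX p₀ u) :
    minEnergy d p₀ p₁ (mass u) ≤ (energy p₀ p₁ u : EReal) := sInf_le ⟨u, hu, rfl, rfl⟩

theorem minVirialEnergy_le {p₀ p₁ : ℝ} {u : Space d → ℂ} (hu : MemX p₀ u)
    (hv : virial p₀ p₁ u = 0) :
    minVirialEnergy d p₀ p₁ (mass u) ≤ (energy p₀ p₁ u : EReal) := sInf_le ⟨u, hu, rfl, hv, rfl⟩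

theorem minVirialEnergy_le_of_nonpos (hd : 1 ≤ d) {p₀ p₁ : ℝ} (hp₁ : 4 / (d : ℝ) < p₁)
    (hp : p₁ < p₀) {u : Space d → ℂ} (hu : MemX p₀ u) (hm : 0 < mass u)
    (hv : virial p₀ p₁ u ≤ 0) :
    minVirialEnergy d p₀ p₁ (mass u) ≤ (energy p₀ p₁ u : EReal) := by
  obtain ⟨w, hw, hwm, hwv, hwe⟩ := exists_virial_eq_zero_of_nonpos hd hp₁ hp hu hm hv
  rw [← hwm]
  exact (minVirialEnergy_le hw hwv).trans (by exact_mod_cast hwe)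

theorem memX_zero (p : ℝ) : MemX p (0 : Space d → ℂ) := by
  obtain ⟨φ, hφ, hc, -⟩ := exists_bump d
  have := (memX_ofReal_test p hφ hc).const_smul 0
  simpa using this

theorem mass_zero : mass (0 : Space d → ℂ) = 0 := by simp [mass]

theorem gradSq_zero : gradSq (0 : Space d → ℂ) = 0 := by
  have := gradSq_const_smul (memX_zero (d := d) 1).1 0
  simpa using this

theorem pot_zero {p : ℝ} (hp : 0 < p) : pot p (0 : Space d → ℂ) = 0 := by
  have : p + 2 ≠ 0 := by linarith
  simp [pot, powInt, Real.zero_rpow this]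

theorem exists_add_mass_pot (hd : 1 ≤ d) {p₀ p₁ : ℝ} (hp₁ : 0 < p₁) (hp : p₁ < p₀)
    {u : Space d → ℂ} (hu : MemX p₀ u) {m : ℝ} (hm : mass u ≤ m) :
    ∃ v : ℕ → Space d → ℂ, (∀ n, MemX p₀ (v n)) ∧ (∀ n, mass (v n) = m) ∧
      Tendsto (fun n => energy p₀ p₁ (v n)) atTop (𝓝 (energy p₀ p₁ u)) ∧
      Tendsto (fun n => virial p₀ p₁ (v n)) atTop (𝓝 (virial p₀ p₁ u)) := by
  obtain ⟨v, hv, hvm, h1, h2, h3⟩ := exists_add_mass hd hp₁ hp hu hm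
  exact ⟨v, hv, hvm, (h1.sub (h2.const_mul _)).add (h3.const_mul _),
    (h1.sub (h2.const_mul _)).add (h3.const_mul _)⟩

/-- Mass m is spread out starting from the zero function. -/
theorem minEnergy_nonpos (hd : 1 ≤ d) {p₀ p₁ : ℝ} (hp₁ : 0 < p₁) (hp : p₁ < p₀) {m : ℝ}
    (hm : 0 ≤ m) : minEnergy d p₀ p₁ m ≤ 0 := by
  obtain ⟨v, hv, hvm, h, -⟩ := exists_add_mass_pot hd hp₁ hp (memX_zero (d := d) p₀)
    (mass_zero.le.trans hm)
  have h0 : energy p₀ p₁ (0 : Space d → ℂ) = 0 := by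
    rw [energy_eq, gradSq_zero, pot_zero hp₁, pot_zero (by linarith)]; ring
  rw [h0] at h
  have h' : Tendsto (fun n => (energy p₀ p₁ (v n) : EReal)) atTop (𝓝 ((0 : ℝ) : EReal)) :=
    (continuous_coe_real_ereal.tendsto 0).comp h
  exact ge_of_tendsto' h' fun n => by rw [← hvm n]; exact minEnergy_le (hv n)

theorem minEnergy_eq_zero_iff (hd : 1 ≤ d) {p₀ p₁ : ℝ} (hp₁ : 0 < p₁) (hp : p₁ < p₀) {m : ℝ}
    (hm : 0 ≤ m) : minEnergy d p₀ p₁ m = 0 ↔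
      ∀ u : Space d → ℂ, MemX p₀ u → mass u = m → 0 ≤ energy p₀ p₁ u := by
  constructor
  · intro h u hu hum
    have := minEnergy_le (p₁ := p₁) hu
    rw [hum, h] at this
    exact_mod_cast this
  · intro h
    refine le_antisymm (minEnergy_nonpos hd hp₁ hp hm) (le_sInf ?_)
    rintro e ⟨u, hu, hum, rfl⟩
    exact_mod_cast h u hu hum

theorem mass_pos_of_energy_neg {p₀ p₁ : ℝ} (hp₁ : 0 < p₁) (hp : p₁ < p₀) {u : Space d → ℂ}
    (hu : MemX p₀ u) (he : energy p₀ p₁ u < 0) : 0 < mass u := by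
  obtain ⟨C, hC, h⟩ := exists_energy_bound (d := d) hp₁ hp
  have h1 := h u hu
  have h2 := gradSq_nonneg u
  have h3 : 0 ≤ 1 / (p₀ + 2) * powInt p₀ u :=
    mul_nonneg (by have : 0 < p₀ := by linarith
                   positivity) (powInt_nonneg _ _)
  have h4 : 0 < C * mass u := by linarith
  exact pos_of_mul_pos_right h4 hC.le

/-- Energy would scale like mass were it not for a defect proportional to G, whose sign is that of θ
- 1. The virial has the same defect. -/
theorem energy_dilate {p₀ p₁ : ℝ} {u v : Space d → ℂ} {θ : ℝ} (hθ : 0 < θ)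
    (hG : gradSq v = θ ^ (1 - 2 / (d : ℝ)) * gradSq u) (hP : ∀ p : ℝ, pot p v = θ * pot p u) :
    energy p₀ p₁ v = θ * energy p₀ p₁ u - θ * (1 - θ ^ (-(2 / (d : ℝ)))) * gradSq u := by
  rw [energy_eq, energy_eq, hG, hP, hP, sub_eq_add_neg 1, Real.rpow_add hθ, Real.rpow_one]
  ring

theorem virial_dilate {p₀ p₁ : ℝ} {u v : Space d → ℂ} {θ : ℝ} (hθ : 0 < θ)
    (hG : gradSq v = θ ^ (1 - 2 / (d : ℝ)) * gradSq u) (hP : ∀ p : ℝ, pot p v = θ * pot p u) :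
    virial p₀ p₁ v = θ * virial p₀ p₁ u - θ * (1 - θ ^ (-(2 / (d : ℝ)))) * gradSq u := by
  rw [virial_eq, virial_eq, hG, hP, hP, sub_eq_add_neg 1, Real.rpow_add hθ, Real.rpow_one]
  ring

theorem rpow_neg_two_div_lt_one (hd : 1 ≤ d) {θ : ℝ} (hθ : 1 < θ) :
    θ ^ (-(2 / (d : ℝ))) < 1 := by
  have hd0 : (0 : ℝ) < d := by exact_mod_cast hd
  exact Real.rpow_lt_one_of_one_lt_of_neg hθ (by
    have : 0 < 2 / (d : ℝ) := by positivity
    linarith)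

theorem tendsto_dilate_factor (x y z : ℝ) :
    Tendsto (fun θ : ℝ => θ * x - θ * (1 - θ ^ z) * y) (𝓝 1) (𝓝 x) := by
  have h : ContinuousAt (fun θ : ℝ => θ * x - θ * (1 - θ ^ z) * y) 1 := by
    have := Real.continuousAt_rpow_const 1 z (Or.inl one_ne_zero)
    fun_prop
  have h' := h.tendsto
  simpa using h'

theorem exists_energy_neg_of_le (hd : 1 ≤ d) {p₀ p₁ : ℝ} (hp₁ : 0 < p₁) (hp : p₁ < p₀)
    {u : Space d → ℂ} (hu : MemX p₀ u) (he : energy p₀ p₁ u < 0) {m : ℝ} (hm : mass u ≤ m) :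
    ∃ v : Space d → ℂ, MemX p₀ v ∧ mass v = m ∧ energy p₀ p₁ v < 0 := by
  obtain ⟨v, hv, hvm, h, -⟩ := exists_add_mass_pot hd hp₁ hp hu hm
  obtain ⟨n, hn⟩ := (h.eventually (gt_mem_nhds he)).exists
  exact ⟨v n, hv n, hvm n, hn⟩

theorem exists_energy_neg (hd : 1 ≤ d) {p₀ p₁ : ℝ} (hp₁ : 0 < p₁) (hp : p₁ < p₀) :
    ∃ u : Space d → ℂ, MemX p₀ u ∧ energy p₀ p₁ u < 0 := by
  have hp₀ : 0 < p₀ := by linarith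
  have hd0 : (0 : ℝ) < d := by exact_mod_cast hd
  obtain ⟨φ, hφ, hc, -, -, hφ1⟩ := exists_bump d
  set f : Space d → ℂ := fun x => (φ x : ℂ) with hf
  have hfX : MemX p₀ f := memX_ofReal_test p₀ hφ hc
  have hM : 0 < mass f := mass_pos_of_bump hφ hc hφ1
  have hA := hfX.pot_pos hp₁ hp.le hM
  have hB := hfX.pot_pos hp₀ le_rfl hM
  -- A small amplitude makes the p₀ term at most half of the p₁ term; a large length scale then
  -- makes the gradient negligible.
  obtain ⟨c, hc0, hc⟩ := exists_mul_rpow_le hB.le (sub_pos.2 hp).ne' (half_pos hA)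
  obtain ⟨l, hl, hl'⟩ := exists_mul_rpow_le (a := gradSq f) (ρ := 2) (gradSq_nonneg f) (by norm_num)
    (by positivity : 0 < c ^ p₁ * (pot p₁ f / 4))
  refine ⟨rescale c l f, hfX.rescale hp₀ c hl, ?_⟩
  rw [energy_eq, gradSq_rescale hfX.1 _ hl, pot_rescale _ _ hc0.le hl, pot_rescale _ _ hc0.le hl,
    sub_eq_add_neg 2, Real.rpow_add hl, Real.rpow_add hc0, Real.rpow_add hc0, Real.rpow_two c]
  have e : c ^ p₀ = c ^ (p₀ - p₁) * c ^ p₁ := by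
    rw [← Real.rpow_add hc0]; congr 1; ring
  rw [e]
  have h1 : 0 < c ^ 2 * l ^ (-(d : ℝ)) := by positivity
  have h2 : 0 < c ^ p₁ := by positivity
  have h3 : l ^ (2 : ℝ) * gradSq f - c ^ p₁ * pot p₁ f + c ^ (p₀ - p₁) * c ^ p₁ * pot p₀ f < 0 := by
    nlinarith
  calc _ = (c ^ 2 * l ^ (-(d : ℝ))) * (l ^ (2 : ℝ) * gradSq f - c ^ p₁ * pot p₁ f
        + c ^ (p₀ - p₁) * c ^ p₁ * pot p₀ f) := by ring
    _ < 0 := mul_neg_of_pos_of_neg h1 h3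

section critical

variable {p₀ p₁ : ℝ}

theorem bddAbove_critical (hd : 1 ≤ d) (hp₁ : 4 / (d : ℝ) < p₁) (hp : p₁ < p₀) :
    BddAbove {m : ℝ | 0 ≤ m ∧ minEnergy d p₀ p₁ m = 0} := by
  have hp₁0 := (pos_of_four_div_lt hd hp₁).1
  obtain ⟨u, hu, he⟩ := exists_energy_neg hd hp₁0 hp
  refine ⟨mass u, fun m hm => ?_⟩
  by_contra! hlt
  obtain ⟨v, hv, hvm, hve⟩ := exists_energy_neg_of_le hd hp₁0 hp hu he hlt.le
  have := (minEnergy_eq_zero_iff hd hp₁0 hp hm.1).1 hm.2 v hv hvm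
  linarith

theorem criticalMass_pos (hd : 1 ≤ d) (hp₁ : 4 / (d : ℝ) < p₁) (hp : p₁ < p₀) :
    0 < criticalMass d p₀ p₁ := by
  have hp₁0 := (pos_of_four_div_lt hd hp₁).1
  obtain ⟨m, hm, h⟩ := exists_energy_nonneg_of_small_mass hd hp₁ hp
  refine hm.trans_le (le_csSup (bddAbove_critical hd hp₁ hp) ⟨hm.le, ?_⟩)
  exact (minEnergy_eq_zero_iff hd hp₁0 hp hm.le).2 fun u hu hum => h u hu hum.le

/-- The supremum defining m_c is attained: a function of negative energy could be dilated slightly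
below mass m_c, still with negative energy, and then topped up to a mass m with I(m) = 0. -/
theorem energy_nonneg_of_mass_le (hd : 1 ≤ d) (hp₁ : 4 / (d : ℝ) < p₁) (hp : p₁ < p₀)
    {u : Space d → ℂ} (hu : MemX p₀ u) (hm : mass u ≤ criticalMass d p₀ p₁) :
    0 ≤ energy p₀ p₁ u := by
  have hp₁0 := (pos_of_four_div_lt hd hp₁).1
  by_contra! he
  have hm0 := mass_pos_of_energy_neg hp₁0 hp hu he
  have hev : ∀ᶠ θ : ℝ in 𝓝[<] 1, 0 < θ ∧ θ < 1 ∧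
      θ * energy p₀ p₁ u - θ * (1 - θ ^ (-(2 / (d : ℝ)))) * gradSq u < 0 := by
    have h1 := ((tendsto_dilate_factor (energy p₀ p₁ u) (gradSq u) (-(2 / (d : ℝ)))).mono_left
      (nhdsWithin_le_nhds (s := Set.Iio 1))).eventually (gt_mem_nhds he)
    filter_upwards [h1, Ioo_mem_nhdsLT (zero_lt_one : (0 : ℝ) < 1)] with θ h2 h3
    exact ⟨h3.1, h3.2, h2⟩
  obtain ⟨θ, hθ0, hθ1, hθ⟩ := hev.exists
  obtain ⟨v, hv, hvm, hvG, hvP⟩ := exists_dilate hd (by linarith : 0 < p₀) hu hθ0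
  rw [← energy_dilate hθ0 hvG hvP] at hθ
  have hlt : mass v < criticalMass d p₀ p₁ := by
    rw [hvm]; nlinarith
  have hne : {m : ℝ | 0 ≤ m ∧ minEnergy d p₀ p₁ m = 0}.Nonempty :=
    ⟨0, le_rfl, (minEnergy_eq_zero_iff hd hp₁0 hp le_rfl).2 fun w hw hwm => by
      by_contra! h
      exact (mass_pos_of_energy_neg hp₁0 hp hw h).ne' hwm⟩
  obtain ⟨m, hmS, hvm'⟩ := exists_lt_of_lt_csSup hne hlt
  obtain ⟨w, hw, hwm, hwe⟩ := exists_energy_neg_of_le hd hp₁0 hp hv hθ hvm'.le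
  have := (minEnergy_eq_zero_iff hd hp₁0 hp hmS.1).1 hmS.2 w hw hwm
  linarith

theorem minEnergy_eq_zero_of_le (hd : 1 ≤ d) (hp₁ : 4 / (d : ℝ) < p₁) (hp : p₁ < p₀) {m : ℝ}
    (hm0 : 0 ≤ m) (hm : m ≤ criticalMass d p₀ p₁) : minEnergy d p₀ p₁ m = 0 :=
  (minEnergy_eq_zero_iff hd (pos_of_four_div_lt hd hp₁).1 hp hm0).2 fun _ hu hum =>
    energy_nonneg_of_mass_le hd hp₁ hp hu (hum.le.trans hm)

theorem exists_energy_neg_of_criticalMass_lt (hd : 1 ≤ d) (hp₁ : 4 / (d : ℝ) < p₁) (hp : p₁ < p₀)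
    {m : ℝ} (hm : criticalMass d p₀ p₁ < m) :
    ∃ u : Space d → ℂ, MemX p₀ u ∧ mass u = m ∧ energy p₀ p₁ u < 0 := by
  have hp₁0 := (pos_of_four_div_lt hd hp₁).1
  have hm0 := (criticalMass_pos hd hp₁ hp).trans hm
  by_contra! h
  exact hm.not_ge (le_csSup (bddAbove_critical hd hp₁ hp)
    ⟨hm0.le, (minEnergy_eq_zero_iff hd hp₁0 hp hm0.le).2 h⟩)

theorem minEnergy_neg (hd : 1 ≤ d) (hp₁ : 4 / (d : ℝ) < p₁) (hp : p₁ < p₀)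
    {m : ℝ} (hm : criticalMass d p₀ p₁ < m) : minEnergy d p₀ p₁ m < 0 := by
  obtain ⟨u, hu, hum, he⟩ := exists_energy_neg_of_criticalMass_lt hd hp₁ hp hm
  rw [← hum]
  exact (minEnergy_le hu).trans_lt (by exact_mod_cast he)

/-- Dilate u to mass exactly m_c, where the energy is nonnegative; the defect term remains. The
coefficient is positive when the mass is below m_c. -/
theorem energy_ge_of_mass_lt (hd : 1 ≤ d) (hp₁ : 4 / (d : ℝ) < p₁) (hp : p₁ < p₀)
    {u : Space d → ℂ} (hu : MemX p₀ u) (hm0 : 0 < mass u) :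
    (1 - (criticalMass d p₀ p₁ / mass u) ^ (-(2 / (d : ℝ)))) * gradSq u ≤ energy p₀ p₁ u := by
  have hp₁0 := (pos_of_four_div_lt hd hp₁).1
  have hθ : 0 < criticalMass d p₀ p₁ / mass u := div_pos (criticalMass_pos hd hp₁ hp) hm0
  obtain ⟨v, hv, hvm, hvG, hvP⟩ := exists_dilate hd (by linarith : 0 < p₀) hu hθ
  have h := energy_nonneg_of_mass_le hd hp₁ hp hv (hvm.trans (div_mul_cancel₀ _ hm0.ne')).le
  rw [energy_dilate hθ hvG hvP, mul_assoc, ← mul_sub] at h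
  have := nonneg_of_mul_nonneg_right h hθ
  linarith

theorem energy_pos_of_mass_lt (hd : 1 ≤ d) (hp₁ : 4 / (d : ℝ) < p₁) (hp : p₁ < p₀)
    {u : Space d → ℂ} (hu : MemX p₀ u) (hm0 : 0 < mass u) (hm : mass u < criticalMass d p₀ p₁) :
    0 < energy p₀ p₁ u := by
  refine lt_of_lt_of_le (mul_pos ?_ (hu.1.gradSq_pos hd hm0))
    (energy_ge_of_mass_lt hd hp₁ hp hu hm0)
  exact sub_pos.2 (rpow_neg_two_div_lt_one hd ((one_lt_div hm0).2 hm))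

/-! ### Monotonicity -/

/-- A slight dilation with θ > 1 makes the virial strictly negative at almost no cost in energy. The
missing mass is then added while the virial stays negative, and the relaxed constraint gives the
bound. -/
theorem minVirialEnergy_antitone (hd : 1 ≤ d) (hp₁ : 4 / (d : ℝ) < p₁) (hp : p₁ < p₀)
    {m m' : ℝ} (hm : 0 < m) (hmm : m ≤ m') :
    minVirialEnergy d p₀ p₁ m' ≤ minVirialEnergy d p₀ p₁ m := by
  have hp₁0 := (pos_of_four_div_lt hd hp₁).1
  rcases hmm.eq_or_lt with rfl | hlt
  · exact le_rfl
  refine le_sInf ?_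
  rintro e ⟨u, hu, rfl, huv, rfl⟩
  by_contra! hcon
  obtain ⟨x, hx1, hx2⟩ := EReal.lt_iff_exists_real_btwn.1 hcon
  have hx1' : energy p₀ p₁ u < x := by exact_mod_cast hx1
  have hG := hu.1.gradSq_pos hd hm
  have hev : ∀ᶠ θ : ℝ in 𝓝[>] 1, 1 < θ ∧ θ * mass u < m' ∧
      θ * energy p₀ p₁ u - θ * (1 - θ ^ (-(2 / (d : ℝ)))) * gradSq u < x := by
    have h1 := ((tendsto_dilate_factor (energy p₀ p₁ u) (gradSq u) (-(2 / (d : ℝ)))).mono_left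
      (nhdsWithin_le_nhds (s := Set.Ioi 1))).eventually (gt_mem_nhds hx1')
    have h2 : Tendsto (fun θ : ℝ => θ * mass u) (𝓝[>] 1) (𝓝 (1 * mass u)) :=
      (tendsto_id.mono_left nhdsWithin_le_nhds).mul_const _
    rw [one_mul] at h2
    filter_upwards [h1, h2.eventually (gt_mem_nhds hlt), self_mem_nhdsWithin] with θ h2 h3 h4
    exact ⟨h4, h3, h2⟩
  obtain ⟨θ, hθ1, hθm, hθe⟩ := hev.exists
  have hθ0 : 0 < θ := by linarith
  obtain ⟨w, hw, hwm, hwG, hwP⟩ := exists_dilate hd (by linarith : 0 < p₀) hu hθ0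
  rw [← energy_dilate hθ0 hwG hwP] at hθe
  have hwv : virial p₀ p₁ w < 0 := by
    rw [virial_dilate hθ0 hwG hwP, huv, mul_zero, zero_sub]
    have := sub_pos.2 (rpow_neg_two_div_lt_one hd hθ1)
    have : 0 < θ * (1 - θ ^ (-(2 / (d : ℝ)))) * gradSq u := by positivity
    linarith
  obtain ⟨v, hv, hvm, hve, hvv⟩ := exists_add_mass_pot hd hp₁0 hp hw (m := m')
    (by rw [hwm]; exact hθm.le)
  obtain ⟨n, hn1, hn2⟩ := ((hve.eventually (gt_mem_nhds hθe)).and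
    (hvv.eventually (gt_mem_nhds hwv))).exists
  have h1 := minVirialEnergy_le_of_nonpos hd hp₁ hp (hv n) (by rw [hvm]; linarith) hn2.le
  rw [hvm] at h1
  have h2 : (energy p₀ p₁ (v n) : EReal) < x := by exact_mod_cast hn1
  exact (h1.trans_lt (h2.trans hx2)).false

theorem minEnergy_le_minVirialEnergy (m : ℝ) :
    minEnergy d p₀ p₁ m ≤ minVirialEnergy d p₀ p₁ m :=
  sInf_le_sInf fun _ ⟨u, hu, hum, _, he⟩ => ⟨u, hu, hum, he⟩

theorem minVirialEnergy_eq_minEnergy_of_lt (hd : 1 ≤ d) (hp₁ : 4 / (d : ℝ) < p₁) (hp : p₁ < p₀)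
    {m : ℝ} (hm : criticalMass d p₀ p₁ < m) :
    minVirialEnergy d p₀ p₁ m = minEnergy d p₀ p₁ m := by
  refine le_antisymm ?_ (minEnergy_le_minVirialEnergy m)
  by_contra! hcon
  have h1 : minEnergy d p₀ p₁ m < min (minVirialEnergy d p₀ p₁ m) 0 :=
    lt_min hcon (minEnergy_neg hd hp₁ hp hm)
  obtain ⟨e, ⟨u, hu, hum, rfl⟩, he⟩ := sInf_lt_iff.1 h1
  have he1 := he.trans_le (min_le_left _ _)
  have he2 : energy p₀ p₁ u < 0 := by exact_mod_cast he.trans_le (min_le_right _ _)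
  obtain ⟨w, hw, hwm, hwv, hwe⟩ := exists_virial_eq_zero_of_energy_neg hd hp₁ hp hu
    (hum ▸ (criticalMass_pos hd hp₁ hp).trans hm) he2
  have h2 := minVirialEnergy_le hw hwv
  rw [hwm, hum] at h2
  have h3 : (energy p₀ p₁ w : EReal) ≤ energy p₀ p₁ u := by exact_mod_cast hwe
  exact ((h2.trans h3).trans_lt he1).false

end critical

/-! ### Compactness of sequences with nonpositive virial -/

section compactness

variable {p₀ p₁ : ℝ}

/-- The energy bound controls G and the p₀ term from above; the virial sign bounds G, hence also the
p₁ term, from below. These are the hypotheses needed to extract a profile. -/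
theorem exists_profile_of_virial_nonpos (hd : 1 ≤ d) (hp₁ : 4 / (d : ℝ) < p₁) (hp : p₁ < p₀)
    {u : ℕ → Space d → ℂ} (hu : ∀ n, MemX p₀ (u n)) {M e : ℝ} (hM0 : ∀ n, 0 < mass (u n))
    (hM : ∀ n, mass (u n) ≤ M) (he : ∀ n, energy p₀ p₁ (u n) ≤ e)
    (hv : ∀ n, virial p₀ p₁ (u n) ≤ 0) :
    ∃ (σ : ℕ → ℕ) (w : Space d → ℂ) (r : ℕ → Space d → ℂ), StrictMono σ ∧ MemX p₀ w ∧
      0 < mass w ∧ (∀ n, MemX p₀ (r n)) ∧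
      Tendsto (fun n => mass (u (σ n)) - mass (r n)) atTop (𝓝 (mass w)) ∧
      Tendsto (fun n => energy p₀ p₁ (u (σ n)) - energy p₀ p₁ (r n)) atTop
        (𝓝 (energy p₀ p₁ w)) ∧
      Tendsto (fun n => virial p₀ p₁ (u (σ n)) - virial p₀ p₁ (r n)) atTop
        (𝓝 (virial p₀ p₁ w)) := by
  have hp₁0 := (pos_of_four_div_lt hd hp₁).1
  have hp₀ : 0 < p₀ := by linarith
  have hd0 : (0 : ℝ) < d := by exact_mod_cast hd
  obtain ⟨C, hC, hb⟩ := exists_energy_bound (d := d) hp₁0 hp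
  obtain ⟨c, hc, hlow⟩ := exists_gradSq_lower_bound hd hp₁ hp M
  have hK : ∀ n, gradSq (u n) + 1 / (p₀ + 2) * powInt p₀ (u n) ≤ e + C * M := fun n =>
    (hb (u n) (hu n)).trans (add_le_add (he n) (mul_le_mul_of_nonneg_left (hM n) hC.le))
  have hB0 : ∀ n, 0 ≤ 1 / (p₀ + 2) * powInt p₀ (u n) := fun n =>
    mul_nonneg (by positivity) (powInt_nonneg _ _)
  have hA : ∀ n, c / (d * p₁ / (2 * (p₁ + 2))) ≤ powInt p₁ (u n) := by
    intro n
    rw [div_le_iff₀ (by positivity), mul_comm]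
    have h1 := hlow (u n) (hu n) (hM0 n) (hM n) (hv n)
    have h2 := hv n
    rw [virial] at h2
    have h3 : 0 ≤ d * p₀ / (2 * (p₀ + 2)) * powInt p₀ (u n) :=
      mul_nonneg (by positivity) (powInt_nonneg _ _)
    linarith
  obtain ⟨σ, w, r, hσ, hw, hw0, hr, h1, h2, h3, h4⟩ := exists_profile hp₁0 hp hu hM
    (G := e + C * M) (B := (p₀ + 2) * (e + C * M)) (fun n => by linarith [hK n, hB0 n])
    (fun n => by
      have h5 : 1 / (p₀ + 2) * powInt p₀ (u n) ≤ e + C * M := by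
        linarith [hK n, gradSq_nonneg (u n)]
      rwa [one_div, inv_mul_le_iff₀ (by positivity)] at h5) (by positivity) hA
  refine ⟨σ, w, r, hσ, hw, hw0, hr, h1, ?_, ?_⟩
  · refine ((h2.sub (h3.const_mul (2 / (p₁ + 2)))).add (h4.const_mul (2 / (p₀ + 2)))).congr
      fun n => ?_
    simp only [energy]
    ring
  · refine ((h2.sub (h3.const_mul (d * p₁ / (2 * (p₁ + 2))))).add
      (h4.const_mul (d * p₀ / (2 * (p₀ + 2))))).congr fun n => ?_
    simp only [virial]
    ring

theorem bounds_of_tendsto {x y : ℕ → ℝ} {a b : ℝ} {σ : ℕ → ℕ} (hσ : StrictMono σ)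
    (hx : Tendsto x atTop (𝓝 a)) (h : Tendsto (fun n => x (σ n) - y n) atTop (𝓝 b)) :
    Tendsto y atTop (𝓝 (a - b)) := by
  have := (hx.comp hσ.tendsto_atTop).sub h
  simpa using this

/-! ### Minimizers of the energy -/

/-- Strict subadditivity: dilating v up to mass m strictly lowers its energy per unit mass. -/
theorem energy_gt_of_mass_lt (hd : 1 ≤ d) (hp₁ : 4 / (d : ℝ) < p₁) (hp : p₁ < p₀) {m i : ℝ}
    (hi : ∀ v : Space d → ℂ, MemX p₀ v → mass v = m → i ≤ energy p₀ p₁ v) {v : Space d → ℂ}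
    (hv : MemX p₀ v) (hv0 : 0 < mass v) (hvm : mass v < m) :
    mass v / m * i < energy p₀ p₁ v := by
  have hp₁0 := (pos_of_four_div_lt hd hp₁).1
  have hm : 0 < m := hv0.trans hvm
  have hθ : 1 < m / mass v := (one_lt_div hv0).2 hvm
  have hθ0 : 0 < m / mass v := by linarith
  obtain ⟨w, hw, hwm, hwG, hwP⟩ := exists_dilate hd (by linarith : 0 < p₀) hv hθ0
  have h1 := hi w hw (hwm.trans (div_mul_cancel₀ _ hv0.ne'))
  rw [energy_dilate hθ0 hwG hwP] at h1
  have h2 := sub_pos.2 (rpow_neg_two_div_lt_one hd hθ)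
  have h3 := hv.1.gradSq_pos hd hv0
  have h4 : 0 < m / mass v * (1 - (m / mass v) ^ (-(2 / (d : ℝ)))) * gradSq v := by positivity
  have h5 : i < m / mass v * energy p₀ p₁ v := by linarith
  calc mass v / m * i < mass v / m * (m / mass v * energy p₀ p₁ v) :=
        mul_lt_mul_of_pos_left h5 (by positivity)
    _ = energy p₀ p₁ v := by field_simp

/-- The remainder carries at least its proportional share of the infimum, so the profile carries at
most its own. Strict subadditivity then forces the profile to take all the mass. -/
theorem exists_of_minimizing (hd : 1 ≤ d) (hp₁ : 4 / (d : ℝ) < p₁) (hp : p₁ < p₀) {m i : ℝ}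
    (hi : ∀ v : Space d → ℂ, MemX p₀ v → mass v = m → i ≤ energy p₀ p₁ v)
    {u : ℕ → Space d → ℂ} (hu : ∀ n, MemX p₀ (u n)) (hu0 : ∀ n, 0 < mass (u n))
    (hum : Tendsto (fun n => mass (u n)) atTop (𝓝 m)) (hv : ∀ n, virial p₀ p₁ (u n) ≤ 0)
    {e : ℕ → ℝ} (hue : ∀ n, energy p₀ p₁ (u n) ≤ e n) (he : Tendsto e atTop (𝓝 i)) :
    ∃ w : Space d → ℂ, MemX p₀ w ∧ mass w = m ∧ virial p₀ p₁ w = 0 ∧ energy p₀ p₁ w = i := by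
  obtain ⟨M, hM⟩ := hum.bddAbove_range
  obtain ⟨E, hE⟩ := he.bddAbove_range
  obtain ⟨σ, w, r, hσ, hw, hw0, hr, h1, h2, -⟩ := exists_profile_of_virial_nonpos hd hp₁ hp hu hu0
    (fun n => hM ⟨n, rfl⟩) (fun n => (hue n).trans (hE ⟨n, rfl⟩)) hv
  have hrm := bounds_of_tendsto hσ hum h1
  have hwm : mass w ≤ m := sub_nonneg.1 (ge_of_tendsto' hrm fun n => mass_nonneg _)
  have hm : 0 < m := hw0.trans_le hwm
  have hre : ∀ᶠ n in atTop, mass (r n) / m * i ≤ energy p₀ p₁ (r n) := by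
    filter_upwards [hrm.eventually (gt_mem_nhds (by linarith : m - mass w < m))] with n hn
    rcases (mass_nonneg (r n)).eq_or_lt with h0 | h0
    · rw [← h0, zero_div, zero_mul]
      exact energy_nonneg_of_mass_le hd hp₁ hp (hr n) (h0 ▸ (criticalMass_pos hd hp₁ hp).le)
    · exact (energy_gt_of_mass_lt hd hp₁ hp hi (hr n) h0 hn).le
  have hwe : energy p₀ p₁ w ≤ mass w / m * i := by
    have h3 : Tendsto (fun n => e (σ n) - mass (r n) / m * i) atTop
        (𝓝 (i - (m - mass w) / m * i)) :=
      (he.comp hσ.tendsto_atTop).sub ((hrm.div_const m).mul_const i)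
    have e1 : i - (m - mass w) / m * i = mass w / m * i := by field_simp; ring
    rw [e1] at h3
    refine le_of_tendsto_of_tendsto h2 h3 ?_
    filter_upwards [hre] with n hn
    linarith [hue (σ n)]
  have hwm' : mass w = m := by
    by_contra hne
    exact (energy_gt_of_mass_lt hd hp₁ hp hi hw hw0 (hwm.lt_of_ne hne)).not_ge hwe
  rw [hwm', div_self hm.ne', one_mul] at hwe
  refine ⟨w, hw, hwm', virial_eq_zero_of_energy_min hd hp₁ hp hw fun v hv hvm =>
    hwe.trans (hi v hv (hvm.trans hwm')), hwe.antisymm (hi w hw hwm')⟩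

/-- At m_c itself a minimizing sequence may spread out and vanish. The sequence is taken instead at
masses decreasing to m_c, with zero virial, which prevents vanishing. -/
theorem exists_minimizer_criticalMass (hd : 1 ≤ d) (hp₁ : 4 / (d : ℝ) < p₁) (hp : p₁ < p₀) :
    ∃ w : Space d → ℂ, MemX p₀ w ∧ mass w = criticalMass d p₀ p₁ ∧ virial p₀ p₁ w = 0 ∧
      energy p₀ p₁ w = 0 := by
  have hmc := criticalMass_pos hd hp₁ hp
  have hm : ∀ n : ℕ, criticalMass d p₀ p₁ < criticalMass d p₀ p₁ + 1 / ((n : ℝ) + 1) := fun n =>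
    lt_add_of_pos_right _ (by positivity)
  have hex : ∀ n : ℕ, ∃ w : Space d → ℂ, MemX p₀ w ∧
      mass w = criticalMass d p₀ p₁ + 1 / ((n : ℝ) + 1) ∧ virial p₀ p₁ w = 0 ∧
      energy p₀ p₁ w ≤ 0 := by
    intro n
    obtain ⟨u, hu, hum, he⟩ := exists_energy_neg_of_criticalMass_lt hd hp₁ hp (hm n)
    obtain ⟨w, hw, hwm, hwv, hwe⟩ := exists_virial_eq_zero_of_energy_neg hd hp₁ hp hu
      (hum ▸ hmc.trans (hm n)) he
    exact ⟨w, hw, hwm.trans hum, hwv, hwe.trans he.le⟩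
  choose u hu hum huv hue using hex
  refine exists_of_minimizing hd hp₁ hp (fun v hv hvm => energy_nonneg_of_mass_le hd hp₁ hp hv hvm.le)
    hu (fun n => hum n ▸ hmc.trans (hm n)) ?_ (fun n => (huv n).le) hue tendsto_const_nhds
  simp only [hum]
  simpa using (tendsto_const_nhds (x := criticalMass d p₀ p₁)).add
    (tendsto_one_div_add_atTop_nhds_zero_nat (𝕜 := ℝ))

theorem exists_minimizer_of_criticalMass_lt (hd : 1 ≤ d) (hp₁ : 4 / (d : ℝ) < p₁) (hp : p₁ < p₀)
    {m : ℝ} (hm : criticalMass d p₀ p₁ < m) :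
    ∃ w : Space d → ℂ, MemX p₀ w ∧ mass w = m ∧ virial p₀ p₁ w = 0 ∧
      (energy p₀ p₁ w : EReal) = minEnergy d p₀ p₁ m := by
  have hm0 := (criticalMass_pos hd hp₁ hp).trans hm
  obtain ⟨u₀, hu₀, hu₀m, hu₀e⟩ := exists_energy_neg_of_criticalMass_lt hd hp₁ hp hm
  obtain ⟨C, hC, hb⟩ := exists_energy_bound (d := d) (pos_of_four_div_lt hd hp₁).1 hp
  set S : Set ℝ := {e | ∃ u : Space d → ℂ, MemX p₀ u ∧ mass u = m ∧ e = energy p₀ p₁ u} with hS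
  have hSb : BddBelow S := by
    refine ⟨-(C * m), ?_⟩
    rintro e ⟨u, hu, hum, rfl⟩
    have h1 := hb u hu
    have h2 := gradSq_nonneg u
    have h3 : 0 ≤ 1 / (p₀ + 2) * powInt p₀ u := mul_nonneg (by
      have := (pos_of_four_div_lt hd hp₁).1.trans hp
      positivity) (powInt_nonneg _ _)
    rw [hum] at h1
    linarith
  have hi : ∀ v : Space d → ℂ, MemX p₀ v → mass v = m → sInf S ≤ energy p₀ p₁ v :=
    fun v hv hvm => csInf_le hSb ⟨v, hv, hvm, rfl⟩
  have hSn : S.Nonempty := ⟨_, u₀, hu₀, hu₀m, rfl⟩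
  have hi0 : sInf S < 0 := (hi u₀ hu₀ hu₀m).trans_lt hu₀e
  have hex : ∀ n : ℕ, ∃ w : Space d → ℂ, MemX p₀ w ∧ mass w = m ∧ virial p₀ p₁ w = 0 ∧
      energy p₀ p₁ w ≤ sInf S + 1 / ((n : ℝ) + 1) := by
    intro n
    -- Staying below 0 as well guarantees the negative energy required to pass to zero virial.
    have hlt : sInf S < min (sInf S + 1 / ((n : ℝ) + 1)) 0 :=
      lt_min (lt_add_of_pos_right _ (by positivity)) hi0
    obtain ⟨e, ⟨u, hu, hum, rfl⟩, he⟩ := exists_lt_of_csInf_lt hSn hlt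
    obtain ⟨w, hw, hwm, hwv, hwe⟩ := exists_virial_eq_zero_of_energy_neg hd hp₁ hp hu
      (hum ▸ hm0) (he.trans_le (min_le_right _ _))
    exact ⟨w, hw, hwm.trans hum, hwv, hwe.trans (he.le.trans (min_le_left _ _))⟩
  choose u hu hum huv hue using hex
  have hlim : Tendsto (fun n : ℕ => sInf S + 1 / ((n : ℝ) + 1)) atTop (𝓝 (sInf S)) := by
    simpa using (tendsto_const_nhds (x := sInf S)).add
      (tendsto_one_div_add_atTop_nhds_zero_nat (𝕜 := ℝ))
  obtain ⟨w, hw, hwm, hwv, hwe⟩ := exists_of_minimizing hd hp₁ hp hi hu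
    (fun n => hum n ▸ hm0) (by simp only [hum]; exact tendsto_const_nhds) (fun n => (huv n).le) hue
    hlim
  refine ⟨w, hw, hwm, hwv, le_antisymm (le_sInf ?_) (hwm ▸ minEnergy_le hw)⟩
  rintro e ⟨v, hv, hvm, rfl⟩
  rw [hwe]
  exact_mod_cast hi v hv hvm

theorem minVirialEnergy_eq_minEnergy (hd : 1 ≤ d) (hp₁ : 4 / (d : ℝ) < p₁) (hp : p₁ < p₀)
    {m : ℝ} (hm : criticalMass d p₀ p₁ ≤ m) :
    minVirialEnergy d p₀ p₁ m = minEnergy d p₀ p₁ m := by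
  rcases hm.eq_or_lt with rfl | hm
  · refine le_antisymm ?_ (minEnergy_le_minVirialEnergy _)
    obtain ⟨w, hw, hwm, hwv, hwe⟩ := exists_minimizer_criticalMass hd hp₁ hp
    rw [minEnergy_eq_zero_of_le hd hp₁ hp (criticalMass_pos hd hp₁ hp).le le_rfl]
    have := minVirialEnergy_le hw hwv
    rw [hwm, hwe] at this
    exact_mod_cast this
  · exact minVirialEnergy_eq_minEnergy_of_lt hd hp₁ hp hm

theorem exists_minimizer_of_criticalMass_le (hd : 1 ≤ d) (hp₁ : 4 / (d : ℝ) < p₁) (hp : p₁ < p₀)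
    {m : ℝ} (hm : criticalMass d p₀ p₁ ≤ m) :
    ∃ w : Space d → ℂ, MemX p₀ w ∧ mass w = m ∧ virial p₀ p₁ w = 0 ∧
      (energy p₀ p₁ w : EReal) = minVirialEnergy d p₀ p₁ m := by
  rw [minVirialEnergy_eq_minEnergy hd hp₁ hp hm]
  rcases hm.eq_or_lt with rfl | hm
  · obtain ⟨w, hw, hwm, hwv, hwe⟩ := exists_minimizer_criticalMass hd hp₁ hp
    refine ⟨w, hw, hwm, hwv, ?_⟩
    rw [hwe, minEnergy_eq_zero_of_le hd hp₁ hp (criticalMass_pos hd hp₁ hp).le le_rfl]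
    rfl
  · exact exists_minimizer_of_criticalMass_lt hd hp₁ hp hm

/-! ### The rescaled critical mass -/

/-- Rescaling u to c·u(lx) gives energy c²l^(-d)(l²G - c^p₁ a + c^p₀ b). It is a multiple of the
virial as soon as c^p₁ = l²α and c^p₀ = l²β. -/
theorem exists_virial_scaling (hd : 1 ≤ d) (hp₁ : 4 / (d : ℝ) < p₁) (hp : p₁ < p₀) :
    ∃ κ k : ℝ, 0 < κ ∧ 0 < k ∧ criticalMassTilde d p₀ p₁ * κ = criticalMass d p₀ p₁ ∧
      (∀ u : Space d → ℂ, MemX p₀ u → ∃ v : Space d → ℂ, MemX p₀ v ∧ mass v = κ * mass u ∧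
        energy p₀ p₁ v = k * virial p₀ p₁ u) ∧
      ∀ v : Space d → ℂ, MemX p₀ v → ∃ u : Space d → ℂ, MemX p₀ u ∧ mass v = κ * mass u ∧
        energy p₀ p₁ v = k * virial p₀ p₁ u := by
  obtain ⟨hp₁0, hα1⟩ := pos_of_four_div_lt hd hp₁
  have hp₀ : 0 < p₀ := by linarith
  have hd0 : (0 : ℝ) < d := by exact_mod_cast hd
  have hpp : p₀ - p₁ ≠ 0 := by linarith
  -- The quotient of the two conditions, c^(p₀-p₁) = β/α = p₀/p₁, determines c; then l² = c^p₁/α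
  -- determines l.
  set c := (p₀ / p₁) ^ (1 / (p₀ - p₁)) with hc
  set α := d * p₁ / 4 with hα
  have hc0 : 0 < c := by positivity
  have hα0 : 0 < α := by linarith
  set l := (c ^ p₁ / α) ^ (1 / 2 : ℝ) with hl
  have hl0 : 0 < l := by positivity
  have hcpp : c ^ (p₀ - p₁) = p₀ / p₁ := by
    rw [hc, ← Real.rpow_mul (by positivity), one_div_mul_cancel hpp, Real.rpow_one]
  have hl2 : l ^ (2 : ℝ) * α = c ^ p₁ := by
    rw [hl, ← Real.rpow_mul (by positivity)]
    norm_num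
    field_simp
  have hcp₀ : c ^ p₀ = l ^ (2 : ℝ) * (d * p₀ / 4) := by
    have : c ^ p₀ = c ^ (p₀ - p₁) * c ^ p₁ := by rw [← Real.rpow_add hc0]; congr 1; ring
    rw [this, hcpp, ← hl2, hα]
    field_simp
  have hE : ∀ u : Space d → ℂ, MemX p₀ u →
      energy p₀ p₁ (rescale c l u) = c ^ 2 * l ^ (2 - (d : ℝ)) * virial p₀ p₁ u := by
    intro u hu
    rw [energy_eq, virial_eq, gradSq_rescale hu.1 _ hl0, pot_rescale _ _ hc0.le hl0,
      pot_rescale _ _ hc0.le hl0, sub_eq_add_neg 2, Real.rpow_add hl0, Real.rpow_add hc0,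
      Real.rpow_add hc0, Real.rpow_two c, hcp₀, ← hl2]
    ring
  refine ⟨c ^ 2 * l ^ (-(d : ℝ)), c ^ 2 * l ^ (2 - (d : ℝ)), by positivity, by positivity, ?_,
    fun u hu => ⟨rescale c l u, hu.rescale hp₀ c hl0, mass_rescale u c hl0, hE u hu⟩,
    fun v hv => ?_⟩
  · have e1 : (p₀ / p₁) ^ ((p₁ * d - 4) / (2 * (p₀ - p₁))) = c ^ ((p₁ * d - 4) / 2) := by
      rw [hc, ← Real.rpow_mul (by positivity)]
      congr 1
      field_simp
    have e2 : 4 / (d * p₁) = α⁻¹ := by rw [hα, inv_div]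
    have e3 : l ^ (-(d : ℝ)) = c ^ (-(p₁ * d / 2)) * α ^ ((d : ℝ) / 2) := by
      rw [hl, ← Real.rpow_mul (by positivity), Real.div_rpow (by positivity) hα0.le,
        ← Real.rpow_mul hc0.le, div_eq_mul_inv, ← Real.rpow_neg hα0.le]
      congr 2 <;> ring
    have e4 : c ^ ((p₁ * d - 4) / 2) * (c ^ 2 * c ^ (-(p₁ * d / 2))) = 1 := by
      rw [← Real.rpow_two, ← Real.rpow_add hc0, ← Real.rpow_add hc0, ← Real.rpow_zero c]
      congr 1
      ring
    rw [criticalMassTilde, e1, e2, e3, Real.inv_rpow hα0.le]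
    have h5 : α ^ ((d : ℝ) / 2) ≠ 0 := by positivity
    calc _ = (c ^ ((p₁ * d - 4) / 2) * (c ^ 2 * c ^ (-(p₁ * d / 2))))
          * ((α ^ ((d : ℝ) / 2))⁻¹ * α ^ ((d : ℝ) / 2)) * criticalMass d p₀ p₁ := by ring
      _ = criticalMass d p₀ p₁ := by rw [e4, inv_mul_cancel₀ h5, one_mul, one_mul]
  · have hX : MemX p₀ (rescale c⁻¹ l⁻¹ v) := hv.rescale hp₀ c⁻¹ (by positivity)
    have hv' : rescale c l (rescale c⁻¹ l⁻¹ v) = v := by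
      funext x
      simp [rescale, smul_smul, hc0.ne', hl0.ne']
    refine ⟨rescale c⁻¹ l⁻¹ v, hX, ?_, ?_⟩
    · rw [← mass_rescale _ c hl0, hv']
    · rw [← hE _ hX, hv']

theorem criticalMassTilde_pos (hd : 1 ≤ d) (hp₁ : 4 / (d : ℝ) < p₁) (hp : p₁ < p₀) :
    0 < criticalMassTilde d p₀ p₁ := by
  obtain ⟨κ, k, hκ, -, h, -⟩ := exists_virial_scaling hd hp₁ hp
  exact pos_of_mul_pos_left (h ▸ criticalMass_pos hd hp₁ hp) hκ.le

theorem minVirialEnergy_eq_top (hd : 1 ≤ d) (hp₁ : 4 / (d : ℝ) < p₁) (hp : p₁ < p₀) {m : ℝ}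
    (hm0 : 0 < m) (hm : m < criticalMassTilde d p₀ p₁) : minVirialEnergy d p₀ p₁ m = ⊤ := by
  obtain ⟨κ, k, hκ, -, h, h1, -⟩ := exists_virial_scaling hd hp₁ hp
  refine sInf_eq_top.2 ?_
  rintro e ⟨u, hu, rfl, huv, rfl⟩
  obtain ⟨v, hv, hvm, hve⟩ := h1 u hu
  have := energy_pos_of_mass_lt hd hp₁ hp hv (by rw [hvm]; positivity)
    (by rw [hvm, ← h, mul_comm]; exact mul_lt_mul_of_pos_right hm hκ)
  rw [hve, huv, mul_zero] at this
  exact absurd this (lt_irrefl _)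

/-- The zero-energy function of mass m_c is transported to a zero-virial function of mass m̃_c;
monotonicity covers larger masses. -/
theorem minVirialEnergy_lt_top (hd : 1 ≤ d) (hp₁ : 4 / (d : ℝ) < p₁) (hp : p₁ < p₀) {m : ℝ}
    (hm : criticalMassTilde d p₀ p₁ ≤ m) : minVirialEnergy d p₀ p₁ m < ⊤ := by
  obtain ⟨κ, k, hκ, hk, h, -, h1⟩ := exists_virial_scaling hd hp₁ hp
  refine (minVirialEnergy_antitone hd hp₁ hp (criticalMassTilde_pos hd hp₁ hp) hm).trans_lt ?_
  obtain ⟨w, hw, hwm, -, hwe⟩ := exists_minimizer_criticalMass hd hp₁ hp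
  obtain ⟨u, hu, hum, hue⟩ := h1 w hw
  have huv : virial p₀ p₁ u = 0 := by
    rw [hwe] at hue
    exact (mul_eq_zero.1 hue.symm).resolve_left hk.ne'
  have hum' : mass u = criticalMassTilde d p₀ p₁ := by
    rw [hwm, ← h, mul_comm] at hum
    exact (mul_left_cancel₀ hκ.ne' hum).symm
  rw [← hum']
  exact (minVirialEnergy_le hu huv).trans_lt (EReal.coe_lt_top _)

/-- Coercivity below m_c together with the uniform lower bound on G keeps the infimum, not just each
value, positive. -/
theorem minVirialEnergy_pos (hd : 1 ≤ d) (hp₁ : 4 / (d : ℝ) < p₁) (hp : p₁ < p₀) {m : ℝ}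
    (hm0 : 0 < m) (hm : m < criticalMass d p₀ p₁) : 0 < minVirialEnergy d p₀ p₁ m := by
  obtain ⟨c, hc, h⟩ := exists_gradSq_lower_bound hd hp₁ hp m
  have hf := sub_pos.2 (rpow_neg_two_div_lt_one hd ((one_lt_div hm0).2 hm))
  refine lt_of_lt_of_le (EReal.coe_pos.2 (mul_pos hf hc)) (le_sInf ?_)
  rintro e ⟨u, hu, rfl, huv, rfl⟩
  refine EReal.coe_le_coe_iff.2 ((mul_le_mul_of_nonneg_left (h u hu hm0 le_rfl huv.le) hf.le).trans
    (energy_ge_of_mass_lt hd hp₁ hp hu hm0))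

/-! ### Subcritical sequences -/

theorem mass_pos_of_virial_neg (hp₁ : 0 < p₁) (hp : p₁ < p₀) {u : Space d → ℂ}
    (hu : MemX p₀ u) (hv : virial p₀ p₁ u < 0) : 0 < mass u := by
  refine (mass_nonneg u).lt_of_ne fun h0 => hv.not_ge ?_
  have hz : (fun x => ‖u x‖ ^ 2) =ᵐ[volume] 0 :=
    (integral_eq_zero_iff_of_nonneg (fun x => by positivity)
      (MemLp.integrable_norm_sq hu.1.1)).1 h0.symm
  have hP : powInt p₁ u = 0 := by
    refine integral_eq_zero_of_ae ?_
    filter_upwards [hz] with x hx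
    have : ‖u x‖ = 0 := by simpa using hx
    rw [this, Real.zero_rpow (by linarith)]
    rfl
  rw [virial, hP, mul_zero, sub_zero]
  have hp₀ : 0 < p₀ := by linarith
  exact add_nonneg (gradSq_nonneg u) (mul_nonneg (by positivity) (powInt_nonneg _ _))

/-- Below m_c all pieces have nonnegative energy. If the profile has Φ ≤ 0 it is itself the answer;
otherwise the remainders inherit the negative virial. -/
theorem exists_virial_nonpos_of_tendsto (hd : 1 ≤ d) (hp₁ : 4 / (d : ℝ) < p₁) (hp : p₁ < p₀)
    {m e : ℝ} (hm : m < criticalMass d p₀ p₁) {u : ℕ → Space d → ℂ} (hu : ∀ n, MemX p₀ (u n))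
    (hu0 : ∀ n, 0 < mass (u n)) (hum : Tendsto (fun n => mass (u n)) atTop (𝓝 m))
    (hv : ∀ n, virial p₀ p₁ (u n) ≤ 0) {e' : ℕ → ℝ} (hue : ∀ n, energy p₀ p₁ (u n) ≤ e' n)
    (he : Tendsto e' atTop (𝓝 e)) :
    ∃ w : Space d → ℂ, MemX p₀ w ∧ 0 < mass w ∧ mass w ≤ m ∧ virial p₀ p₁ w ≤ 0 ∧
      energy p₀ p₁ w ≤ e := by
  obtain ⟨M, hM⟩ := hum.bddAbove_range
  obtain ⟨E, hE⟩ := he.bddAbove_range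
  obtain ⟨σ, w, r, hσ, hw, hw0, hr, h1, h2, h3⟩ := exists_profile_of_virial_nonpos hd hp₁ hp hu hu0
    (fun n => hM ⟨n, rfl⟩) (fun n => (hue n).trans (hE ⟨n, rfl⟩)) hv
  have hrm := bounds_of_tendsto hσ hum h1
  have hwm : mass w ≤ m := sub_nonneg.1 (ge_of_tendsto' hrm fun n => mass_nonneg _)
  have hσe := he.comp hσ.tendsto_atTop
  rcases le_or_gt (virial p₀ p₁ w) 0 with hwv | hwv
  · refine ⟨w, hw, hw0, hwm, hwv, le_of_tendsto_of_tendsto h2 hσe ?_⟩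
    filter_upwards [hrm.eventually (gt_mem_nhds (by linarith :
      m - mass w < criticalMass d p₀ p₁))] with n hn
    have := energy_nonneg_of_mass_le hd hp₁ hp (hr n) hn.le
    have := hue (σ n)
    simp only [Function.comp]
    linarith
  -- The profile takes a positive amount of energy and of mass, so a late remainder has energy below
  -- e and mass below m.
  · have hwe := energy_pos_of_mass_lt hd hp₁ hp hw hw0 (hwm.trans_lt hm)
    obtain ⟨n, ⟨hn1, hn2⟩, hn3⟩ := (((hrm.eventually (gt_mem_nhds (by linarith :
      m - mass w < m))).and (h3.eventually (lt_mem_nhds hwv))).and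
      ((hσe.sub h2).eventually (gt_mem_nhds (by linarith : e - energy p₀ p₁ w < e)))).exists
    have hrv : virial p₀ p₁ (r n) < 0 := by linarith [hv (σ n)]
    refine ⟨r n, hr n, mass_pos_of_virial_neg (pos_of_four_div_lt hd hp₁).1 hp (hr n) hrv, hn1.le,
      hrv.le, ?_⟩
    have := hue (σ n)
    simp only [Function.comp] at hn3
    linarith

end compactness
/-! ### Derivatives of the functionals -/

/-- Differentiation under the integral; for |ε| ≤ 1 the derivative is dominated by
(p+2)(|U|+|Ψ|)^(p+2). -/
theorem hasDerivAt_integral_abs_rpow {p : ℝ} (hp : 0 < p) {U Ψ : Space d → ℝ}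
    (hU : MemLp U (ENNReal.ofReal (p + 2)) volume)
    (hΨ : MemLp Ψ (ENNReal.ofReal (p + 2)) volume) :
    Integrable (fun x => |U x| ^ p * U x * Ψ x) volume ∧
      HasDerivAt (fun ε : ℝ => ∫ x, |U x + ε * Ψ x| ^ (p + 2))
        ((p + 2) * ∫ x, |U x| ^ p * U x * Ψ x) 0 := by
  have hq : 0 < p + 2 := by linarith
  have hq0 : ENNReal.ofReal (p + 2) ≠ 0 := by simpa using hq
  have hint : ∀ f : Space d → ℝ, MemLp f (ENNReal.ofReal (p + 2)) volume →
      Integrable (fun x => |f x| ^ (p + 2)) volume := fun f hf => by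
    have := hf.integrable_norm_rpow hq0 ENNReal.ofReal_ne_top
    rwa [ENNReal.toReal_ofReal hq.le] at this
  have hb : Integrable (fun x => (p + 2) * (|U x| + |Ψ x|) ^ (p + 2)) volume := by
    have h := hint (fun x => |U x| + |Ψ x|) (hU.norm.add hΨ.norm)
    refine (h.congr (ae_of_all _ fun x => ?_)).const_mul (p + 2)
    simp only
    rw [abs_of_nonneg (by positivity)]
  have hsm : ∀ ε : ℝ, AEStronglyMeasurable (fun x => U x + ε * Ψ x) volume := fun ε =>
    hU.1.add (hΨ.1.const_mul ε)
  have key := hasDerivAt_integral_of_dominated_loc_of_deriv_le (𝕜 := ℝ) (μ := volume)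
    (F := fun ε x => |U x + ε * Ψ x| ^ (p + 2))
    (F' := fun ε x => (p + 2) * |U x + ε * Ψ x| ^ (p + 2 - 2) * (U x + ε * Ψ x) * Ψ x)
    (x₀ := (0 : ℝ)) (s := Metric.ball 0 1) (bound := fun x => (p + 2) * (|U x| + |Ψ x|) ^ (p + 2))
    (Metric.ball_mem_nhds _ one_pos)
    (Eventually.of_forall fun ε => ((hsm ε).norm.aemeasurable.pow_const _).aestronglyMeasurable)
    (by simpa using hint U hU)
    ((((((hsm 0).norm.aemeasurable.pow_const _).const_mul (p + 2)).mul (hsm 0).aemeasurable).mul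
      hΨ.1.aemeasurable).aestronglyMeasurable)
    (ae_of_all _ fun x ε hε => ?_) hb (ae_of_all _ fun x ε _ => ?_)
  · obtain ⟨h1, h2⟩ := key
    have e : ∀ x, (p + 2) * |U x + 0 * Ψ x| ^ (p + 2 - 2) * (U x + 0 * Ψ x) * Ψ x
        = (p + 2) * (|U x| ^ p * U x * Ψ x) := by
      intro x
      rw [zero_mul, add_zero, add_sub_cancel_right]
      ring
    simp only [e] at h1 h2
    rw [integral_const_mul] at h2
    refine ⟨?_, h2⟩
    have h3 := h1.const_mul (p + 2)⁻¹
    simpa [hq.ne'] using h3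
  · have hε1 : |ε| ≤ 1 := by
      have : |ε| < 1 := by simpa using hε
      exact this.le
    have h1 : |U x + ε * Ψ x| ≤ |U x| + |Ψ x| := by
      refine (abs_add_le _ _).trans (add_le_add_right ?_ _)
      rw [abs_mul]
      exact mul_le_of_le_one_left (abs_nonneg _) hε1
    have h2 : |Ψ x| ≤ |U x| + |Ψ x| := le_add_of_nonneg_left (abs_nonneg _)
    have hs : 0 ≤ |U x| + |Ψ x| := by positivity
    rw [add_sub_cancel_right, Real.norm_eq_abs, abs_mul, abs_mul, abs_mul, abs_of_pos hq,
      abs_of_nonneg (by positivity : 0 ≤ |U x + ε * Ψ x| ^ p), mul_assoc, mul_assoc]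
    refine mul_le_mul_of_nonneg_left ?_ hq.le
    rw [Real.rpow_add' hs hq.ne', Real.rpow_two, sq]
    gcongr
  · have h1 := (hasDerivAt_abs_rpow (U x + ε * Ψ x) (by linarith : 1 < p + 2))
    have h2 : HasDerivAt (fun ε : ℝ => U x + ε * Ψ x) (1 * Ψ x) ε :=
      ((hasDerivAt_id ε).mul_const (Ψ x)).const_add (U x)
    rw [one_mul] at h2
    exact h1.comp ε h2

theorem hasDerivAt_powInt {p : ℝ} (hp : 0 < p) {U Ψ : Space d → ℝ}
    (hU : MemLp U (ENNReal.ofReal (p + 2)) volume)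
    (hΨ : MemLp Ψ (ENNReal.ofReal (p + 2)) volume) :
    HasDerivAt (fun ε : ℝ => powInt p ((fun x => (U x : ℂ)) + (ε : ℂ) • fun x => (Ψ x : ℂ)))
      ((p + 2) * ∫ x, |U x| ^ p * U x * Ψ x) 0 := by
  refine (hasDerivAt_integral_abs_rpow hp hU hΨ).2.congr_of_eventuallyEq (Eventually.of_forall ?_)
  intro ε
  refine integral_congr_ae (ae_of_all _ fun x => ?_)
  simp only [Pi.add_apply, Pi.smul_apply, smul_eq_mul]
  rw [← Complex.ofReal_mul, ← Complex.ofReal_add, Complex.norm_real, Real.norm_eq_abs]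

theorem hasDerivAt_gradSq {u w : Space d → ℂ} (hu : MemH1 u) (hw : MemH1 w) :
    HasDerivAt (fun ε : ℝ => gradSq (u + (ε : ℂ) • w)) (2 * gradInner u w) 0 := by
  simp only [gradSq_add_smul hu hw]
  have h1 := ((hasDerivAt_id (0 : ℝ)).const_mul 2).mul_const (gradInner u w)
  have h2 := ((hasDerivAt_id (0 : ℝ)).pow 2).mul_const (gradSq w)
  exact ((h1.const_add (gradSq u)).add h2).congr_deriv (by simp)

theorem continuous_mass_add_smul {u w : Space d → ℂ} (hu : MemH1 u) (hw : MemH1 w) :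
    Continuous fun ε : ℝ => mass (u + (ε : ℂ) • w) := by
  simp only [mass_add_smul hu hw]
  fun_prop

/-! ### The Lagrange multiplier of a dilation -/

/-- If a family of values of energy, virial and gradient cannot be improved by dilations, then the
derivatives at `0` satisfy the Lagrange condition of the dilation. -/
theorem lagrange_of_dilations (hd : 1 ≤ d) {e φ g : ℝ → ℝ} {e' φ' g' : ℝ}
    (he : HasDerivAt e e' 0) (hφ : HasDerivAt φ φ' 0) (hg : HasDerivAt g g' 0) (hφ0 : φ 0 = 0)
    (hg0 : 0 < g 0)
    (hmin : ∀ᶠ z : ℝ × ℝ in 𝓝 (0, 1),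
      z.2 * φ z.1 - z.2 * (1 - z.2 ^ (-(2 / (d : ℝ)))) * g z.1 ≤ 0 →
      e 0 ≤ z.2 * e z.1 - z.2 * (1 - z.2 ^ (-(2 / (d : ℝ)))) * g z.1) :
    e' + φ' * ((d * e 0 - 2 * g 0) / (2 * g 0)) = 0 := by
  have hd0 : (0 : ℝ) < d := by exact_mod_cast hd
  set δ := 2 / (d : ℝ) with hδ
  have hδ0 : 0 < δ := by positivity
  have hfac : ∀ τ : ℝ, HasDerivAt (fun ε : ℝ => (1 + τ * ε) * (1 - (1 + τ * ε) ^ (-δ)))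
      (τ * δ) 0 := by
    intro τ
    have h1 : HasDerivAt (fun ε : ℝ => 1 + τ * ε) τ 0 := by
      simpa using ((hasDerivAt_id (0 : ℝ)).const_mul τ).const_add 1
    have h2 : HasDerivAt (fun ε : ℝ => (1 + τ * ε) ^ (-δ)) (τ * -δ) 0 := by
      simpa using h1.rpow_const (p := -δ) (Or.inl (by simp))
    exact (h1.mul (h2.const_sub 1)).congr_deriv (by simp)
  have hlin : ∀ τ (f : ℝ → ℝ) (f' : ℝ), HasDerivAt f f' 0 →
      HasDerivAt (fun ε : ℝ => (1 + τ * ε) * f ε - (1 + τ * ε) * (1 - (1 + τ * ε) ^ (-δ)) * g ε)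
        (f' + τ * (f 0 - δ * g 0)) 0 := by
    intro τ f f' hf
    have h1 : HasDerivAt (fun ε : ℝ => 1 + τ * ε) τ 0 := by
      simpa using ((hasDerivAt_id (0 : ℝ)).const_mul τ).const_add 1
    have h2 := (h1.mul hf).sub ((hfac τ).mul hg)
    refine h2.congr_deriv ?_
    simp
    ring
  have hpath : ∀ τ : ℝ, ∀ᶠ ε : ℝ in 𝓝 0,
      (1 + τ * ε) * φ ε - (1 + τ * ε) * (1 - (1 + τ * ε) ^ (-δ)) * g ε ≤ 0 →
      e 0 ≤ (1 + τ * ε) * e ε - (1 + τ * ε) * (1 - (1 + τ * ε) ^ (-δ)) * g ε := by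
    intro τ
    have hc : Tendsto (fun ε : ℝ => (ε, 1 + τ * ε)) (𝓝 0) (𝓝 (0, 1)) := by
      have : Continuous fun ε : ℝ => (ε, 1 + τ * ε) := by fun_prop
      simpa using this.tendsto 0
    exact hc.eventually hmin
  -- Along θ = 1 + τε the virial has derivative φ' - τδg(0). For τ > τ₀ the points ε > 0 are
  -- admissible, for τ < τ₀ the points ε < 0; the two resulting inequalities for the energy
  -- derivative meet at τ₀.
  set τ₀ := φ' / (δ * g 0) with hτ₀
  have hδg : 0 < δ * g 0 := by positivity
  have hright : ∀ τ, τ₀ < τ → 0 ≤ e' + τ * (e 0 - δ * g 0) := by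
    intro τ hτ
    by_contra! hneg
    rw [hτ₀, div_lt_iff₀ hδg] at hτ
    have h1 := eventually_lt_right_of_deriv_neg (hlin τ φ φ' hφ) (by rw [hφ0]; linarith)
    have h2 := eventually_lt_right_of_deriv_neg (hlin τ e e' he) hneg
    obtain ⟨ε, ⟨h3, h4⟩, h5⟩ := ((h1.and h2).and
      ((hpath τ).filter_mono nhdsWithin_le_nhds)).exists
    simp only [mul_zero, add_zero, Real.one_rpow, sub_self, one_mul, hφ0, zero_mul, sub_zero]
      at h3 h4
    exact (h5 h3.le).not_gt h4
  have hleft : ∀ τ, τ < τ₀ → e' + τ * (e 0 - δ * g 0) ≤ 0 := by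
    intro τ hτ
    by_contra! hpos
    rw [hτ₀, lt_div_iff₀ hδg] at hτ
    have h1 := eventually_lt_left_of_deriv_pos (hlin τ φ φ' hφ) (by rw [hφ0]; linarith)
    have h2 := eventually_lt_left_of_deriv_pos (hlin τ e e' he) hpos
    obtain ⟨ε, ⟨h3, h4⟩, h5⟩ := ((h1.and h2).and
      ((hpath τ).filter_mono nhdsWithin_le_nhds)).exists
    simp only [mul_zero, add_zero, Real.one_rpow, sub_self, one_mul, hφ0, zero_mul, sub_zero]
      at h3 h4
    exact (h5 h3.le).not_gt h4
  have hcont : Continuous fun τ : ℝ => e' + τ * (e 0 - δ * g 0) := by fun_prop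
  have hz : e' + τ₀ * (e 0 - δ * g 0) = 0 := by
    refine le_antisymm ?_ ?_
    · refine le_of_tendsto ((hcont.tendsto τ₀).mono_left (nhdsWithin_le_nhds (s := Set.Iio τ₀))) ?_
      filter_upwards [self_mem_nhdsWithin] with τ hτ using hleft τ hτ
    · refine ge_of_tendsto ((hcont.tendsto τ₀).mono_left (nhdsWithin_le_nhds (s := Set.Ioi τ₀))) ?_
      filter_upwards [self_mem_nhdsWithin] with τ hτ using hright τ hτ
  refine Eq.trans ?_ hz
  rw [hτ₀, hδ]
  field_simp

/-! ### Testing the gradient against cutoffs -/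

/-- Both derivatives are put on φ, so that only the L² norm of u is needed against wide cutoffs. -/
theorem gradInner_ofReal_test {u : Space d → ℂ} (hu : MemH1 u) {φ : Space d → ℝ}
    (hφ : ContDiff ℝ (⊤ : ℕ∞) φ) (hc : HasCompactSupport φ) :
    gradInner u (fun x => (φ x : ℂ)) = -∑ i : Fin d, ∫ x, fderiv ℝ
      (fun y => fderiv ℝ φ y (EuclideanSpace.single i 1)) x (EuclideanSpace.single i 1)
        * (u x).re := by
  rw [gradInner, ← Finset.sum_neg_distrib]
  refine Finset.sum_congr rfl fun i _ => ?_
  set D : Space d → ℝ := fun y => fderiv ℝ φ y (EuclideanSpace.single i 1) with hD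
  have hDs : ContDiff ℝ (⊤ : ℕ∞) D := contDiff_fderiv_apply hφ _
  have hDc : HasCompactSupport D := hc.fderiv_apply (𝕜 := ℝ) _
  have hDL : MemLp (fun x => (D x : ℂ)) 2 volume :=
    memLp_two_of_test (Complex.continuous_ofReal.comp hDs.continuous) (hasCompactSupport_ofReal hDc) 2
  have hae := weakPartial_ae_eq hDL (isWeakPartial_ofReal_test i hφ hc)
  have h1 := hu.isWeakPartial i D hDs hDc
  have h2 := congrArg Complex.re h1
  rw [Complex.neg_re] at h2
  have e1 := integral_re (𝕜 := ℂ) (integrable_fderiv_test_smul hDs hDc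
    (EuclideanSpace.single i 1) hu.1)
  have e2 := integral_re (𝕜 := ℂ) (integrable_test_smul hDs.continuous hDc
    (hu.weakPartial_memLp i))
  simp only [RCLike.re_to_complex] at e1 e2
  rw [← e1, ← e2] at h2
  simp only [Complex.real_smul, Complex.re_ofReal_mul] at h2
  rw [h2, neg_neg]
  refine integral_congr_ae ?_
  filter_upwards [hae] with x hx
  rw [hx]
  simp [hD, mul_comm]

/-- With l = 1/(n+1), the rescaled function l²D(lx) has L² norm of order l^(2-d/2), bounded because
d ≤ 4. It lives outside the ball of radius n + 1, where the L² mass of u tends to 0. -/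
theorem tendsto_integral_cutoff (hd4 : d ≤ 4) {u : Space d → ℂ} (hu : MemLp u 2 volume)
    {D : Space d → ℝ} (hD : Continuous D) (hc : HasCompactSupport D)
    (h0 : ∀ x, ‖x‖ < 1 → D x = 0) :
    Tendsto (fun n : ℕ => ∫ x, (((n : ℝ) + 1)⁻¹ ^ 2 * D (((n : ℝ) + 1)⁻¹ • x)) * (u x).re) atTop
      (𝓝 0) := by
  set s : ℕ → Set (Space d) := fun n => {x | (n : ℝ) + 1 ≤ ‖x‖} with hs
  have hsm : ∀ n, MeasurableSet (s n) := fun n => measurableSet_le measurable_const measurable_norm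
  have hi := MemLp.integrable_norm_sq hu
  have hT : Tendsto (fun n => ∫ x in s n, ‖u x‖ ^ 2) atTop (𝓝 0) := by
    have h := tendsto_setIntegral_of_antitone (μ := volume) (f := fun x => ‖u x‖ ^ 2) hsm
      (fun m n hmn x (hx : (n : ℝ) + 1 ≤ ‖x‖) => show (m : ℝ) + 1 ≤ ‖x‖ from by
        have : (m : ℝ) ≤ n := by exact_mod_cast hmn
        linarith) ⟨0, hi.integrableOn⟩
    have he : ⋂ n, s n = ∅ := by
      ext x
      simp only [Set.mem_iInter, Set.mem_empty_iff_false, iff_false, not_forall]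
      obtain ⟨n, hn⟩ := exists_nat_gt ‖x‖
      exact ⟨n, fun h => by have : (n : ℝ) + 1 ≤ ‖x‖ := h
                            linarith⟩
    rwa [he, setIntegral_empty] at h
  have hD2 : MemLp D 2 volume := memLp_two_of_test hD hc 2
  have hDi : Integrable (fun x => D x ^ 2) volume := hD2.integrable_sq
  set K := ∫ x, D x ^ 2 with hK
  have hK0 : 0 ≤ K := integral_nonneg fun _ => sq_nonneg _
  have hbound : ∀ (n : ℕ) (t : ℝ), 0 < t →
      2 * |∫ x, (((n : ℝ) + 1)⁻¹ ^ 2 * D (((n : ℝ) + 1)⁻¹ • x)) * (u x).re|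
        ≤ t * (∫ x in s n, ‖u x‖ ^ 2) + t⁻¹ * K := by
    intro n t ht
    set l : ℝ := ((n : ℝ) + 1)⁻¹ with hl
    have hl0 : 0 < l := by positivity
    have hl1 : l ≤ 1 := inv_le_one_of_one_le₀ (by linarith [(Nat.cast_nonneg n : (0 : ℝ) ≤ n)])
    have hDl : Integrable (fun x => D (l • x) ^ 2) volume := hDi.comp_smul hl0.ne'
    have hI1 : Integrable (fun x => t * (s n).indicator (fun x => ‖u x‖ ^ 2) x) volume :=
      (hi.indicator (hsm n)).const_mul t
    have hI2 : Integrable (fun x => t⁻¹ * (l ^ 4 * D (l • x) ^ 2)) volume :=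
      (hDl.const_mul _).const_mul _
    have hpt : ∀ x, ‖2 * ((l ^ 2 * D (l • x)) * (u x).re)‖ ≤
        t * (s n).indicator (fun x => ‖u x‖ ^ 2) x + t⁻¹ * (l ^ 4 * D (l • x) ^ 2) := by
      intro x
      by_cases hx : x ∈ s n
      · rw [Set.indicator_of_mem hx]
        have h1 : |(u x).re| ≤ ‖u x‖ := Complex.abs_re_le_norm _
        rw [Real.norm_eq_abs, abs_mul, abs_mul, abs_mul, abs_of_pos (two_pos (α := ℝ)),
          abs_of_pos (by positivity : 0 < l ^ 2)]
        have h2 : 0 ≤ t⁻¹ * (t * ‖u x‖ - l ^ 2 * |D (l • x)|) ^ 2 := by positivity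
        have h3 : t⁻¹ * (t * ‖u x‖ - l ^ 2 * |D (l • x)|) ^ 2
            = t * ‖u x‖ ^ 2 + t⁻¹ * (l ^ 4 * D (l • x) ^ 2)
              - 2 * (l ^ 2 * |D (l • x)| * ‖u x‖) := by
          rw [← sq_abs (D (l • x))]
          field_simp
          ring
        have h4 : l ^ 2 * |D (l • x)| * |(u x).re| ≤ l ^ 2 * |D (l • x)| * ‖u x‖ := by gcongr
        linarith
      · have hx' : ‖x‖ < (n : ℝ) + 1 := not_le.1 hx
        have : D (l • x) = 0 := h0 _ (by
          rw [norm_smul, Real.norm_of_nonneg hl0.le, hl, inv_mul_lt_iff₀ (by positivity), mul_one]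
          exact hx')
        rw [Set.indicator_of_notMem hx, this]
        simp
    have h1 := norm_integral_le_of_norm_le (hI1.add hI2) (ae_of_all _ hpt)
    rw [integral_const_mul, norm_mul, Real.norm_of_nonneg (zero_le_two (α := ℝ)),
      Real.norm_eq_abs] at h1
    refine h1.trans ?_
    simp only [Pi.add_apply]
    rw [integral_add hI1 hI2, integral_const_mul, integral_const_mul, integral_const_mul,
      integral_indicator (hsm n), integral_comp_smul_space (fun x => D x ^ 2) hl0, smul_eq_mul,
      ← mul_assoc (l ^ 4)]
    have h2 : l ^ 4 * l ^ (-(d : ℝ)) ≤ 1 := by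
      have : l ^ 4 = l ^ (4 : ℝ) := by exact_mod_cast (Real.rpow_natCast l 4).symm
      rw [this, ← Real.rpow_add hl0]
      refine Real.rpow_le_one hl0.le hl1 ?_
      have : (d : ℝ) ≤ 4 := by exact_mod_cast hd4
      linarith
    gcongr
    exact mul_le_of_le_one_left hK0 h2
  rw [Metric.tendsto_atTop]
  intro ε hε
  set t := (K + 1) / ε with ht
  have ht0 : 0 < t := by positivity
  obtain ⟨N, hN⟩ := eventually_atTop.1 (hT.eventually (gt_mem_nhds (by positivity : 0 < ε / t)))
  refine ⟨N, fun n hn => ?_⟩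
  have h1 := hbound n t ht0
  have h2 := hN n hn
  rw [lt_div_iff₀ ht0] at h2
  have h3 : t⁻¹ * K < ε := by
    rw [ht, inv_div, div_mul_eq_mul_div, div_lt_iff₀ (by positivity)]
    nlinarith
  rw [dist_zero_right, Real.norm_eq_abs]
  linarith

theorem tendsto_gradInner_cutoff (hd4 : d ≤ 4) {u : Space d → ℂ} (hu : MemH1 u) {χ : Space d → ℝ}
    (hχ : ContDiff ℝ (⊤ : ℕ∞) χ) (hc : HasCompactSupport χ) (h1 : ∀ x, ‖x‖ ≤ 1 → χ x = 1) :
    Tendsto (fun n : ℕ => gradInner u (fun x => (χ (((n : ℝ) + 1)⁻¹ • x) : ℂ))) atTop (𝓝 0) := by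
  have hl0 : ∀ n : ℕ, ((n : ℝ) + 1)⁻¹ ≠ 0 := fun n => by positivity
  have e : ∀ n : ℕ, gradInner u (fun x => (χ (((n : ℝ) + 1)⁻¹ • x) : ℂ))
      = -∑ i : Fin d, ∫ x, (((n : ℝ) + 1)⁻¹ ^ 2 * fderiv ℝ
        (fun y => fderiv ℝ χ y (EuclideanSpace.single i 1)) (((n : ℝ) + 1)⁻¹ • x)
          (EuclideanSpace.single i 1)) * (u x).re := by
    intro n
    rw [gradInner_ofReal_test hu (φ := fun x => χ (((n : ℝ) + 1)⁻¹ • x))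
      (hχ.comp (contDiff_const_smul _)) (hc.comp_smul (hl0 n))]
    congr 1
    refine Finset.sum_congr rfl fun i _ => ?_
    refine integral_congr_ae (ae_of_all _ fun x => ?_)
    simp only
    have e1 : (fun y => fderiv ℝ (fun x => χ (((n : ℝ) + 1)⁻¹ • x)) y (EuclideanSpace.single i 1))
        = ((n : ℝ) + 1)⁻¹ • fun y => (fun z => fderiv ℝ χ z (EuclideanSpace.single i 1))
          (((n : ℝ) + 1)⁻¹ • y) := by
      funext y
      rw [fderiv_comp_smul]
      rfl
    have hdiff : DifferentiableAt ℝ (fun y => (fun z => fderiv ℝ χ z (EuclideanSpace.single i 1))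
        (((n : ℝ) + 1)⁻¹ • y)) x :=
      ((contDiff_fderiv_apply hχ (EuclideanSpace.single i 1)).comp
        (contDiff_const_smul _)).contDiffAt.differentiableAt (by simp)
    rw [e1, fderiv_const_smul hdiff, fderiv_comp_smul (f := fun z => fderiv ℝ χ z
      (EuclideanSpace.single i 1))]
    simp only [smul_apply, smul_eq_mul]
    ring
  simp only [e]
  rw [← neg_zero, ← Finset.sum_const_zero (s := (Finset.univ : Finset (Fin d)))]
  refine (tendsto_finsetSum _ fun i _ => ?_).neg
  have hDs := contDiff_fderiv_apply hχ (EuclideanSpace.single i 1)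
  have hDc : HasCompactSupport fun y => fderiv ℝ χ y (EuclideanSpace.single i 1) :=
    hc.fderiv_apply (𝕜 := ℝ) _
  refine tendsto_integral_cutoff hd4 hu.1 (continuous_fderiv_apply_of_contDiff hDs _)
    (hDc.fderiv_apply (𝕜 := ℝ) _) fun x hx => ?_
  have hb : ∀ y, ‖y‖ < 1 → fderiv ℝ χ y = 0 := by
    intro y hy
    have : χ =ᶠ[𝓝 y] fun _ => 1 := by
      filter_upwards [Metric.isOpen_ball.mem_nhds (mem_ball_zero_iff.2 hy)] with z hz
      exact h1 z (mem_ball_zero_iff.1 hz).le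
    rw [this.fderiv_eq]
    simp
  have : (fun y => fderiv ℝ χ y (EuclideanSpace.single i 1)) =ᶠ[𝓝 x] fun _ => 0 := by
    filter_upwards [Metric.isOpen_ball.mem_nhds (mem_ball_zero_iff.2 hx)] with z hz
    rw [hb z (mem_ball_zero_iff.1 hz)]
    rfl
  rw [this.fderiv_eq]
  simp
/-! ### Energy minimality under a slack mass constraint -/

section strictness

variable {p₀ p₁ : ℝ}

/-- `u` minimizes the energy among nonzero functions of mass at most `m` and nonpositive virial. -/
def IsVirialMinimal (p₀ p₁ m : ℝ) (u : Space d → ℂ) : Prop :=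
  ∀ v : Space d → ℂ, MemX p₀ v → 0 < mass v → mass v ≤ m → virial p₀ p₁ v ≤ 0 →
    energy p₀ p₁ u ≤ energy p₀ p₁ v

theorem MemX.re_memLp {p : ℝ} (hp : 0 ≤ p) (hpp : p ≤ p₀) (hp₀ : 0 < p₀) {U : Space d → ℝ}
    (hU : MemX p₀ fun x => (U x : ℂ)) : MemLp U (ENNReal.ofReal (p + 2)) volume := by
  simpa using (hU.memLp_of_le hp hpp hp₀).re

/-- Slack in the mass allows dilations with θ > 1, which keep Φ ≤ 0. Minimality makes the derivative
of the energy at θ = 1, namely E - 2G/d, nonnegative. -/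
theorem IsVirialMinimal.multiplier_nonneg (hd : 1 ≤ d) (hp₁ : 4 / (d : ℝ) < p₁) (hp : p₁ < p₀)
    {u : Space d → ℂ} (hu : MemX p₀ u) {m : ℝ} (hmin : IsVirialMinimal p₀ p₁ m u)
    (hm0 : 0 < mass u) (hm : mass u < m) (hv : virial p₀ p₁ u = 0) :
    2 * gradSq u ≤ d * energy p₀ p₁ u := by
  have hd0 : (0 : ℝ) < d := by exact_mod_cast hd
  have hp₁0 := (pos_of_four_div_lt hd hp₁).1
  by_contra! hcon
  have h1 : HasDerivAt (fun θ : ℝ => θ * energy p₀ p₁ u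
      - θ * (1 - θ ^ (-(2 / (d : ℝ)))) * gradSq u)
      (energy p₀ p₁ u - 2 / (d : ℝ) * gradSq u) 1 := by
    have h2 : HasDerivAt (fun θ : ℝ => θ ^ (-(2 / (d : ℝ)))) (-(2 / (d : ℝ))) 1 := by
      simpa using Real.hasDerivAt_rpow_const (x := 1) (p := -(2 / (d : ℝ))) (Or.inl one_ne_zero)
    have h3 := ((hasDerivAt_id (1 : ℝ)).mul_const (energy p₀ p₁ u)).sub
      (((hasDerivAt_id (1 : ℝ)).mul (h2.const_sub 1)).mul_const (gradSq u))
    exact h3.congr_deriv (by simp)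
  have hneg : energy p₀ p₁ u - 2 / (d : ℝ) * gradSq u < 0 := by
    rw [sub_neg, div_mul_eq_mul_div, lt_div_iff₀ hd0]
    linarith
  have h2 : Tendsto (fun θ : ℝ => θ * mass u) (𝓝[>] 1) (𝓝 (1 * mass u)) :=
    (tendsto_id.mono_left nhdsWithin_le_nhds).mul_const _
  rw [one_mul] at h2
  obtain ⟨θ, ⟨h3, h4⟩, h5⟩ := (((eventually_lt_right_of_deriv_neg h1 hneg).and
    (h2.eventually (gt_mem_nhds hm))).and self_mem_nhdsWithin).exists
  have hθ1 : 1 < θ := h5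
  have hθ0 : 0 < θ := by linarith
  obtain ⟨w, hw, hwm, hwG, hwP⟩ := exists_dilate hd (by linarith : 0 < p₀) hu hθ0
  have hf := sub_pos.2 (rpow_neg_two_div_lt_one hd hθ1)
  have hG := gradSq_nonneg u
  have h6 := hmin w hw (by rw [hwm]; positivity) (by rw [hwm]; exact h4.le) (by
    rw [virial_dilate hθ0 hwG hwP, hv, mul_zero, zero_sub, neg_nonpos]
    positivity)
  rw [energy_dilate hθ0 hwG hwP] at h6
  simp only [one_mul, Real.one_rpow, sub_self, zero_mul, sub_zero] at h3
  exact h6.not_gt h3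

/-- The Euler-Lagrange equation of a real minimizer. -/
theorem IsVirialMinimal.euler_lagrange (hd : 1 ≤ d) (hp₁ : 4 / (d : ℝ) < p₁) (hp : p₁ < p₀)
    {U Ψ : Space d → ℝ} (hu : MemX p₀ fun x => (U x : ℂ)) (hψ : MemX p₀ fun x => (Ψ x : ℂ)) {m : ℝ}
    (hmin : IsVirialMinimal p₀ p₁ m fun x => (U x : ℂ)) (hm0 : 0 < mass fun x => (U x : ℂ))
    (hm : (mass fun x => (U x : ℂ)) < m) (hv : (virial p₀ p₁ fun x => (U x : ℂ)) = 0) {ν : ℝ}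
    (hν : ν = (d * (energy p₀ p₁ fun x => (U x : ℂ)) - 2 * gradSq fun x => (U x : ℂ))
      / (2 * gradSq fun x => (U x : ℂ))) :
    Integrable (fun x => ((1 + ν * (d * p₁ / 4)) * (|U x| ^ p₁ * U x)
        - (1 + ν * (d * p₀ / 4)) * (|U x| ^ p₀ * U x)) * Ψ x) volume ∧
      (1 + ν) * gradInner (fun x => (U x : ℂ)) (fun x => (Ψ x : ℂ)) =
        ∫ x, ((1 + ν * (d * p₁ / 4)) * (|U x| ^ p₁ * U x)
          - (1 + ν * (d * p₀ / 4)) * (|U x| ^ p₀ * U x)) * Ψ x := by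
  have hp₁0 := (pos_of_four_div_lt hd hp₁).1
  have hp₀ : 0 < p₀ := by linarith
  set u : Space d → ℂ := fun x => (U x : ℂ) with hudef
  set ψ : Space d → ℂ := fun x => (Ψ x : ℂ) with hψdef
  have hU1 := MemX.re_memLp hp₁0.le hp.le hp₀ hu
  have hU0 := MemX.re_memLp hp₀.le le_rfl hp₀ hu
  have hΨ1 := MemX.re_memLp hp₁0.le hp.le hp₀ hψ
  have hΨ0 := MemX.re_memLp hp₀.le le_rfl hp₀ hψ
  have hi1 := (hasDerivAt_integral_abs_rpow hp₁0 hU1 hΨ1).1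
  have hi0 := (hasDerivAt_integral_abs_rpow hp₀ hU0 hΨ0).1
  have hd1 := hasDerivAt_powInt hp₁0 hU1 hΨ1
  have hd0 := hasDerivAt_powInt hp₀ hU0 hΨ0
  have hdG := hasDerivAt_gradSq hu.1 hψ.1
  set J₁ := ∫ x, |U x| ^ p₁ * U x * Ψ x with hJ₁
  set J₀ := ∫ x, |U x| ^ p₀ * U x * Ψ x with hJ₀
  have hint : ∀ x, ((1 + ν * (d * p₁ / 4)) * (|U x| ^ p₁ * U x)
        - (1 + ν * (d * p₀ / 4)) * (|U x| ^ p₀ * U x)) * Ψ x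
      = (1 + ν * (d * p₁ / 4)) * (|U x| ^ p₁ * U x * Ψ x)
        - (1 + ν * (d * p₀ / 4)) * (|U x| ^ p₀ * U x * Ψ x) := fun x => by ring
  simp only [hint]
  refine ⟨(hi1.const_mul _).sub (hi0.const_mul _), ?_⟩
  rw [integral_sub (hi1.const_mul _) (hi0.const_mul _), integral_const_mul, integral_const_mul]
  have hE := (hdG.sub (hd1.const_mul (2 / (p₁ + 2)))).add (hd0.const_mul (2 / (p₀ + 2)))
  have hΦ := (hdG.sub (hd1.const_mul (d * p₁ / (2 * (p₁ + 2))))).add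
    (hd0.const_mul (d * p₀ / (2 * (p₀ + 2))))
  have hz : u + ((0 : ℝ) : ℂ) • ψ = u := by simp
  have key := lagrange_of_dilations hd (e := fun ε : ℝ => energy p₀ p₁ (u + (ε : ℂ) • ψ))
    (φ := fun ε : ℝ => virial p₀ p₁ (u + (ε : ℂ) • ψ)) (g := fun ε : ℝ => gradSq (u + (ε : ℂ) • ψ))
    hE hΦ hdG (by simp only [hz]; exact hv) (by simp only [hz]; exact hu.1.gradSq_pos hd hm0) (by
      have hc := continuous_mass_add_smul hu.1 hψ.1
      have hc1 : Continuous fun z : ℝ × ℝ => mass (u + (z.1 : ℂ) • ψ) := hc.comp continuous_fst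
      have hc2 : Continuous fun z : ℝ × ℝ => z.2 * mass (u + (z.1 : ℂ) • ψ) :=
        continuous_snd.mul hc1
      have t1 := hc1.tendsto (0, 1)
      have t2 := hc2.tendsto (0, 1)
      have t3 : Tendsto (fun z : ℝ × ℝ => z.2) (𝓝 (0, 1)) (𝓝 1) := continuous_snd.tendsto (0, 1)
      simp only [hz, one_mul] at t1 t2
      -- The strict inequality on the mass leaves room for all nearby perturbations and dilations.
      filter_upwards [t1.eventually (lt_mem_nhds hm0), t2.eventually (gt_mem_nhds hm),
        t3.eventually (lt_mem_nhds one_pos)] with z h1 h2 h3 h4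
      obtain ⟨w, hw, hwm, hwG, hwP⟩ := exists_dilate hd hp₀ (hu.add (hψ.const_smul (z.1 : ℂ))) h3
      simp only [hz]
      rw [← energy_dilate h3 hwG hwP]
      rw [← virial_dilate h3 hwG hwP] at h4
      exact hmin w hw (by rw [hwm]; positivity) (by rw [hwm]; exact h2.le) h4)
  simp only [hz] at key
  rw [← hν] at key
  have e1 : 2 / (p₁ + 2) * ((p₁ + 2) * J₁) = 2 * J₁ := by field_simp
  have e2 : 2 / (p₀ + 2) * ((p₀ + 2) * J₀) = 2 * J₀ := by field_simp
  have e3 : d * p₁ / (2 * (p₁ + 2)) * ((p₁ + 2) * J₁) = d * p₁ / 2 * J₁ := by field_simp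
  have e4 : d * p₀ / (2 * (p₀ + 2)) * ((p₀ + 2) * J₀) = d * p₀ / 2 * J₀ := by field_simp
  rw [e1, e2, e3, e4] at key
  linarith

/-- The modulus keeps mass and powers and does not increase G, so its virial is nonpositive;
minimality then forces equality of the gradients. -/
theorem IsVirialMinimal.norm {u : Space d → ℂ} (hu : MemX p₀ u)
    {m : ℝ} (hmin : IsVirialMinimal p₀ p₁ m u) (hm0 : 0 < mass u) (hm : mass u ≤ m)
    (hv : virial p₀ p₁ u = 0) :
    (MemX p₀ fun x => ((‖u x‖ : ℝ) : ℂ)) ∧ (mass fun x => ((‖u x‖ : ℝ) : ℂ)) = mass u ∧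
      (virial p₀ p₁ fun x => ((‖u x‖ : ℝ) : ℂ)) = 0 ∧
      IsVirialMinimal p₀ p₁ m fun x => ((‖u x‖ : ℝ) : ℂ) := by
  have he : (fun x => ((‖u x‖ : ℝ) : ℂ)) = fun x => excess 0 (u x) := by
    funext x
    simp [excess]
  have h0 : excess 0 0 = 0 := by simp [excess]
  have hX : MemX p₀ fun x => ((‖u x‖ : ℝ) : ℂ) := he ▸ hu.comp_lipschitz (lipschitzWith_excess 0) h0
  have hG : (gradSq fun x => ((‖u x‖ : ℝ) : ℂ)) ≤ gradSq u :=
    he ▸ (hu.1.comp_lipschitz (lipschitzWith_excess 0) h0).2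
  have hM : (mass fun x => ((‖u x‖ : ℝ) : ℂ)) = mass u := by simp [mass]
  have hP : ∀ p, (powInt p fun x => ((‖u x‖ : ℝ) : ℂ)) = powInt p u := fun p => by simp [powInt]
  have h1 := hmin _ hX (hM ▸ hm0) (hM ▸ hm) (by
    rw [virial] at hv ⊢
    rw [hP, hP]
    linarith)
  have hG' : (gradSq fun x => ((‖u x‖ : ℝ) : ℂ)) = gradSq u := by
    refine hG.antisymm ?_
    rw [energy, energy, hP, hP] at h1
    linarith
  have hE : (energy p₀ p₁ fun x => ((‖u x‖ : ℝ) : ℂ)) = energy p₀ p₁ u := by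
    rw [energy, energy, hP, hP, hG']
  refine ⟨hX, hM, ?_, fun v => ?_⟩
  · rw [virial, hP, hP, hG']
    exact hv
  · rw [hE]
    exact hmin v

/-! ### Nonexistence of minimizers with slack mass. -/

/-- With ψ = (U-K)₊, the truncation min(U, K) = U - ψ has no larger gradient norm; expanding the
square gives 2⟨∇U, ∇ψ⟩ ≥ ‖∇ψ‖². -/
theorem gradInner_excess_nonneg {U : Space d → ℝ} (hU : ∀ x, 0 ≤ U x)
    (hu : MemH1 fun x => (U x : ℂ)) {K : ℝ} (hK : 0 < K) :
    0 ≤ gradInner (fun x => (U x : ℂ)) (fun x => ((max (U x - K) 0 : ℝ) : ℂ)) := by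
  have h0 : excess K 0 = 0 := by simp [excess, hK.le]
  have he : (fun x => ((max (U x - K) 0 : ℝ) : ℂ)) = fun x => excess K (U x : ℂ) := by
    funext x
    simp [excess, abs_of_nonneg (hU x)]
  have hψ : MemH1 fun x => ((max (U x - K) 0 : ℝ) : ℂ) :=
    he ▸ (hu.comp_lipschitz (lipschitzWith_excess K) h0).1
  have hT : LipschitzWith 1 fun z : ℂ => ((min ‖z‖ K : ℝ) : ℂ) := by
    refine LipschitzWith.of_dist_le_mul fun a b => ?_
    rw [dist_eq_norm, dist_eq_norm, ← Complex.ofReal_sub, Complex.norm_real, NNReal.coe_one,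
      one_mul]
    refine (abs_min_sub_min_le_max _ _ _ _).trans ?_
    rw [sub_self, abs_zero, max_eq_left (abs_nonneg _)]
    exact abs_norm_sub_norm_le a b
  have h1 := (hu.comp_lipschitz hT (by simp [hK.le])).2
  have h2 : (fun x => ((min ‖(U x : ℂ)‖ K : ℝ) : ℂ))
      = (fun x => (U x : ℂ)) + (((-1 : ℝ)) : ℂ) • fun x => ((max (U x - K) 0 : ℝ) : ℂ) := by
    funext x
    simp only [Pi.add_apply, Pi.smul_apply, smul_eq_mul, Complex.norm_real, Real.norm_eq_abs,
      abs_of_nonneg (hU x)]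
    rw [← Complex.ofReal_mul, ← Complex.ofReal_add]
    congr 1
    rcases le_total (U x) K with h | h
    · rw [min_eq_left h, max_eq_right (by linarith)]; ring
    · rw [min_eq_right h, max_eq_left (by linarith)]; ring
  rw [h2, gradSq_add_smul hu hψ] at h1
  have h3 := gradSq_nonneg fun x => ((max (U x - K) 0 : ℝ) : ℂ)
  linarith

/-- The equation is -(1+ν)ΔU = h₁U^(p₁+1) - h₀U^(p₀+1) in weak form with ν ≥ 0. Truncation shows U ≤
K, so the right side is nonnegative and U is superharmonic; a nontrivial nonnegative L² function of
this kind does not exist for d ≤ 4. -/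
theorem IsVirialMinimal.false_of_dim_le_four (hd : 1 ≤ d) (hd4 : d ≤ 4) (hp₁ : 4 / (d : ℝ) < p₁)
    (hp : p₁ < p₀) {U : Space d → ℝ} (hU : ∀ x, 0 ≤ U x) (hu : MemX p₀ fun x => (U x : ℂ)) {m : ℝ}
    (hmin : IsVirialMinimal p₀ p₁ m fun x => (U x : ℂ)) (hm0 : 0 < mass fun x => (U x : ℂ))
    (hm : (mass fun x => (U x : ℂ)) < m) (hv : (virial p₀ p₁ fun x => (U x : ℂ)) = 0) : False := by
  have hp₁0 := (pos_of_four_div_lt hd hp₁).1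
  have hp₀ : 0 < p₀ := by linarith
  have hpp : 0 < p₀ - p₁ := by linarith
  have hG := hu.1.gradSq_pos hd hm0
  obtain ⟨ν, hν⟩ : ∃ ν, ν = (d * (energy p₀ p₁ fun x => (U x : ℂ))
    - 2 * gradSq fun x => (U x : ℂ)) / (2 * gradSq fun x => (U x : ℂ)) := ⟨_, rfl⟩
  have hν0 : 0 ≤ ν := by
    rw [hν]
    exact div_nonneg (sub_nonneg.2 (hmin.multiplier_nonneg hd hp₁ hp hu hm0 hm hv)) (by positivity)
  have hEL := fun (Ψ : Space d → ℝ) (hψ : MemX p₀ fun x => (Ψ x : ℂ)) =>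
    hmin.euler_lagrange hd hp₁ hp hu hψ hm0 hm hv hν
  obtain ⟨h₁, hh₁⟩ : ∃ h, h = 1 + ν * (d * p₁ / 4) := ⟨_, rfl⟩
  obtain ⟨h₀, hh₀⟩ : ∃ h, h = 1 + ν * (d * p₀ / 4) := ⟨_, rfl⟩
  have hh₁0 : 0 < h₁ := by rw [hh₁]; positivity
  have hh₀0 : 0 < h₀ := by rw [hh₀]; positivity
  simp only [← hh₁, ← hh₀] at hEL
  set g : Space d → ℝ := fun x => h₁ * (|U x| ^ p₁ * U x) - h₀ * (|U x| ^ p₀ * U x) with hg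
  -- The positive zero of the nonlinearity, which is nonnegative on [0, K] and negative beyond.
  set K := (h₁ / h₀) ^ (1 / (p₀ - p₁)) with hK
  have hK0 : 0 < K := by positivity
  have hKp : h₀ * K ^ (p₀ - p₁) = h₁ := by
    rw [hK, ← Real.rpow_mul (by positivity), one_div_mul_cancel hpp.ne', Real.rpow_one]
    field_simp
  have hgx : ∀ x, 0 < U x → g x = U x ^ p₁ * U x * (h₁ - h₀ * U x ^ (p₀ - p₁)) := by
    intro x hx
    have : U x ^ p₀ = U x ^ p₁ * U x ^ (p₀ - p₁) := by
      rw [← Real.rpow_add hx]; congr 1; ring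
    simp only [hg]
    rw [abs_of_pos hx, this]
    ring
  have hgneg : ∀ x, K < U x → g x < 0 := by
    intro x hx
    have hx0 := hK0.trans hx
    rw [hgx x hx0]
    refine mul_neg_of_pos_of_neg (by positivity) ?_
    have := mul_lt_mul_of_pos_left (Real.rpow_lt_rpow hK0.le hx hpp) hh₀0
    linarith
  have hgpos : ∀ x, U x ≤ K → 0 ≤ g x := by
    intro x hx
    rcases (hU x).eq_or_lt with h | h
    · simp [hg, ← h]
    · rw [hgx x h]
      refine mul_nonneg (by positivity) ?_
      have := mul_le_mul_of_nonneg_left (Real.rpow_le_rpow h.le hx hpp.le) hh₀0.le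
      linarith
  -- Weak maximum principle: tested with (U-K)₊, the left side is nonnegative and the right side
  -- nonpositive, so the integrand vanishes.
  have hUK : ∀ᵐ x, U x ≤ K := by
    have he : (fun x => ((max (U x - K) 0 : ℝ) : ℂ)) = fun x => excess K (U x : ℂ) := by
      funext x
      simp [excess, abs_of_nonneg (hU x)]
    have hψ : MemX p₀ fun x => ((max (U x - K) 0 : ℝ) : ℂ) :=
      he ▸ hu.comp_lipschitz (lipschitzWith_excess K) (by simp [excess, hK0.le])
    obtain ⟨hi, h1⟩ := hEL _ hψ
    have h2 := gradInner_excess_nonneg hU hu.1 hK0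
    have hle : ∀ x, 0 ≤ -(g x * max (U x - K) 0) := by
      intro x
      rcases le_or_gt (U x) K with h | h
      · rw [max_eq_right (by linarith)]; simp
      · have := mul_nonneg (neg_nonneg.2 (hgneg x h).le) (le_max_right (U x - K) 0)
        linarith
    have h3 : ∫ x, -(g x * max (U x - K) 0) = 0 := by
      refine le_antisymm ?_ (integral_nonneg hle)
      rw [integral_neg, ← h1, neg_nonpos]
      positivity
    filter_upwards [(integral_eq_zero_iff_of_nonneg hle hi.neg).1 h3] with x hx
    by_contra! hlt
    rw [max_eq_left (by linarith)] at hx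
    have := mul_pos (neg_pos.2 (hgneg x hlt)) (sub_pos.2 hlt)
    have hx' : -(g x * (U x - K)) = 0 := hx
    linarith
  obtain ⟨χ, hχ, hc, hχ0, hχ1, hχb⟩ := exists_bump d
  have hl0 : ∀ n : ℕ, ((n : ℝ) + 1)⁻¹ ≠ 0 := fun n => by positivity
  have hcut := fun n : ℕ => hEL (fun x => χ (((n : ℝ) + 1)⁻¹ • x))
    (memX_ofReal_test p₀ (hχ.comp (contDiff_const_smul _)) (hc.comp_smul (hl0 n)))
  obtain ⟨hgU, hself⟩ := hEL U hu
  have hlim1 : Tendsto (fun n : ℕ => ∫ x, g x * χ (((n : ℝ) + 1)⁻¹ • x)) atTop (𝓝 0) := by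
    have := (tendsto_gradInner_cutoff hd4 hu.1 hχ hc hχb).const_mul (1 + ν)
    rw [mul_zero] at this
    exact this.congr fun n => (hcut n).2
  have hlim2 : Tendsto (fun n : ℕ => ∫ x, g x * U x * χ (((n : ℝ) + 1)⁻¹ • x)) atTop
      (𝓝 (∫ x, g x * U x)) := by
    refine tendsto_integral_of_dominated_convergence (fun x => ‖g x * U x‖) (fun n => ?_) hgU.norm
      (fun n => ae_of_all _ fun x => ?_) (ae_of_all _ fun x => ?_)
    · exact hgU.1.mul (hχ.continuous.comp (continuous_const_smul _)).aestronglyMeasurable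
    · rw [norm_mul, Real.norm_of_nonneg (hχ0 _)]
      exact mul_le_of_le_one_right (norm_nonneg _) (hχ1 _)
    · refine tendsto_const_nhds.congr' ?_
      obtain ⟨N, hN⟩ := exists_nat_gt ‖x‖
      filter_upwards [eventually_ge_atTop N] with n hn
      have hn' : (N : ℝ) ≤ n := by exact_mod_cast hn
      rw [hχb, mul_one]
      rw [norm_smul, Real.norm_of_nonneg (by positivity), inv_mul_le_iff₀ (by positivity)]
      linarith
  -- From U ≤ K and g ≥ 0, the integral of gUχₙ is at most K times that of gχₙ, which tends to 0.
  -- Testing with U itself makes the limit (1+ν)G > 0.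
  have hle : ∫ x, g x * U x ≤ 0 := by
    have h1 := hlim1.const_mul K
    rw [mul_zero] at h1
    refine le_of_tendsto_of_tendsto' hlim2 h1 fun n => ?_
    rw [← integral_const_mul]
    refine integral_mono_of_nonneg ?_ ((hcut n).1.const_mul K) ?_
    · filter_upwards [hUK] with x hx
      exact mul_nonneg (mul_nonneg (hgpos x hx) (hU x)) (hχ0 _)
    · filter_upwards [hUK] with x hx
      have := mul_le_mul_of_nonneg_right hx (mul_nonneg (hgpos x hx) (hχ0 (((n : ℝ) + 1)⁻¹ • x)))
      linarith
  rw [← hself, gradInner_self hu.1] at hle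
  have : 0 < (1 + ν) * gradSq fun x => (U x : ℂ) := by positivity
  linarith

/-- From Φ = 0, 4G = d(p₁a - p₀b), so positivity of G gives a > b. Then 2G ≤ dE reads (d-2)(p₁a -
p₀b) ≥ 4(a - b). But the left side is (d-2)p₁(a-b) - (d-2)(p₀-p₁)b, which is smaller than 4(a-b)
because (d-2)p₁ ≤ 4. -/
theorem IsVirialMinimal.false_of_le (hd : 5 ≤ d) (hp₁ : 4 / (d : ℝ) < p₁) (hp : p₁ < p₀)
    (h : p₀ ≤ 4 / ((d : ℝ) - 2)) {u : Space d → ℂ} (hu : MemX p₀ u) {m : ℝ}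
    (hmin : IsVirialMinimal p₀ p₁ m u) (hm0 : 0 < mass u) (hm : mass u < m)
    (hv : virial p₀ p₁ u = 0) : False := by
  have hd1 : 1 ≤ d := by linarith
  have hd5 : (5 : ℝ) ≤ d := by exact_mod_cast hd
  have hp₁0 := (pos_of_four_div_lt hd1 hp₁).1
  have hp₀ : 0 < p₀ := by linarith
  have h1 := hmin.multiplier_nonneg hd1 hp₁ hp hu hm0 hm hv
  have hG := hu.1.gradSq_pos hd1 hm0
  have ha := hu.pot_pos hp₁0 hp.le hm0
  have hb := hu.pot_pos hp₀ le_rfl hm0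
  rw [le_div_iff₀ (by linarith)] at h
  rw [virial_eq] at hv
  rw [energy_eq] at h1
  have hd0 : (0 : ℝ) < d := by linarith
  have h2 : p₀ * pot p₀ u < p₁ * pot p₁ u := by
    have : d / 4 * (p₀ * pot p₀ u) < d / 4 * (p₁ * pot p₁ u) := by linarith
    exact lt_of_mul_lt_mul_left this (by positivity)
  have h3 : pot p₀ u < pot p₁ u := by
    have : p₁ * pot p₀ u < p₁ * pot p₁ u := by nlinarith
    exact lt_of_mul_lt_mul_left this hp₁0.le
  have h4 : d * ((d - 2) * (p₁ * pot p₁ u - p₀ * pot p₀ u))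
      ≥ d * (4 * (pot p₁ u - pot p₀ u)) := by nlinarith
  have h5 : (d - 2) * (p₁ * pot p₁ u - p₀ * pot p₀ u) ≥ 4 * (pot p₁ u - pot p₀ u) :=
    le_of_mul_le_mul_left h4 hd0
  have h6 : (d - 2) * (p₁ * pot p₁ u - p₀ * pot p₀ u) < 4 * (pot p₁ u - pot p₀ u) := by
    have e : (d - 2) * (p₁ * pot p₁ u - p₀ * pot p₀ u)
        = (d - 2) * p₁ * (pot p₁ u - pot p₀ u) - (d - 2) * (p₀ - p₁) * pot p₀ u := by ring
    have h7 : (d - 2) * p₁ ≤ 4 := by nlinarith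
    have h8 : 0 < (d - 2) * (p₀ - p₁) * pot p₀ u := by
      have : 0 < (d : ℝ) - 2 := by linarith
      have : 0 < p₀ - p₁ := by linarith
      positivity
    have h9 := mul_le_mul_of_nonneg_right h7 (sub_pos.2 h3).le
    linarith
  linarith

theorem IsVirialMinimal.false (hd : 1 ≤ d) (hp₁ : 4 / (d : ℝ) < p₁) (hp : p₁ < p₀)
    (h : d ≤ 4 ∨ p₀ ≤ 4 / ((d : ℝ) - 2)) {u : Space d → ℂ} (hu : MemX p₀ u) {m : ℝ}
    (hmin : IsVirialMinimal p₀ p₁ m u) (hm0 : 0 < mass u) (hm : mass u < m)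
    (hv : virial p₀ p₁ u = 0) : False := by
  rcases le_or_gt d 4 with hd4 | hd4
  · obtain ⟨h1, h2, h3, h4⟩ := hmin.norm hu hm0 hm.le hv
    exact h4.false_of_dim_le_four hd hd4 hp₁ hp (fun x => norm_nonneg _) h1 (h2 ▸ hm0) (h2 ▸ hm) h3
  · exact hmin.false_of_le hd4 hp₁ hp (h.resolve_left (by omega)) hu hm0 hm hv

end strictness

/-! ### Attainment, strict monotonicity and semicontinuity -/

section attainment

variable {p₀ p₁ : ℝ}

/-- Monotonicity and the relaxed virial constraint extend minimality at mass m to all smaller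
positive masses and to Φ ≤ 0. -/
theorem isVirialMinimal_of_le (hd : 1 ≤ d) (hp₁ : 4 / (d : ℝ) < p₁) (hp : p₁ < p₀) {m : ℝ}
    {u : Space d → ℂ} (h : (energy p₀ p₁ u : EReal) ≤ minVirialEnergy d p₀ p₁ m) :
    IsVirialMinimal p₀ p₁ m u := fun _ hv hv0 hvm hvv => EReal.coe_le_coe_iff.1 <|
  h.trans <| (minVirialEnergy_antitone hd hp₁ hp hv0 hvm).trans <|
    minVirialEnergy_le_of_nonpos hd hp₁ hp hv hv0 hvv

/-- Compactness yields a function of mass at most m; mass strictly below m would be a slack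
minimizer, which cannot exist. -/
theorem exists_minimizer_of_lt_criticalMass (hd : 1 ≤ d) (hp₁ : 4 / (d : ℝ) < p₁) (hp : p₁ < p₀)
    (h : d ≤ 4 ∨ p₀ ≤ 4 / ((d : ℝ) - 2)) {m : ℝ} (hmt : criticalMassTilde d p₀ p₁ ≤ m)
    (hm : m < criticalMass d p₀ p₁) :
    ∃ w : Space d → ℂ, MemX p₀ w ∧ mass w = m ∧ virial p₀ p₁ w = 0 ∧
      (energy p₀ p₁ w : EReal) = minVirialEnergy d p₀ p₁ m := by
  have hm0 := (criticalMassTilde_pos hd hp₁ hp).trans_le hmt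
  obtain ⟨i, hi⟩ : ∃ i : ℝ, (i : EReal) = minVirialEnergy d p₀ p₁ m :=
    ⟨_, EReal.coe_toReal (minVirialEnergy_lt_top hd hp₁ hp hmt).ne
      ((EReal.bot_lt_zero.trans (minVirialEnergy_pos hd hp₁ hp hm0 hm)).ne')⟩
  have hex : ∀ n : ℕ, ∃ u : Space d → ℂ, MemX p₀ u ∧ mass u = m ∧ virial p₀ p₁ u = 0 ∧
      energy p₀ p₁ u ≤ i + 1 / ((n : ℝ) + 1) := by
    intro n
    have hlt : minVirialEnergy d p₀ p₁ m < ((i + 1 / ((n : ℝ) + 1) : ℝ) : EReal) := by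
      rw [← hi]
      exact EReal.coe_lt_coe_iff.2 (lt_add_of_pos_right _ (by positivity))
    obtain ⟨e, ⟨u, hu, hum, huv, rfl⟩, he⟩ := sInf_lt_iff.1 hlt
    exact ⟨u, hu, hum, huv, (EReal.coe_lt_coe_iff.1 he).le⟩
  choose u hu hum huv hue using hex
  have hlim : Tendsto (fun n : ℕ => i + 1 / ((n : ℝ) + 1)) atTop (𝓝 i) := by
    simpa using (tendsto_const_nhds (x := i)).add
      (tendsto_one_div_add_atTop_nhds_zero_nat (𝕜 := ℝ))
  obtain ⟨v, hv, hv0, hvm, hvv, hve⟩ := exists_virial_nonpos_of_tendsto hd hp₁ hp hm hu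
    (fun n => hum n ▸ hm0) (by simp only [hum]; exact tendsto_const_nhds) (fun n => (huv n).le) hue
    hlim
  obtain ⟨w, hw, hwm, hwv, hwe⟩ := exists_virial_eq_zero_of_nonpos hd hp₁ hp hv hv0 hvv
  have hle : (energy p₀ p₁ w : EReal) ≤ minVirialEnergy d p₀ p₁ m := by
    rw [← hi]
    exact EReal.coe_le_coe_iff.2 (hwe.trans hve)
  have hwm' : mass w = m := by
    by_contra hne
    exact (isVirialMinimal_of_le hd hp₁ hp hle).false hd hp₁ hp h hw (hwm ▸ hv0)
      ((hwm.trans_le hvm).lt_of_ne hne) hwv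
  exact ⟨w, hw, hwm', hwv, hle.antisymm (hwm' ▸ minVirialEnergy_le hw hwv)⟩

theorem exists_minimizer (hd : 1 ≤ d) (hp₁ : 4 / (d : ℝ) < p₁) (hp : p₁ < p₀)
    (h : d ≤ 4 ∨ p₀ ≤ 4 / ((d : ℝ) - 2)) {m : ℝ} (hmt : criticalMassTilde d p₀ p₁ ≤ m) :
    ∃ w : Space d → ℂ, MemX p₀ w ∧ mass w = m ∧ virial p₀ p₁ w = 0 ∧
      (energy p₀ p₁ w : EReal) = minVirialEnergy d p₀ p₁ m := by
  rcases le_or_gt (criticalMass d p₀ p₁) m with hm | hm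
  · exact exists_minimizer_of_criticalMass_le hd hp₁ hp hm
  · exact exists_minimizer_of_lt_criticalMass hd hp₁ hp h hmt hm

/-- Equal values at two masses would turn a minimizer at the smaller mass into a slack minimizer for
the larger. -/
theorem minVirialEnergy_strictAntiOn (hd : 1 ≤ d) (hp₁ : 4 / (d : ℝ) < p₁) (hp : p₁ < p₀)
    (h : d ≤ 4 ∨ p₀ ≤ 4 / ((d : ℝ) - 2)) :
    StrictAntiOn (minVirialEnergy d p₀ p₁) (Set.Ici (criticalMassTilde d p₀ p₁)) := by
  intro m₁ hm₁ m₂ _ hlt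
  have hm₁0 : 0 < m₁ := (criticalMassTilde_pos hd hp₁ hp).trans_le hm₁
  refine (minVirialEnergy_antitone hd hp₁ hp hm₁0 hlt.le).lt_of_ne fun heq => ?_
  obtain ⟨w, hw, hwm, hwv, hwe⟩ := exists_minimizer hd hp₁ hp h hm₁
  exact (isVirialMinimal_of_le hd hp₁ hp (hwe.trans heq.symm).le).false hd hp₁ hp h hw
    (hwm ▸ hm₁0) (hwm ▸ hlt) hwv

/-! ### Lower semicontinuity. -/

/-- For m ≥ m_c the virial constraint is immaterial, so dilating down to mass m suffices, with
bounded G making the defect vanish. For m < m_c the compactness dichotomy applies. -/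
theorem minVirialEnergy_le_of_tendsto (hd : 1 ≤ d) (hp₁ : 4 / (d : ℝ) < p₁) (hp : p₁ < p₀)
    {m z : ℝ} (hm0 : 0 < m) {u : ℕ → Space d → ℂ} (hu : ∀ n, MemX p₀ (u n))
    (hmu : ∀ n, m < mass (u n)) (hum : Tendsto (fun n => mass (u n)) atTop (𝓝 m))
    (hv : ∀ n, virial p₀ p₁ (u n) = 0) (hue : ∀ n, energy p₀ p₁ (u n) ≤ z) :
    minVirialEnergy d p₀ p₁ m ≤ (z : EReal) := by
  have hu0 : ∀ n, 0 < mass (u n) := fun n => hm0.trans (hmu n)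
  rcases le_or_gt (criticalMass d p₀ p₁) m with hm | hm
  · have hp₁0 := (pos_of_four_div_lt hd hp₁).1
    rw [minVirialEnergy_eq_minEnergy hd hp₁ hp hm]
    obtain ⟨M, hM⟩ := hum.bddAbove_range
    obtain ⟨C, hC, hb⟩ := exists_energy_bound (d := d) hp₁0 hp
    have hG : ∀ n, gradSq (u n) ≤ z + C * M := fun n => by
      have h1 := hb (u n) (hu n)
      have h2 : 0 ≤ 1 / (p₀ + 2) * powInt p₀ (u n) := mul_nonneg (by
        have := hp₁0.trans hp
        positivity) (powInt_nonneg _ _)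
      have h3 := mul_le_mul_of_nonneg_left (hM ⟨n, rfl⟩ : mass (u n) ≤ M) hC.le
      linarith [hue n]
    have hθ : Tendsto (fun n => m / mass (u n)) atTop (𝓝 1) := by
      have := (tendsto_const_nhds (x := m)).div hum hm0.ne'
      rwa [div_self hm0.ne'] at this
    have hlim := (tendsto_dilate_factor z (z + C * M) (-(2 / (d : ℝ)))).comp hθ
    have hlim' := (continuous_coe_real_ereal.tendsto z).comp hlim
    refine ge_of_tendsto' hlim' fun n => ?_
    have hθ0 : 0 < m / mass (u n) := div_pos hm0 (hu0 n)
    obtain ⟨w, hw, hwm, hwG, hwP⟩ := exists_dilate hd (by linarith : 0 < p₀) (hu n) hθ0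
    rw [div_mul_cancel₀ _ (hu0 n).ne'] at hwm
    rw [← hwm]
    refine (minEnergy_le hw).trans (EReal.coe_le_coe_iff.2 ?_)
    rw [energy_dilate hθ0 hwG hwP, hwm]
    have h1 : 1 ≤ (m / mass (u n)) ^ (-(2 / (d : ℝ))) :=
      Real.one_le_rpow_of_pos_of_le_one_of_nonpos hθ0 ((div_le_one (hu0 n)).2 (hmu n).le)
        (neg_nonpos.2 (by positivity))
    have h2 := mul_le_mul_of_nonneg_left (hue n) hθ0.le
    have h3 := mul_le_mul_of_nonneg_left (hG n)
      (mul_nonneg hθ0.le (sub_nonneg.2 h1))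
    simp only [Function.comp]
    linarith
  · obtain ⟨w, hw, hw0, hwm, hwv, hwe⟩ := exists_virial_nonpos_of_tendsto hd hp₁ hp hm hu hu0 hum
      (fun n => (hv n).le) hue (tendsto_const_nhds (x := z))
    exact (minVirialEnergy_antitone hd hp₁ hp hw0 hwm).trans
      ((minVirialEnergy_le_of_nonpos hd hp₁ hp hw hw0 hwv).trans (EReal.coe_le_coe_iff.2 hwe))

theorem minVirialEnergy_lowerSemicontinuousOn (hd : 1 ≤ d) (hp₁ : 4 / (d : ℝ) < p₁)
    (hp : p₁ < p₀) : LowerSemicontinuousOn (minVirialEnergy d p₀ p₁)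
      (Set.Ici (criticalMassTilde d p₀ p₁)) := by
  intro m hm y hy
  by_contra hcon
  have hm0 : 0 < m := (criticalMassTilde_pos hd hp₁ hp).trans_le hm
  obtain ⟨x, hx, hxy⟩ := exists_seq_forall_of_frequently
    ((not_eventually.1 hcon).and_eventually self_mem_nhdsWithin)
  obtain ⟨z, hyz, hz⟩ := EReal.lt_iff_exists_real_btwn.1 hy
  have hlt : ∀ n, minVirialEnergy d p₀ p₁ (x n) < z := fun n => (not_lt.1 (hxy n).1).trans_lt hyz
  -- Monotonicity already settles masses at or below m, so only approach from the right matters.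
  have hmx : ∀ n, m < x n := by
    intro n
    by_contra! hle
    exact ((hlt n).trans hz).not_ge (minVirialEnergy_antitone hd hp₁ hp
      ((criticalMassTilde_pos hd hp₁ hp).trans_le (hxy n).2) hle)
  have hex : ∀ n, ∃ u : Space d → ℂ, MemX p₀ u ∧ mass u = x n ∧ virial p₀ p₁ u = 0 ∧
      energy p₀ p₁ u ≤ z := by
    intro n
    obtain ⟨e, ⟨u, hu, hum, huv, rfl⟩, he⟩ := sInf_lt_iff.1 (hlt n)
    exact ⟨u, hu, hum, huv, (EReal.coe_lt_coe_iff.1 he).le⟩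
  choose u hu hum huv hue using hex
  refine hz.not_ge (minVirialEnergy_le_of_tendsto hd hp₁ hp hm0 hu (fun n => ?_) ?_ huv hue)
  · rw [hum]
    exact hmx n
  · simp only [hum]
    exact hx.mono_right nhdsWithin_le_nhds

end attainment
end

end DoublePowerNLS

/-! ### The theorem. -/

open DoublePowerNLS in
theorem theorem3p8 (d : ℕ) (hd : 1 ≤ d) (p₀ p₁ : ℝ) (hp₁ : 4 / (d : ℝ) < p₁) (hp : p₁ < p₀) :
    -- `m_c` is a genuine critical mass
    (0 < criticalMass d p₀ p₁ ∧
      (∀ m : ℝ, 0 ≤ m → m ≤ criticalMass d p₀ p₁ → minEnergy d p₀ p₁ m = 0) ∧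
      (∀ m : ℝ, criticalMass d p₀ p₁ < m → minEnergy d p₀ p₁ m < 0)) ∧
    -- positivity of the virial functional
    (∀ u : Space d → ℂ, MemX p₀ u →
      0 < mass u → mass u < criticalMass d p₀ p₁ →
      0 < energy p₀ p₁ u → (energy p₀ p₁ u : EReal) < minVirialEnergy d p₀ p₁ (mass u) →
      0 < virial p₀ p₁ u) ∧
    (∀ m : ℝ, 0 < m → m < criticalMassTilde d p₀ p₁ → minVirialEnergy d p₀ p₁ m = ⊤) ∧
    (∀ m : ℝ, criticalMassTilde d p₀ p₁ ≤ m → m < criticalMass d p₀ p₁ →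
      0 < minVirialEnergy d p₀ p₁ m ∧ minVirialEnergy d p₀ p₁ m < ⊤) ∧
    (∀ m : ℝ, criticalMass d p₀ p₁ ≤ m → minVirialEnergy d p₀ p₁ m = minEnergy d p₀ p₁ m) ∧
    AntitoneOn (minVirialEnergy d p₀ p₁) (Set.Ici (criticalMassTilde d p₀ p₁)) ∧
    (d ≤ 4 ∨ p₀ ≤ 4 / ((d : ℝ) - 2) →
      (∀ m : ℝ, criticalMassTilde d p₀ p₁ ≤ m →
        ∃ u : Space d → ℂ, MemX p₀ u ∧ mass u = m ∧ virial p₀ p₁ u = 0 ∧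
          (energy p₀ p₁ u : EReal) = minVirialEnergy d p₀ p₁ m) ∧
      StrictAntiOn (minVirialEnergy d p₀ p₁) (Set.Ici (criticalMassTilde d p₀ p₁)) ∧
      LowerSemicontinuousOn (minVirialEnergy d p₀ p₁)
        (Set.Ici (criticalMassTilde d p₀ p₁))) := by
  refine ⟨⟨criticalMass_pos hd hp₁ hp, fun m => minEnergy_eq_zero_of_le hd hp₁ hp,
    fun m => minEnergy_neg hd hp₁ hp⟩, fun u hu hm0 _ _ he => ?_,
    fun m => minVirialEnergy_eq_top hd hp₁ hp, fun m hmt hm =>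
      ⟨minVirialEnergy_pos hd hp₁ hp ((criticalMassTilde_pos hd hp₁ hp).trans_le hmt) hm,
        minVirialEnergy_lt_top hd hp₁ hp hmt⟩,
    fun m => minVirialEnergy_eq_minEnergy hd hp₁ hp, fun m hm m' _ hmm =>
      minVirialEnergy_antitone hd hp₁ hp ((criticalMassTilde_pos hd hp₁ hp).trans_le hm) hmm,
    fun h => ⟨fun m => exists_minimizer hd hp₁ hp h, minVirialEnergy_strictAntiOn hd hp₁ hp h,
      minVirialEnergy_lowerSemicontinuousOn hd hp₁ hp⟩⟩
  -- A nonpositive virial would put I^Φ at or below the energy of u.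
  by_contra! hv
  exact he.not_ge (minVirialEnergy_le_of_nonpos hd hp₁ hp hu hm0 hv)
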